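/- Let $K$ be an algebraically closed field of characteristic zero. A curve in $\mathbb P^n\times\mathbb P^m$ has bidegree $(a,b)$ if its intersection numbers with the pullbacks of the hyperplane classes of $\mathbb P^n$ and $\mathbb P^m$ are $a$ and $b$ respectively. A statement holds for $k$ general points of $\mathbb P^n\times\mathbb P^m$ if it holds for all $k$-tuples in some nonempty Zariski-open subset of $(\mathbb P^n\times\mathbb P^m)^k$. (a) Let $n\ge 0$. Given $n+3$ general points in $\mathbb P^n\times\mathbb P^{n+1}$, there is a unique irreducible curve of bidegree $(n,n+1)$ passing through all the points. This curve (called the distinguished rational curve determined by the points) is smooth and rational. (b) Let $n\ge 0$ and $0\le s\le n+2$. Given $s$ general points in $\mathbb P^n\times\mathbb P^{n+1}$, the union of all irreducible curves of bidegree $(n,n+1)$ passing through all the points is Zariski-dense in $\mathbb P^n\times\mathbb P^{n+1}$. (c) Let $d\ge s\ge 1$ and $0\le k<d+2$. Given $k$ general points in $\mathbb P^1\times\mathbb P^s$, the union of all irreducible curves of bidegree $(1,d)$ passing through all the points is Zariski-dense in $\mathbb P^1\times\mathbb P^s$. -/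

import Mathlib

open MvPolynomial Topology
open scoped LinearAlgebra.Projectivization

namespace BiProjective

/-- The points of `ℙⁿ × ℙᵐ` over the field `K`. -/
@[ext]
structure BiProj (K : Type*) [Field K] (n m : ℕ) where
  fst : ℙ K (Fin (n + 1) → K)
  snd : ℙ K (Fin (m + 1) → K)

/-- Index set of the bihomogeneous coordinates `x₀, …, xₙ, y₀, …, yₘ` on `ℙⁿ × ℙᵐ`. -/
abbrev Coord (n m : ℕ) : Type := Fin (n + 1) ⊕ Fin (m + 1)

/-- The bigrading of `K[x₀, …, xₙ, y₀, …, yₘ]`: each `xᵢ` has bidegree `(1, 0)` and each `yⱼ` has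
bidegree `(0, 1)`. -/
def biWeight (n m : ℕ) : Coord n m → ℕ × ℕ :=
  Sum.elim (fun _ => (1, 0)) (fun _ => (0, 1))

/-- The multigrading of the coordinate ring of `(ℙⁿ × ℙᵐ)ᵏ`: the bigrading, separately for each
of the `k` factors. -/
def tupleWeight (n m k : ℕ) : Fin k × Coord n m → (Fin k → ℕ × ℕ) :=
  fun a => Pi.single a.1 (biWeight n m a.2)

section

variable {K : Type*} [Field K] {n m : ℕ}

/-- Bihomogeneous coordinates of a point. (They depend on a choice of representatives; the
vanishing of a bihomogeneous polynomial at them does not.) -/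
noncomputable def BiProj.coord (p : BiProj K n m) : Coord n m → K :=
  Sum.elim p.fst.rep p.snd.rep

/-- The topology whose basic open sets are the non-vanishing loci of the (multi)homogeneous
polynomials for the grading given by the weights `w`, evaluated through the coordinates `x`. -/
@[reducible]
def zariski {X σ M : Type*} [AddCommMonoid M] (x : X → σ → K) (w : σ → M) : TopologicalSpace X :=
  TopologicalSpace.generateFrom
    {U | ∃ (F : MvPolynomial σ K) (d : M), IsWeightedHomogeneous w F d ∧
      U = {p | eval (x p) F ≠ 0}}

/-- The Zariski topology on `ℙⁿ × ℙᵐ`. -/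
noncomputable instance : TopologicalSpace (BiProj K n m) := zariski BiProj.coord (biWeight n m)

/-- The Zariski topology on `(ℙⁿ × ℙᵐ)ᵏ` (which is not the product topology). -/
@[reducible]
noncomputable def zariskiTuples (K : Type*) [Field K] (n m k : ℕ) : TopologicalSpace (Fin k → BiProj K n m) :=
  zariski (fun p (a : Fin k × Coord n m) => (p a.1).coord a.2) (tupleWeight n m k)

/-- The property `P` holds for `k` general points of `ℙⁿ × ℙᵐ`: it holds for all `k`-tuples in a
nonempty Zariski-open subset of the irreducible variety `(ℙⁿ × ℙᵐ)ᵏ`. -/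
def ForGeneralPoints {k : ℕ} (P : (Fin k → BiProj K n m) → Prop) : Prop :=
  ∃ U : Set (Fin k → BiProj K n m),
    IsOpen[zariskiTuples K n m k] U ∧ U.Nonempty ∧ ∀ p ∈ U, P p

/-- An irreducible curve in `ℙⁿ × ℙᵐ`: a Zariski-closed irreducible subset of dimension one. -/
def IsIrreducibleCurve (C : Set (BiProj K n m)) : Prop :=
  IsClosed C ∧ IsIrreducible C ∧ topologicalKrullDim C = 1

/-- The bihomogeneous ideal of a subset `C` of `ℙⁿ × ℙᵐ`, generated by all the bihomogeneous
polynomials that vanish on `C`. -/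
noncomputable def idealOf (C : Set (BiProj K n m)) : Ideal (MvPolynomial (Coord n m) K) :=
  Ideal.span {F | (∃ d, IsWeightedHomogeneous (biWeight n m) F d) ∧ ∀ p ∈ C, eval p.coord F = 0}

/-- The bihomogeneous coordinate ring of `C`. -/
abbrev CoordRing (C : Set (BiProj K n m)) : Type _ :=
  MvPolynomial (Coord n m) K ⧸ idealOf C

/-- The bigraded Hilbert function of `C`: the dimension of the part of bidegree `(u, v)` of the
bihomogeneous coordinate ring of `C`. -/
noncomputable def hilbertFunction (C : Set (BiProj K n m)) (u v : ℕ) : ℕ :=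
  Module.finrank K ((weightedHomogeneousSubmodule K (biWeight n m) (u, v)).map
    (Ideal.Quotient.mkₐ K (idealOf C)).toLinearMap)

/-- The curve `C` has bidegree `(a, b)`, that is, `H₁ · C = a` and `H₂ · C = b`, where `H₁` and
`H₂` are the pullbacks of the hyperplane classes of `ℙⁿ` and of `ℙᵐ`: the degree of the line bundle
`𝒪(u, v) = u H₁ + v H₂` on `C` is `a u + b v`, so the bigraded Hilbert polynomial of `C` is
`a u + b v + c`, where the constant `c` is the Euler characteristic of `𝒪_C`. -/
def HasBidegree (C : Set (BiProj K n m)) (a b : ℕ) : Prop :=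
  ∃ (c : ℤ) (N : ℕ), ∀ u v : ℕ, N ≤ u → N ≤ v → (hilbertFunction C u v : ℤ) = a * u + b * v + c

/-- The tangent space, at the coordinates of `p`, of the cone in `Kⁿ⁺¹ × Kᵐ⁺¹` over `C`: the common
kernel of the differentials at that point of all the elements of the ideal of `C`. -/
noncomputable def coneTangentSpace (C : Set (BiProj K n m)) (p : BiProj K n m) :
    Submodule K (Coord n m → K) :=
  ⨅ F ∈ idealOf C, LinearMap.ker
    (∑ a, eval p.coord (pderiv a F) • (LinearMap.proj a : (Coord n m → K) →ₗ[K] K))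

/-- Smoothness of a curve `C`, by the Jacobian criterion. The cone over `C` is, away from the
irrelevant locus, a bundle over `C` with two-dimensional fibres, so the tangent space of `C` at `p`
has dimension one exactly when the tangent space of the cone has dimension `1 + 2`. -/
def IsSmoothCurve (C : Set (BiProj K n m)) : Prop :=
  ∀ p ∈ C, Module.finrank K (coneTangentSpace C p) = 1 + 2

/-- The function field of an irreducible closed subset `C`: the fractions `f / g` of elements of
the bihomogeneous coordinate ring with `f` and `g` bihomogeneous of the same bidegree. -/
noncomputable def functionField (C : Set (BiProj K n m)) : Subalgebra K (FractionRing (CoordRing C)) where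
  carrier := {z | ∃ (d : ℕ × ℕ) (f g : MvPolynomial (Coord n m) K),
    IsWeightedHomogeneous (biWeight n m) f d ∧ IsWeightedHomogeneous (biWeight n m) g d ∧
    Ideal.Quotient.mk (idealOf C) g ∈ nonZeroDivisors (CoordRing C) ∧
    z * algebraMap (CoordRing C) _ (Ideal.Quotient.mk (idealOf C) g) =
      algebraMap (CoordRing C) _ (Ideal.Quotient.mk (idealOf C) f)}
  mul_mem' := by
    rintro z z' ⟨d, f, g, hf, hg, h0, h⟩ ⟨d', f', g', hf', hg', h0', h'⟩
    refine ⟨d + d', f * f', g * g', hf.mul hf', hg.mul hg', ?_, ?_⟩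
    · rw [map_mul]; exact mul_mem h0 h0'
    · simp only [map_mul]; rw [← h, ← h']; ring
  add_mem' := by
    rintro z z' ⟨d, f, g, hf, hg, h0, h⟩ ⟨d', f', g', hf', hg', h0', h'⟩
    refine ⟨d + d', f * g' + g * f', g * g', (hf.mul hg').add (hg.mul hf'), hg.mul hg', ?_, ?_⟩
    · rw [map_mul]; exact mul_mem h0 h0'
    · simp only [map_mul, map_add]; rw [← h, ← h']; ring
  algebraMap_mem' r := by
    refine ⟨0, MvPolynomial.C r, 1, isWeightedHomogeneous_C _ r, isWeightedHomogeneous_one K _, ?_, ?_⟩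
    · rw [map_one]; exact one_mem _
    · rw [map_one, map_one, mul_one, IsScalarTower.algebraMap_apply K (CoordRing C)]
      rfl

/-- Rationality of an irreducible curve: its function field is `K`-isomorphic to `K(t)`. -/
def IsRationalCurve (C : Set (BiProj K n m)) : Prop :=
  Nonempty (functionField C ≃ₐ[K] RatFunc K)

/-- `C` is an irreducible curve of bidegree `(a, b)` that passes through the points `p i`. -/
def IsCurveThrough {k : ℕ} (p : Fin k → BiProj K n m) (a b : ℕ) (C : Set (BiProj K n m)) : Prop :=
  IsIrreducibleCurve C ∧ HasBidegree C a b ∧ ∀ i, p i ∈ C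

/-- The locus swept out by the irreducible curves of bidegree `(a, b)` through the points `p i`:
the union of these curves. -/
def sweptLocus {k : ℕ} (p : Fin k → BiProj K n m) (a b : ℕ) : Set (BiProj K n m) :=
  ⋃₀ {C | IsCurveThrough p a b C}

end

end BiProjective

/-!
The proof realises all the curves that are needed by explicit parametrisations, and shows the
uniqueness in the first statement by a Bézout argument on the Hilbert function.

*Generality.* A property holds for general tuples as soon as it holds for all tuples having some
representatives outside the zero locus of one nonzero polynomial `G`, which need not be
multihomogeneous (`forGeneralPoints_of_polynomial`): by the linear independence of characters, a
nonzero multihomogeneous component of `G` cuts out the required open set. It follows that if `N`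
general points lie on an irreducible curve of a given bidegree, then the curves of that bidegree
through fewer than `N` general points sweep out a dense set, because one more point may be chosen in
any given open set (`dense_sweptLocus_of_exists`). So the two density statements reduce to the
existence of curves through `n + 3`, respectively `d + 2`, general points.

*Parametrised curves.* Let `φ` and `ψ` be tuples of binary forms of degrees `a` and `b` such that
the bihomogeneous polynomials of large bidegree `(u, v)` pull back onto all the forms of degree
`a u + b v` (`IsParam`). Then the image of `ℙ¹` is closed, irreducible, of dimension one, of
bidegree `(a, b)`, since its Hilbert function is `a u + b v + 1`, and rational. If moreover `φ` and
`ψ` are bases of the forms of their degrees (`IsNormalParam`), then the cone over the curve has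
tangent spaces of dimension three, so the curve is smooth.

*The distinguished curve.* After a change of coordinates, `n + 3` general points of `ℙⁿ × ℙⁿ⁺¹` have
as their components in `ℙⁿ` the coordinate points, a point `c` and the unit point, and in `ℙⁿ⁺¹` the
coordinate points and the unit point (`exists_frame`). A pair of rational normal curves, given by
the Lagrange polynomials of the nodes `-1 / c i` and of these nodes together with `0`, passes
through these points. For the uniqueness, let `C` be any irreducible curve of bidegree `(n, n + 1)`
through the points. On `C`, consider the pencil of hyperplanes of `ℙⁿ⁺¹` through `n` of the points, and the
pencil of hyperplanes of `ℙⁿ` through `n - 1` of these. Each has one moving intersection with `C`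
left over, and the two pencils agree at three of the other points, so they agree on all of `C`
(`pencils_correspond`); in place of divisors on a possibly singular curve, the proof counts
dimensions with the Hilbert function. The resulting bilinear equations force `C` into the
distinguished curve (`subset_distinguished`), whose proper closed subsets are finite.

*Curves of bidegree `(1, d)`.* The graph of a map `ℙ¹ → ℙˢ` of degree `d` through `d + 2` general
points is found by Lagrange interpolation at the first `d + 1` points, the free scalars being
determined, by Cramer's rule, by the condition at the last one. The graph satisfies `IsParam` when
two of the components of the map have nonzero resultant, which is checked at one tuple of points,
where the interpolating map is given by a Newton basis (`exists_interpDisc_ne_zero`).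
-/

namespace BiProjective

open scoped Polynomial

/-! ### Representatives, and properties of general points -/

section Basics

variable {K : Type*} [Field K] {n m : ℕ}

/-- A character of the grading monoid rescales each variable by its weight; a homogeneous
polynomial then scales by the value of the character at its degree. -/
lemma aeval_character_mul {σ M A : Type*} [AddCommMonoid M] [CommRing A] [Algebra K A] {w : σ → M}
    {F : MvPolynomial σ K} {d : M} (hF : IsWeightedHomogeneous w F d) (χ : Multiplicative M →* A)
    (x : σ → A) :
    aeval (fun s => χ (Multiplicative.ofAdd (w s)) * x s) F =
      χ (Multiplicative.ofAdd d) * aeval x F := by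
  rw [aeval_def, aeval_def, eval₂_eq, eval₂_eq, Finset.mul_sum]
  refine Finset.sum_congr rfl fun e he => ?_
  have hd := hF (mem_support_iff.mp he)
  simp only [mul_pow, Finset.prod_mul_distrib]
  have : ∏ i ∈ e.support, χ (Multiplicative.ofAdd (w i)) ^ e i = χ (Multiplicative.ofAdd d) := by
    rw [← hd, Finsupp.weight_apply, Finsupp.sum, ofAdd_sum, map_prod]
    exact Finset.prod_congr rfl fun i _ => by rw [ofAdd_nsmul, map_pow]
  rw [this]; ring

lemma eval_character_mul {σ M : Type*} [AddCommMonoid M] {w : σ → M} {F : MvPolynomial σ K} {d : M}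
    (hF : IsWeightedHomogeneous w F d) (χ : Multiplicative M →* K) (x : σ → K) :
    eval (fun s => χ (Multiplicative.ofAdd (w s)) * x s) F =
      χ (Multiplicative.ofAdd d) * eval x F :=
  aeval_character_mul hF χ x

/-- The basic open sets of `zariski x w` are closed under intersections, so they form a basis. -/
lemma exists_basicOpen_subset {X σ M : Type*} [AddCommMonoid M] {x : X → σ → K} {w : σ → M}
    {U : Set X} (hU : IsOpen[zariski x w] U) {p : X} (hp : p ∈ U) :
    ∃ (F : MvPolynomial σ K) (d : M), IsWeightedHomogeneous w F d ∧ eval (x p) F ≠ 0 ∧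
      ∀ q, eval (x q) F ≠ 0 → q ∈ U := by
  induction hU with
  | basic s hs =>
    obtain ⟨F, d, hF, rfl⟩ := hs
    exact ⟨F, d, hF, hp, fun q hq => hq⟩
  | univ => exact ⟨1, 0, isWeightedHomogeneous_one K w, by simp, fun q _ => trivial⟩
  | inter s t _ _ ihs iht =>
    obtain ⟨F, d, hF, hFp, hFs⟩ := ihs hp.1
    obtain ⟨G, e, hG, hGp, hGt⟩ := iht hp.2
    refine ⟨F * G, d + e, hF.mul hG, by simp [hFp, hGp], fun q hq => ?_⟩
    rw [map_mul] at hq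
    exact ⟨hFs q (left_ne_zero_of_mul hq), hGt q (right_ne_zero_of_mul hq)⟩
  | sUnion S _ ih =>
    obtain ⟨s, hs, hps⟩ := hp
    obtain ⟨F, d, hF, hFp, hFs⟩ := ih s hs hps
    exact ⟨F, d, hF, hFp, fun q hq => ⟨s, hs, hFs q hq⟩⟩

lemma isOpen_basicOpen {X σ M : Type*} [AddCommMonoid M] (x : X → σ → K) {w : σ → M}
    {F : MvPolynomial σ K} {d : M} (hF : IsWeightedHomogeneous w F d) :
    IsOpen[zariski x w] {p | eval (x p) F ≠ 0} :=
  TopologicalSpace.GenerateOpen.basic _ ⟨F, d, hF, rfl⟩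

/-- The vector `x` of bihomogeneous coordinates represents the point `p`. -/
def IsRep (x : Coord n m → K) (p : BiProj K n m) : Prop :=
  ∃ l r : K, l ≠ 0 ∧ r ≠ 0 ∧ x = fun a => Sum.elim (fun _ => l) (fun _ => r) a * p.coord a

lemma isRep_coord (p : BiProj K n m) : IsRep p.coord p :=
  ⟨1, 1, one_ne_zero, one_ne_zero, by ext a; cases a <;> simp⟩

/-- The character of the bigrading monoid with values `l` and `r` on the generators. -/
def biCharacter (l r : K) : Multiplicative (ℕ × ℕ) →* K where
  toFun d := l ^ (Multiplicative.toAdd d).1 * r ^ (Multiplicative.toAdd d).2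
  map_one' := by simp
  map_mul' a b := by simp only [toAdd_mul, Prod.fst_add, Prod.snd_add, pow_add]; ring

lemma biCharacter_biWeight (l r : K) (a : Coord n m) :
    biCharacter l r (Multiplicative.ofAdd (biWeight n m a)) =
      Sum.elim (fun _ => l) (fun _ => r) a := by
  cases a <;> simp [biCharacter, biWeight]

/-- A bihomogeneous polynomial of bidegree `(u, v)` scales by `l ^ u * r ^ v` when the two blocks of
coordinates are scaled by `l` and `r`. -/
lemma eval_scale {F : MvPolynomial (Coord n m) K} {d : ℕ × ℕ}
    (hF : IsWeightedHomogeneous (biWeight n m) F d) (l r : K) (x : Coord n m → K) :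
    eval (fun a => Sum.elim (fun _ => l) (fun _ => r) a * x a) F =
      l ^ d.1 * r ^ d.2 * eval x F := by
  have := eval_character_mul hF (biCharacter l r) x
  simp only [biCharacter_biWeight] at this
  exact this

lemma IsRep.eval_eq_zero_iff {x : Coord n m → K} {p : BiProj K n m} (h : IsRep x p)
    {F : MvPolynomial (Coord n m) K} {d : ℕ × ℕ}
    (hF : IsWeightedHomogeneous (biWeight n m) F d) : eval x F = 0 ↔ eval p.coord F = 0 := by
  obtain ⟨l, r, hl, hr, rfl⟩ := h
  rw [eval_scale hF]
  simp [hl, hr]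

lemma exists_isRep {x : Coord n m → K} (h1 : ∃ i, x (Sum.inl i) ≠ 0) (h2 : ∃ j, x (Sum.inr j) ≠ 0) :
    ∃ p : BiProj K n m, IsRep x p := by
  have h1' : (fun i => x (Sum.inl i)) ≠ 0 := by
    obtain ⟨i, hi⟩ := h1
    exact fun h => hi (congrFun h i)
  have h2' : (fun i => x (Sum.inr i)) ≠ 0 := by
    obtain ⟨i, hi⟩ := h2
    exact fun h => hi (congrFun h i)
  obtain ⟨l, hl⟩ := Projectivization.exists_smul_eq_mk_rep K _ h1'
  obtain ⟨r, hr⟩ := Projectivization.exists_smul_eq_mk_rep K _ h2'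
  refine ⟨⟨Projectivization.mk K _ h1', Projectivization.mk K _ h2'⟩, (l⁻¹ : Kˣ), (r⁻¹ : Kˣ),
    Units.ne_zero _, Units.ne_zero _, ?_⟩
  ext a
  cases a with
  | inl i => simp [BiProj.coord, ← hl, Units.smul_def]
  | inr i => simp [BiProj.coord, ← hr, Units.smul_def]

lemma IsRep.fst_ne_zero {x : Coord n m → K} {p : BiProj K n m} (h : IsRep x p) :
    ∃ i, x (Sum.inl i) ≠ 0 := by
  obtain ⟨l, r, hl, hr, rfl⟩ := h
  obtain ⟨i, hi⟩ := Function.ne_iff.mp p.fst.rep_nonzero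
  exact ⟨i, mul_ne_zero hl hi⟩

lemma IsRep.snd_ne_zero {x : Coord n m → K} {p : BiProj K n m} (h : IsRep x p) :
    ∃ i, x (Sum.inr i) ≠ 0 := by
  obtain ⟨l, r, hl, hr, rfl⟩ := h
  obtain ⟨i, hi⟩ := Function.ne_iff.mp p.snd.rep_nonzero
  exact ⟨i, mul_ne_zero hr hi⟩

lemma IsRep.eq_of_scale {x y : Coord n m → K} {p q : BiProj K n m} (hp : IsRep x p)
    (hq : IsRep y q) (h1 : ∃ c : K, c ≠ 0 ∧ ∀ i, x (Sum.inl i) = c * y (Sum.inl i))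
    (h2 : ∃ c : K, c ≠ 0 ∧ ∀ j, x (Sum.inr j) = c * y (Sum.inr j)) : p = q := by
  obtain ⟨l, r, hl, hr, rfl⟩ := hp
  obtain ⟨l', r', hl', hr', rfl⟩ := hq
  obtain ⟨c, hc, h1⟩ := h1
  obtain ⟨e, he, h2⟩ := h2
  ext1
  · rw [← p.fst.mk_rep, ← q.fst.mk_rep, Projectivization.mk_eq_mk_iff']
    refine ⟨l⁻¹ * c * l', ?_⟩
    ext i
    have := h1 i
    simp only [BiProj.coord, Sum.elim_inl] at this
    simp only [Pi.smul_apply, smul_eq_mul]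
    field_simp
    linear_combination -this
  · rw [← p.snd.mk_rep, ← q.snd.mk_rep, Projectivization.mk_eq_mk_iff']
    refine ⟨r⁻¹ * e * r', ?_⟩
    ext i
    have := h2 i
    simp only [BiProj.coord, Sum.elim_inr] at this
    simp only [Pi.smul_apply, smul_eq_mul]
    field_simp
    linear_combination -this

lemma IsRep.unique {x : Coord n m → K} {p q : BiProj K n m} (hp : IsRep x p)
    (hq : IsRep x q) : p = q :=
  hp.eq_of_scale hq ⟨1, one_ne_zero, by simp⟩ ⟨1, one_ne_zero, by simp⟩

lemma IsRep.scale {x : Coord n m → K} {p : BiProj K n m} (hp : IsRep x p) {l r : K} (hl : l ≠ 0)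
    (hr : r ≠ 0) : IsRep (fun a => Sum.elim (fun _ => l) (fun _ => r) a * x a) p := by
  obtain ⟨l', r', hl', hr', rfl⟩ := hp
  refine ⟨l * l', r * r', mul_ne_zero hl hl', mul_ne_zero hr hr', ?_⟩
  ext a
  cases a <;> simp [mul_assoc]

lemma exists_eval_ne_zero {σ : Type*} [Infinite K] {F : MvPolynomial σ K} (hF : F ≠ 0) :
    ∃ x : σ → K, eval x F ≠ 0 := by
  by_contra! h
  exact hF (MvPolynomial.funext fun x => by simpa using h x)

/-- The character of the grading monoid of tuples attached to a degree, as a function of the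
scaling factors. -/
def tupleCharacter {k : ℕ} (d : Fin k → ℕ × ℕ) : (Fin k → Kˣ × Kˣ) →* K where
  toFun c := ∏ i, ((c i).1 : K) ^ (d i).1 * ((c i).2 : K) ^ (d i).2
  map_one' := by simp
  map_mul' a b := by
    rw [← Finset.prod_mul_distrib]
    refine Finset.prod_congr rfl fun i _ => ?_
    simp only [Pi.mul_apply, Prod.fst_mul, Prod.snd_mul, Units.val_mul, mul_pow]; ring

lemma tupleCharacter_injective [CharZero K] {k : ℕ} :
    Function.Injective (tupleCharacter (K := K) (k := k)) := by
  intro d e h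
  have two : (2 : K) ≠ 0 := two_ne_zero
  ext i
  · have := DFunLike.congr_fun h (Pi.mulSingle i (Units.mk0 2 two, 1))
    simp only [tupleCharacter, MonoidHom.coe_mk, OneHom.coe_mk] at this
    rw [Finset.prod_eq_single i, Finset.prod_eq_single i] at this
    · simp only [Pi.mulSingle_eq_same, Units.val_mk0, Units.val_one, one_pow, mul_one] at this
      have h2 : (2 : ℕ) ^ (d i).1 = 2 ^ (e i).1 := by exact_mod_cast this
      exact Nat.pow_right_injective le_rfl h2
    all_goals simp +contextual [Pi.mulSingle_eq_of_ne]
  · have := DFunLike.congr_fun h (Pi.mulSingle i (1, Units.mk0 2 two))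
    simp only [tupleCharacter, MonoidHom.coe_mk, OneHom.coe_mk] at this
    rw [Finset.prod_eq_single i, Finset.prod_eq_single i] at this
    · simp only [Pi.mulSingle_eq_same, Units.val_mk0, Units.val_one, one_pow, one_mul] at this
      have h2 : (2 : ℕ) ^ (d i).2 = 2 ^ (e i).2 := by exact_mod_cast this
      exact Nat.pow_right_injective le_rfl h2
    all_goals simp +contextual [Pi.mulSingle_eq_of_ne]

lemma eval_scale_tuple {k : ℕ} {F : MvPolynomial (Fin k × Coord n m) K} {d : Fin k → ℕ × ℕ}
    (hF : IsWeightedHomogeneous (tupleWeight n m k) F d) (c : Fin k → Kˣ × Kˣ)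
    (x : Fin k × Coord n m → K) :
    eval (fun a => Sum.elim (fun _ => ((c a.1).1 : K)) (fun _ => ((c a.1).2 : K)) a.2 * x a) F =
      tupleCharacter d c * eval x F := by
  let χ : Multiplicative (Fin k → ℕ × ℕ) →* K :=
    { toFun := fun d => tupleCharacter (Multiplicative.toAdd d) c
      map_one' := by simp [tupleCharacter]
      map_mul' := fun a b => by
        simp only [tupleCharacter, MonoidHom.coe_mk, OneHom.coe_mk, toAdd_mul, Pi.add_apply,
          Prod.fst_add, Prod.snd_add, pow_add]
        rw [← Finset.prod_mul_distrib]
        exact Finset.prod_congr rfl fun i _ => by ring }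
  have := eval_character_mul hF χ x
  rw [show tupleCharacter d c = χ (Multiplicative.ofAdd d) from rfl, ← this]
  congr 2
  ext ⟨i, a⟩
  congr 1
  change _ = tupleCharacter (tupleWeight n m k (i, a)) c
  simp only [tupleCharacter, MonoidHom.coe_mk, OneHom.coe_mk, tupleWeight]
  rw [Finset.prod_eq_single i]
  · cases a <;> simp [biWeight]
  · intro j _ hj; simp [Pi.single_eq_of_ne hj]
  · simp

/-- If a polynomial vanishes at all the rescalings of `y`, then so do its multihomogeneous
components, by the linear independence of characters. -/
lemma eval_component_eq_zero [CharZero K] {k : ℕ}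
    {g : (Fin k → ℕ × ℕ) → MvPolynomial (Fin k × Coord n m) K}
    (hg : ∀ e, IsWeightedHomogeneous (tupleWeight n m k) (g e) e)
    (hfin : (Function.support g).Finite) (y : Fin k × Coord n m → K)
    (h0 : ∀ c : Fin k → Kˣ × Kˣ, eval (fun a => Sum.elim (fun _ => ((c a.1).1 : K))
      (fun _ => ((c a.1).2 : K)) a.2 * y a) (∑ᶠ e, g e) = 0) (d : Fin k → ℕ × ℕ) :
    eval y (g d) = 0 := by
  have key : ∀ c : Fin k → Kˣ × Kˣ, ∑ᶠ e : Fin k → ℕ × ℕ,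
      tupleCharacter e c * eval y (g e) = 0 := by
    intro c
    have h0 := h0 c
    change (eval _ : MvPolynomial (Fin k × Coord n m) K →+* K).toAddMonoidHom _ = 0 at h0
    rw [AddMonoidHom.map_finsum _ hfin] at h0
    rw [← h0]
    exact finsum_congr fun e => (eval_scale_tuple (hg e) c _).symm
  have hfin' : (Function.support fun e => eval y (g e)).Finite :=
    hfin.subset fun e he h0 => he (by simp [h0])
  have hli : LinearIndependent K fun e : Fin k → ℕ × ℕ =>
      ((tupleCharacter e : (Fin k → Kˣ × Kˣ) →* K) : (Fin k → Kˣ × Kˣ) → K) :=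
    (linearIndependent_monoidHom (Fin k → Kˣ × Kˣ) K).comp _ tupleCharacter_injective
  rw [linearIndependent_iff'] at hli
  by_contra hne
  refine hne (hli hfin'.toFinset (fun e => eval y (g e)) ?_ d ?_)
  · ext c
    rw [Finset.sum_apply, Pi.zero_apply, ← key c]
    rw [finsum_eq_sum_of_support_subset _ (s := hfin'.toFinset)]
    · exact Finset.sum_congr rfl fun e _ => by simp [mul_comm]
    · intro e he
      simp only [Set.Finite.coe_toFinset, Function.mem_support] at he ⊢
      exact right_ne_zero_of_mul he
  · simpa using hne

/-- To prove a property of general points, it suffices to prove it for all the tuples that have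
*some* representatives outside the zero locus of a fixed nonzero polynomial, which need not be
multihomogeneous. The open set is the non-vanishing locus of a nonzero multihomogeneous component
`H` of the polynomial: if `H` does not vanish at `p`, then by the independence of characters the
polynomial does not vanish identically on the representatives of `p`. -/
theorem forGeneralPoints_of_polynomial [CharZero K] {k : ℕ} {P : (Fin k → BiProj K n m) → Prop}
    (G : MvPolynomial (Fin k × Coord n m) K) (hG : G ≠ 0)
    (h : ∀ (p : Fin k → BiProj K n m) (x : Fin k × Coord n m → K),
      (∀ i, IsRep (fun a => x (i, a)) (p i)) → eval x G ≠ 0 → P p) :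
    ForGeneralPoints P := by
  classical
  obtain ⟨g, hg, hfin, hsum⟩ : ∃ g : (Fin k → ℕ × ℕ) → MvPolynomial (Fin k × Coord n m) K,
      (∀ e, IsWeightedHomogeneous (tupleWeight n m k) (g e) e) ∧ (Function.support g).Finite ∧
      ∑ᶠ e, g e = G :=
    ⟨fun e => weightedHomogeneousComponent (tupleWeight n m k) e G,
      fun e => weightedHomogeneousComponent_isWeightedHomogeneous e G,
      weightedHomogeneousComponent_finsupp G, finsum_weightedHomogeneousComponent _ G⟩
  obtain ⟨d, hd⟩ : ∃ d, g d ≠ 0 := by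
    by_contra! hc
    apply hG
    rw [← hsum]
    simp [hc]
  have hopen : IsOpen[zariskiTuples K n m k]
      {p | eval (fun a : Fin k × Coord n m => (p a.1).coord a.2) (g d) ≠ 0} :=
    isOpen_basicOpen _ (hg d)
  refine ⟨_, hopen, ?_, ?_⟩
  · obtain ⟨x, hx⟩ := exists_eval_ne_zero (F := g d *
      ∏ i : Fin k, (X (i, Sum.inl 0) * X (i, Sum.inr 0))) (mul_ne_zero hd
        (Finset.prod_ne_zero_iff.mpr fun i _ => mul_ne_zero (X_ne_zero _) (X_ne_zero _)))
    rw [map_mul, map_prod] at hx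
    have hx2 := Finset.prod_ne_zero_iff.mp (right_ne_zero_of_mul hx)
    simp only [map_mul, eval_X] at hx2
    choose p hp using fun i => exists_isRep (x := fun a => x (i, a))
      ⟨0, left_ne_zero_of_mul (hx2 i (Finset.mem_univ _))⟩
      ⟨0, right_ne_zero_of_mul (hx2 i (Finset.mem_univ _))⟩
    refine ⟨p, fun h0 => left_ne_zero_of_mul hx ?_⟩
    choose l r hl hr hlr using hp
    have := eval_scale_tuple (hg d) (fun i => (Units.mk0 _ (hl i), Units.mk0 _ (hr i)))
      (fun a => (p a.1).coord a.2)
    rw [h0, mul_zero] at this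
    rw [← this]
    congr 2
    ext ⟨i, a⟩
    exact congrFun (hlr i) a
  · intro p hp
    by_contra hP
    apply hp
    obtain ⟨y, hy⟩ : ∃ y : Fin k × Coord n m → K, y = fun a => (p a.1).coord a.2 := ⟨_, rfl⟩
    rw [← hy]
    refine eval_component_eq_zero hg hfin y (fun c => ?_) d
    rw [hsum]
    by_contra hne
    exact hP (h p _ (fun i => ⟨(c i).1, (c i).2, (c i).1.ne_zero, (c i).2.ne_zero,
      by rw [hy]⟩) hne)

/-- If general `N`-tuples lie on an irreducible curve of bidegree `(a, b)`, then the curves of that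
bidegree through `k < N` general points sweep out a dense set: the remaining points of the tuple
can be chosen freely, one of them in any prescribed open set. -/
theorem dense_sweptLocus_of_exists [CharZero K] {N k a b : ℕ} (hk : k < N)
    (h : ForGeneralPoints fun p : Fin N → BiProj K n m => ∃ C, IsCurveThrough p a b C) :
    ForGeneralPoints fun p : Fin k → BiProj K n m => Dense (sweptLocus p a b) := by
  classical
  obtain ⟨U, hU, ⟨p₀, hp₀⟩, hC⟩ := h
  obtain ⟨F, d, hF, hF0, hFU⟩ := exists_basicOpen_subset hU hp₀
  -- substitution of the coordinates of the base tuple for the variables of the points `≥ k`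
  let sub : Fin N × Coord n m → MvPolynomial (Fin k × Coord n m) K := fun a =>
    if ha : (a.1 : ℕ) < k then X (⟨a.1, ha⟩, a.2) else MvPolynomial.C ((p₀ a.1).coord a.2)
  have hsub : ∀ x, eval x (aeval sub F) = eval (fun a : Fin N × Coord n m =>
      if ha : (a.1 : ℕ) < k then x (⟨a.1, ha⟩, a.2) else (p₀ a.1).coord a.2) F := by
    intro x
    rw [← MvPolynomial.coe_aeval_eq_eval, RingHom.coe_coe, ← AlgHom.comp_apply, comp_aeval,
      ← MvPolynomial.coe_aeval_eq_eval, RingHom.coe_coe]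
    congr 2
    ext a
    by_cases ha : (a.1 : ℕ) < k <;> simp [sub, ha]
  refine forGeneralPoints_of_polynomial (aeval sub F) (fun h0 => hF0 ?_) ?_
  · have := hsub (fun a => (p₀ (Fin.castLE hk.le a.1)).coord a.2)
    rw [h0, map_zero] at this
    rw [this]
    congr 2
    ext a
    by_cases ha : (a.1 : ℕ) < k <;> simp [ha]
  · intro p x hx hne
    rw [hsub] at hne
    rw [dense_iff_inter_open]
    rintro V hV ⟨q₀, hq₀⟩
    obtain ⟨H, e, hH, hH0, hHV⟩ := exists_basicOpen_subset hV hq₀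
    -- the polynomial cutting out the bad choices of the `k`-th point
    let sub' : Fin N × Coord n m → MvPolynomial (Coord n m) K := fun a =>
      if ha : (a.1 : ℕ) < k then MvPolynomial.C (x (⟨a.1, ha⟩, a.2)) else
        if (a.1 : ℕ) = k then X a.2 else MvPolynomial.C ((p₀ a.1).coord a.2)
    have hsub' : ∀ z, eval z (aeval sub' F) = eval (fun a : Fin N × Coord n m =>
        if ha : (a.1 : ℕ) < k then x (⟨a.1, ha⟩, a.2) else
        if (a.1 : ℕ) = k then z a.2 else (p₀ a.1).coord a.2) F := by
      intro z
      rw [← MvPolynomial.coe_aeval_eq_eval, RingHom.coe_coe, ← AlgHom.comp_apply, comp_aeval,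
        ← MvPolynomial.coe_aeval_eq_eval, RingHom.coe_coe]
      congr 2
      ext a
      by_cases ha : (a.1 : ℕ) < k
      · simp [sub', ha]
      · by_cases ha' : (a.1 : ℕ) = k <;> simp [sub', ha, ha']
    have h1 : aeval sub' F ≠ 0 := by
      intro h0
      have := hsub' (p₀ ⟨k, hk⟩).coord
      rw [h0, map_zero] at this
      apply hne
      rw [this]
      congr 2
      ext ⟨i, a⟩
      by_cases ha : (i : ℕ) < k
      · simp [ha]
      · by_cases ha' : (i : ℕ) = k
        · obtain rfl : i = ⟨k, hk⟩ := Fin.ext ha'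
          simp
        · simp [ha, ha']
    have h2 : H ≠ 0 := fun h0 => hH0 (by simp [h0])
    obtain ⟨z, hz⟩ := exists_eval_ne_zero (mul_ne_zero (mul_ne_zero h1 h2)
      (mul_ne_zero (X_ne_zero (R := K) (Sum.inl 0 : Coord n m)) (X_ne_zero (R := K) (Sum.inr 0))))
    simp only [map_mul, eval_X, mul_ne_zero_iff] at hz
    obtain ⟨⟨hzF, hzH⟩, hz1, hz2⟩ := hz
    obtain ⟨q, hq⟩ := exists_isRep ⟨0, hz1⟩ ⟨0, hz2⟩
    rw [hsub'] at hzF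
    let P : Fin N → BiProj K n m := fun i => if hi : (i : ℕ) < k then p ⟨i, hi⟩ else
      if (i : ℕ) = k then q else p₀ i
    have hrep : ∀ i : Fin N, IsRep (fun a => if ha : (i : ℕ) < k then x (⟨i, ha⟩, a) else
        if (i : ℕ) = k then z a else (p₀ i).coord a) (P i) := by
      intro i
      by_cases hi : (i : ℕ) < k
      · simpa [P, hi] using hx ⟨i, hi⟩
      · by_cases hi' : (i : ℕ) = k
        · simpa [P, hi'] using hq
        · simpa [P, hi, hi'] using isRep_coord (p₀ i)
    have hPU : P ∈ U := by
      apply hFU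
      intro h0
      choose l r hl hr hlr using hrep
      have := eval_scale_tuple hF (fun i => (Units.mk0 _ (hl i), Units.mk0 _ (hr i)))
        (fun a => (P a.1).coord a.2)
      rw [h0, mul_zero] at this
      apply hzF
      rw [← this]
      congr 2
      ext ⟨i, a⟩
      exact congrFun (hlr i) a
    obtain ⟨C, hC1, hC2, hC3⟩ := hC P hPU
    refine ⟨q, hHV q fun h0 => hzH ((hq.eval_eq_zero_iff hH).mpr h0), C,
      ⟨hC1, hC2, fun i => ?_⟩, ?_⟩
    · simpa [P] using hC3 (Fin.castLE hk.le i)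
    · simpa [P] using hC3 ⟨k, hk⟩

end Basics

/-! ### The Zariski topology on a product of two projective spaces -/

section Topological

variable {K : Type*} [Field K] {n m : ℕ}

lemma isClosed_of_forall_exists {Z : Set (BiProj K n m)}
    (h : ∀ q ∉ Z, ∃ (F : MvPolynomial (Coord n m) K) (d : ℕ × ℕ),
      IsWeightedHomogeneous (biWeight n m) F d ∧ (∀ p ∈ Z, eval p.coord F = 0) ∧
      eval q.coord F ≠ 0) : IsClosed Z := by
  rw [← isOpen_compl_iff, isOpen_iff_forall_mem_open]
  intro q hq
  obtain ⟨F, d, hF, hZ, hne⟩ := h q hq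
  exact ⟨{p | eval p.coord F ≠ 0}, fun p hp hpZ => hp (hZ p hpZ), isOpen_basicOpen _ hF, hne⟩

lemma exists_vanishing_of_isClosed {Z : Set (BiProj K n m)} (hZ : IsClosed Z) {q : BiProj K n m}
    (hq : q ∉ Z) : ∃ (F : MvPolynomial (Coord n m) K) (d : ℕ × ℕ),
      IsWeightedHomogeneous (biWeight n m) F d ∧ (∀ p ∈ Z, eval p.coord F = 0) ∧
      eval q.coord F ≠ 0 := by
  obtain ⟨F, d, hF, hne, hsub⟩ := exists_basicOpen_subset hZ.isOpen_compl hq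
  exact ⟨F, d, hF, fun p hp => by_contra fun h0 => hsub p h0 hp, hne⟩

/-- Distinct points are separated by a linear form in one of the two blocks of variables. -/
lemma exists_separating_linear {p q : BiProj K n m} (hpq : q ≠ p) :
    ∃ F : MvPolynomial (Coord n m) K, (IsWeightedHomogeneous (biWeight n m) F (1, 0) ∨
      IsWeightedHomogeneous (biWeight n m) F (0, 1)) ∧ eval p.coord F = 0 ∧ eval q.coord F ≠ 0 := by
  by_contra! hc
  apply hpq
  have h1 : ∀ i j, p.coord (Sum.inl i) * q.coord (Sum.inl j) =
      p.coord (Sum.inl j) * q.coord (Sum.inl i) := by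
    intro i j
    have := hc (MvPolynomial.C (p.coord (Sum.inl i)) * X (Sum.inl j) -
      MvPolynomial.C (p.coord (Sum.inl j)) * X (Sum.inl i))
      (Or.inl <| ((isWeightedHomogeneous_X K (biWeight n m) (Sum.inl j)).C_mul _).sub
        ((isWeightedHomogeneous_X K (biWeight n m) (Sum.inl i)).C_mul _))
      (by simp; ring)
    simpa [sub_eq_zero] using this
  have h2 : ∀ i j, p.coord (Sum.inr i) * q.coord (Sum.inr j) =
      p.coord (Sum.inr j) * q.coord (Sum.inr i) := by
    intro i j
    have := hc (MvPolynomial.C (p.coord (Sum.inr i)) * X (Sum.inr j) -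
      MvPolynomial.C (p.coord (Sum.inr j)) * X (Sum.inr i))
      (Or.inr <| ((isWeightedHomogeneous_X K (biWeight n m) (Sum.inr j)).C_mul _).sub
        ((isWeightedHomogeneous_X K (biWeight n m) (Sum.inr i)).C_mul _))
      (by simp; ring)
    simpa [sub_eq_zero] using this
  obtain ⟨i, hi⟩ := (isRep_coord p).fst_ne_zero
  obtain ⟨j, hj⟩ := (isRep_coord p).snd_ne_zero
  obtain ⟨i', hi'⟩ := (isRep_coord q).fst_ne_zero
  obtain ⟨j', hj'⟩ := (isRep_coord q).snd_ne_zero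
  have hqi : q.coord (Sum.inl i) ≠ 0 := fun h0 => by
    have := h1 i i'
    rw [h0, mul_zero] at this
    exact mul_ne_zero hi hi' this
  have hqj : q.coord (Sum.inr j) ≠ 0 := fun h0 => by
    have := h2 j j'
    rw [h0, mul_zero] at this
    exact mul_ne_zero hj hj' this
  refine (isRep_coord q).eq_of_scale (isRep_coord p)
    ⟨q.coord (Sum.inl i) / p.coord (Sum.inl i), div_ne_zero hqi hi, fun k => ?_⟩
    ⟨q.coord (Sum.inr j) / p.coord (Sum.inr j), div_ne_zero hqj hj, fun k => ?_⟩
  · field_simp; linear_combination h1 i k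
  · field_simp; linear_combination h2 j k

instance : T1Space (BiProj K n m) := by
  refine ⟨fun p => isClosed_of_forall_exists fun q hq => ?_⟩
  obtain ⟨F, hF, hp, hq⟩ := exists_separating_linear hq
  obtain ⟨d, hd⟩ : ∃ d, IsWeightedHomogeneous (biWeight n m) F d := hF.elim (⟨_, ·⟩) (⟨_, ·⟩)
  exact ⟨F, d, hd, by rintro _ rfl; exact hp, hq⟩

lemma subsingleton_of_finite_of_isPreirreducible {X : Type*} [TopologicalSpace X] [T1Space X]
    {S : Set X} (hS : S.Finite) (hirr : IsPreirreducible S) : S.Subsingleton := by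
  intro x hx y hy
  by_contra hne
  obtain ⟨z, hz, hz1, hz2⟩ := hirr (S \ {x})ᶜ {x}ᶜ (hS.sdiff.isClosed.isOpen_compl)
    isClosed_singleton.isOpen_compl ⟨x, hx, by simp⟩ ⟨y, hy, by simpa using Ne.symm hne⟩
  exact hz1 ⟨hz, hz2⟩

/-- An irreducible closed set whose proper closed subsets are finite is a curve. -/
lemma topologicalKrullDim_eq_one {X : Type*} [TopologicalSpace X] [T1Space X]
    {C : Set X} (hC : IsClosed C) (hirr : IsIrreducible C)
    (hfin : ∀ Z ⊆ C, IsClosed Z → Z ≠ C → Z.Finite) (hnt : C.Nontrivial) :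
    topologicalKrullDim C = 1 := by
  apply le_antisymm
  · rw [topologicalKrullDim, Order.krullDim_le_one_iff]
    intro Z
    by_cases hZ : (Z : Set C) = Set.univ
    · right
      intro Y _ z _
      change z ∈ (Z : Set C)
      rw [hZ]
      trivial
    · left
      have hs : (Subtype.val '' (Z : Set C)).Finite := by
        refine hfin _ (by simp) (hC.isClosedEmbedding_subtypeVal.isClosedMap _ Z.isClosed) ?_
        intro h
        apply hZ
        ext z
        simp only [Set.mem_univ, iff_true]
        obtain ⟨z', hz', he⟩ : (z : X) ∈ Subtype.val '' (Z : Set C) := by rw [h]; exact z.2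
        rwa [← Subtype.ext he]
      have hsub : (Z : Set C).Subsingleton :=
        subsingleton_of_finite_of_isPreirreducible (Set.Finite.of_finite_image hs
          Subtype.val_injective.injOn) Z.isIrreducible.isPreirreducible
      intro Y hY z hz
      obtain ⟨y, hy⟩ := Y.isIrreducible.nonempty
      have : z = y := hsub hz (hY hy)
      rw [this]
      exact hy
  · rw [topologicalKrullDim, Order.one_le_krullDim_iff]
    obtain ⟨x, hx, y, hy, hxy⟩ := hnt
    have : IrreducibleSpace C := isIrreducible_iff_irreducibleSpace.mp hirr
    refine ⟨⟨{⟨x, hx⟩}, isIrreducible_singleton, isClosed_singleton⟩,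
      ⟨Set.univ, IrreducibleSpace.isIrreducible_univ C, isClosed_univ⟩, ?_⟩
    refine lt_of_le_not_ge (fun _ _ => trivial) fun h => hxy ?_
    have := h (show (⟨y, hy⟩ : C) ∈ Set.univ from trivial)
    exact (congrArg Subtype.val (Set.mem_singleton_iff.mp this)).symm

lemma mk_idealOf_eq_zero_iff {C : Set (BiProj K n m)} {F : MvPolynomial (Coord n m) K} {d : ℕ × ℕ}
    (hF : IsWeightedHomogeneous (biWeight n m) F d) :
    Ideal.Quotient.mk (idealOf C) F = 0 ↔ ∀ p ∈ C, eval p.coord F = 0 := by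
  rw [Ideal.Quotient.eq_zero_iff_mem]
  refine ⟨fun h p hp => ?_, fun h => Ideal.subset_span ⟨⟨d, hF⟩, h⟩⟩
  have : idealOf C ≤ RingHom.ker (eval p.coord) :=
    Ideal.span_le.mpr fun G hG => hG.2 p hp
  exact this h

lemma finrank_map_eq_of_ker {V W W' : Type*} [AddCommGroup V] [Module K V] [AddCommGroup W]
    [Module K W] [AddCommGroup W'] [Module K W'] (M : Submodule K V) (f : V →ₗ[K] W)
    (g : V →ₗ[K] W') (h : ∀ x ∈ M, f x = 0 ↔ g x = 0) :
    Module.finrank K (M.map f) = Module.finrank K (M.map g) := by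
  rw [← LinearMap.range_domRestrict, ← LinearMap.range_domRestrict,
    ← (f.domRestrict M).quotKerEquivRange.finrank_eq,
    ← (g.domRestrict M).quotKerEquivRange.finrank_eq]
  refine (Submodule.quotEquivOfEq _ _ ?_).finrank_eq
  ext x
  simpa using h x x.2

end Topological

/-! ### Curves parametrised by binary forms -/

section Parametrised

variable {K : Type*} [Field K] {n m : ℕ}

/-- The value of a polynomial, regarded as a binary form of degree `D`, at a point of the
projective line: `some t` is the point `t` of the affine line and `none` is the point at infinity,
where the value is the coefficient of degree `D`. -/
noncomputable def projEval (D : ℕ) : Option K → K[X] →ₗ[K] K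
  | some t => Polynomial.leval t
  | none => Polynomial.lcoeff K D

@[simp] lemma projEval_some (D : ℕ) (t : K) (f : K[X]) : projEval D (some t) f = f.eval t := rfl

@[simp] lemma projEval_none (D : ℕ) (f : K[X]) : projEval D none f = f.coeff D := rfl

lemma mem_degreeLT_succ_iff {f : K[X]} {D : ℕ} :
    f ∈ Polynomial.degreeLT K (D + 1) ↔ f.natDegree ≤ D := by
  rw [Polynomial.mem_degreeLT, Polynomial.degree_lt_iff_coeff_zero,
    Polynomial.natDegree_le_iff_coeff_eq_zero]
  exact forall_congr' fun N => by rw [Nat.succ_le_iff]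

lemma projEval_mul {D E : ℕ} (τ : Option K) {f g : K[X]} (hf : f.natDegree ≤ D)
    (hg : g.natDegree ≤ E) : projEval (D + E) τ (f * g) = projEval D τ f * projEval E τ g := by
  cases τ with
  | some t => simp
  | none => exact Polynomial.coeff_mul_add_eq_of_natDegree_le hf hg

lemma projEval_pow {D : ℕ} (τ : Option K) {f : K[X]} (hf : f.natDegree ≤ D) (e : ℕ) :
    projEval (e * D) τ (f ^ e) = projEval D τ f ^ e := by
  induction e with
  | zero => cases τ <;> simp
  | succ e ih =>
    rw [pow_succ, pow_succ, ← ih, Nat.succ_mul]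
    exact projEval_mul τ (Polynomial.natDegree_pow_le_of_le e hf) hf

lemma projEval_prod {ι : Type*} (s : Finset ι) (D : ι → ℕ) (τ : Option K) {f : ι → K[X]}
    (hf : ∀ i, (f i).natDegree ≤ D i) :
    projEval (∑ i ∈ s, D i) τ (∏ i ∈ s, f i) = ∏ i ∈ s, projEval (D i) τ (f i) := by
  classical
  induction s using Finset.induction_on with
  | empty => cases τ <;> simp
  | insert i s hi ih =>
    rw [Finset.sum_insert hi, Finset.prod_insert hi, Finset.prod_insert hi, ← ih]
    exact projEval_mul τ (hf i) ((Polynomial.natDegree_prod_le _ _).trans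
      (Finset.sum_le_sum fun j _ => hf j))

/-- Some binary form of degree `D` takes the value one at a given point of the line. -/
lemma exists_projEval_eq_one (D : ℕ) (τ : Option K) :
    ∃ f : K[X], f.natDegree ≤ D ∧ projEval D τ f = 1 := by
  cases τ with
  | some t => exact ⟨1, by simp, by simp⟩
  | none => exact ⟨Polynomial.X ^ D, Polynomial.natDegree_X_pow_le D, by simp⟩

/-- The substitution of polynomials in one variable for the bihomogeneous coordinates. -/
noncomputable def paramHom (φ : Fin (n + 1) → K[X]) (ψ : Fin (m + 1) → K[X]) :
    MvPolynomial (Coord n m) K →ₐ[K] K[X] :=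
  aeval (Sum.elim φ ψ)

/-- The coordinates of the point with parameter `τ` on the curve parametrised by the binary forms
`φ i` of degree `a` and `ψ j` of degree `b`. -/
noncomputable def paramVec (a b : ℕ) (φ : Fin (n + 1) → K[X]) (ψ : Fin (m + 1) → K[X])
    (τ : Option K) : Coord n m → K :=
  Sum.elim (fun i => projEval a τ (φ i)) (fun j => projEval b τ (ψ j))

/-- The image of the projective line under the parametrisation `(φ, ψ)`. -/
def paramCurve (a b : ℕ) (φ : Fin (n + 1) → K[X]) (ψ : Fin (m + 1) → K[X]) :
    Set (BiProj K n m) :=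
  {p | ∃ τ, IsRep (paramVec a b φ ψ τ) p}

/-- The forms `φ i` of degree `a` and `ψ j` of degree `b` in one (dehomogenised) variable
parametrise an embedded line: for all large `u, v`, the bihomogeneous polynomials of bidegree
`(u, v)` pull back onto *all* the forms of degree `a u + b v`. -/
structure IsParam (a b : ℕ) (φ : Fin (n + 1) → K[X]) (ψ : Fin (m + 1) → K[X]) : Prop where
  natDegree_fst : ∀ i, (φ i).natDegree ≤ a
  natDegree_snd : ∀ j, (ψ j).natDegree ≤ b
  full : ∃ N : ℕ, ∀ u v : ℕ, N ≤ u → N ≤ v → ∀ f : K[X], f.natDegree ≤ a * u + b * v →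
    ∃ F, IsWeightedHomogeneous (biWeight n m) F (u, v) ∧ paramHom φ ψ F = f

variable {a b : ℕ} {φ : Fin (n + 1) → K[X]} {ψ : Fin (m + 1) → K[X]}

/-- The pullback of a polynomial of bidegree `(u, v)` is a form of degree `a u + b v`, whose value
at any parameter, infinity included, is the value of the polynomial at the corresponding point. -/
lemma natDegree_le_and_projEval_paramHom (h1 : ∀ i, (φ i).natDegree ≤ a)
    (h2 : ∀ j, (ψ j).natDegree ≤ b)
    {F : MvPolynomial (Coord n m) K} {d : ℕ × ℕ}
    (hF : IsWeightedHomogeneous (biWeight n m) F d) :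
    (paramHom φ ψ F).natDegree ≤ a * d.1 + b * d.2 ∧
    ∀ τ, projEval (a * d.1 + b * d.2) τ (paramHom φ ψ F) = eval (paramVec a b φ ψ τ) F := by
  induction hF using IsWeightedHomogeneous.induction_on with
  | zero => simp
  | add p q hp hq ihp ihq =>
    rw [map_add]
    exact ⟨Polynomial.natDegree_add_le_of_degree_le ihp.1 ihq.1, fun τ => by
      rw [map_add, map_add, ihp.2 τ, ihq.2 τ]⟩
  | monomial e r hr =>
    let D : Coord n m → ℕ := Sum.elim (fun _ => a) (fun _ => b)
    have hD : ∀ i, (Sum.elim φ ψ i).natDegree ≤ D i := by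
      rintro (i | i)
      exacts [h1 i, h2 i]
    have hdeg : ∑ i ∈ e.support, e i * D i = a * d.1 + b * d.2 := by
      rw [← hr, Finsupp.weight_apply, Finsupp.sum, Prod.fst_sum, Prod.snd_sum, Finset.mul_sum,
        Finset.mul_sum, ← Finset.sum_add_distrib]
      refine Finset.sum_congr rfl fun i _ => ?_
      rcases i with i | i <;> simp [D, biWeight, mul_comm]
    have hpow : ∀ i, (Sum.elim φ ψ i ^ e i).natDegree ≤ e i * D i := fun i =>
      Polynomial.natDegree_pow_le_of_le _ (hD i)
    have hval : paramHom φ ψ (monomial e r) =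
        r • ∏ i ∈ e.support, Sum.elim φ ψ i ^ e i := by
      rw [paramHom, aeval_monomial, Finsupp.prod, Algebra.smul_def]
    rw [hval]
    refine ⟨(Polynomial.natDegree_smul_le _ _).trans ((Polynomial.natDegree_prod_le _ _).trans
      ((Finset.sum_le_sum fun i _ => hpow i).trans hdeg.le)), fun τ => ?_⟩
    rw [map_smul, ← hdeg, projEval_prod e.support _ τ hpow, eval_monomial, Finsupp.prod,
      smul_eq_mul]
    congr 1
    refine Finset.prod_congr rfl fun i _ => ?_
    rw [projEval_pow τ (hD i)]
    rcases i with i | i <;> rfl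

namespace IsParam

variable (h : IsParam a b φ ψ)

include h

lemma natDegree_paramHom {F : MvPolynomial (Coord n m) K} {u v : ℕ}
    (hF : IsWeightedHomogeneous (biWeight n m) F (u, v)) :
    (paramHom φ ψ F).natDegree ≤ a * u + b * v :=
  (natDegree_le_and_projEval_paramHom h.natDegree_fst h.natDegree_snd hF).1

lemma eval_paramVec {F : MvPolynomial (Coord n m) K} {u v : ℕ}
    (hF : IsWeightedHomogeneous (biWeight n m) F (u, v)) (τ : Option K) :
    eval (paramVec a b φ ψ τ) F = projEval (a * u + b * v) τ (paramHom φ ψ F) :=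
  ((natDegree_le_and_projEval_paramHom h.natDegree_fst h.natDegree_snd hF).2 τ).symm

/-- The parametrisation has no base points. -/
lemma exists_point (τ : Option K) : ∃ p : BiProj K n m, IsRep (paramVec a b φ ψ τ) p := by
  obtain ⟨N, hN⟩ := h.full
  obtain ⟨f, hf, hf1⟩ := exists_projEval_eq_one (a * (N + 1) + b * (N + 1)) τ
  obtain ⟨F, hF, hFf⟩ := hN (N + 1) (N + 1) (by simp) (by simp) f hf
  have hne : eval (paramVec a b φ ψ τ) F ≠ 0 := by
    rw [h.eval_paramVec hF, hFf, hf1]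
    exact one_ne_zero
  apply exists_isRep
  · by_contra! hc
    apply hne
    have := eval_scale hF (0 : K) 1 (paramVec a b φ ψ τ)
    rw [zero_pow (by simp), zero_mul, zero_mul] at this
    rw [← this]
    congr 2
    ext (i | i) <;> simp [hc]
  · by_contra! hc
    apply hne
    have := eval_scale hF (1 : K) 0 (paramVec a b φ ψ τ)
    rw [zero_pow (by simp), mul_zero, zero_mul] at this
    rw [← this]
    congr 2
    ext (i | i) <;> simp [hc]

lemma eval_eq_zero_iff [Infinite K] {F : MvPolynomial (Coord n m) K} {d : ℕ × ℕ}
    (hF : IsWeightedHomogeneous (biWeight n m) F d) :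
    (∀ p ∈ paramCurve a b φ ψ, eval p.coord F = 0) ↔ paramHom φ ψ F = 0 := by
  obtain ⟨u, v⟩ := d
  constructor
  · intro hp
    refine Polynomial.funext fun t => ?_
    obtain ⟨p, hpt⟩ := h.exists_point (some t)
    have h0 := (hpt.eval_eq_zero_iff hF).mpr (hp p ⟨_, hpt⟩)
    rw [h.eval_paramVec hF] at h0
    simpa using h0
  · rintro h0 p ⟨τ, hτ⟩
    rw [← hτ.eval_eq_zero_iff hF, h.eval_paramVec hF, h0, map_zero]

omit h in
/-- A vector satisfying the equations of the rational normal curve lies on the cone over it. -/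
lemma exists_projEval_X_pow {D : ℕ} {z : ℕ → K}
    (hz : ∀ i j k l, i ≤ D → j ≤ D → k ≤ D → l ≤ D → i + j = k + l → z i * z j = z k * z l) :
    ∃ (τ : Option K) (c : K), ∀ k ≤ D, z k = c * projEval D τ (Polynomial.X ^ k) := by
  by_cases h0 : z 0 = 0
  · have hlt : ∀ k < D, z k = 0 := by
      intro k
      induction k with
      | zero => exact fun _ => h0
      | succ k ih =>
        intro hk
        have := hz (k + 1) (k + 1) k (k + 2) (by omega) (by omega) (by omega) (by omega) (by omega)
        rw [ih (by omega), zero_mul] at this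
        exact mul_self_eq_zero.mp this
    refine ⟨none, z D, fun k hk => ?_⟩
    rcases hk.lt_or_eq with hk | rfl
    · simp [hlt k hk, Polynomial.coeff_X_pow, hk.ne']
    · simp
  · refine ⟨some (z 1 / z 0), z 0, fun k => ?_⟩
    induction k with
    | zero => simp
    | succ k ih =>
      intro hk
      have := hz (k + 1) 0 k 1 (by omega) (by omega) (by omega) (by omega) (by omega)
      rw [ih (by omega)] at this
      simp only [projEval_some, Polynomial.eval_pow, Polynomial.eval_X] at this ⊢
      rw [pow_succ]
      field_simp at this ⊢
      linear_combination this

/-- The image of a parametrisation is closed. A point `q` of its closure induces a functional on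
each space of binary forms, compatible with products, so that its values on the monomials satisfy
the equations of the rational normal curve; hence the functional is an evaluation. -/
lemma isClosed [Infinite K] : IsClosed (paramCurve a b φ ψ) := by
  refine isClosed_of_forall_exists fun q hq => ?_
  by_contra! hc
  apply hq
  have hq0 : ∀ {F : MvPolynomial (Coord n m) K} {d : ℕ × ℕ},
      IsWeightedHomogeneous (biWeight n m) F d → paramHom φ ψ F = 0 → eval q.coord F = 0 :=
    fun hF h0 => hc _ _ hF ((h.eval_eq_zero_iff hF).mpr h0)
  obtain ⟨N, hN⟩ := h.full
  set w := N + 1 with hw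
  set D := a * w + b * w with hD
  have hex : ∀ k : ℕ, ∃ F, IsWeightedHomogeneous (biWeight n m) F (w, w) ∧
      (k ≤ D → paramHom φ ψ F = Polynomial.X ^ k) := by
    intro k
    by_cases hk : k ≤ D
    · obtain ⟨F, hF, hFk⟩ := hN w w (by omega) (by omega) (Polynomial.X ^ k)
        ((Polynomial.natDegree_X_pow_le k).trans hk)
      exact ⟨F, hF, fun _ => hFk⟩
    · exact ⟨0, isWeightedHomogeneous_zero K _ _, fun h => absurd h hk⟩
  choose G hG hGX using hex
  obtain ⟨τ, c, hτ⟩ := exists_projEval_X_pow (D := D) (z := fun k => eval q.coord (G k)) (by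
    intro i j k l hi hj hk hl hij
    rw [← map_mul, ← map_mul, ← sub_eq_zero, ← map_sub]
    refine hq0 (((hG i).mul (hG j)).sub ((hG k).mul (hG l))) ?_
    rw [map_sub, map_mul, map_mul, hGX i hi, hGX j hj, hGX k hk, hGX l hl, ← pow_add, ← pow_add,
      hij, sub_self])
  have key : ∀ {F : MvPolynomial (Coord n m) K}, IsWeightedHomogeneous (biWeight n m) F (w, w) →
      eval q.coord F = c * eval (paramVec a b φ ψ τ) F := by
    intro F hF
    have hdeg : (paramHom φ ψ F).natDegree < D + 1 :=
      Nat.lt_succ_of_le (h.natDegree_paramHom hF)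
    have hsum := (paramHom φ ψ F).as_sum_range_C_mul_X_pow' hdeg
    set f := paramHom φ ψ F with hf
    have h0 : eval q.coord
        (F - ∑ k ∈ Finset.range (D + 1), MvPolynomial.C (f.coeff k) * G k) = 0 := by
      refine hq0 (hF.sub (IsWeightedHomogeneous.sum _ _ _ fun k _ => (hG k).C_mul _)) ?_
      rw [map_sub, map_sum, ← hf, sub_eq_zero]
      rw [hsum]
      refine Finset.sum_congr rfl fun k hk => ?_
      rw [map_mul, hGX k (Nat.lt_succ_iff.mp (Finset.mem_range.mp hk)), paramHom, aeval_C]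
      rw [← hsum]; rfl
    rw [map_sub, sub_eq_zero] at h0
    rw [h0, h.eval_paramVec hF, ← hf, hsum, map_sum, map_sum, Finset.mul_sum, ← hsum]
    refine Finset.sum_congr rfl fun k hk => ?_
    rw [map_mul, eval_C, hτ k (Nat.lt_succ_iff.mp (Finset.mem_range.mp hk)),
      ← Polynomial.smul_eq_C_mul, map_smul, smul_eq_mul]
    ring
  obtain ⟨i, hi⟩ := (isRep_coord q).fst_ne_zero
  obtain ⟨j, hj⟩ := (isRep_coord q).snd_ne_zero
  have hwt1 : ∀ k : Fin (n + 1), IsWeightedHomogeneous (biWeight n m)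
      (X (Sum.inl k) * X (Sum.inl i) ^ N * X (Sum.inr j) ^ w : MvPolynomial (Coord n m) K)
      (w, w) := by
    intro k
    have := ((isWeightedHomogeneous_X K (biWeight n m) (Sum.inl k)).mul
      ((isWeightedHomogeneous_X K (biWeight n m) (Sum.inl i)).pow N)).mul
      ((isWeightedHomogeneous_X K (biWeight n m) (Sum.inr j)).pow w)
    convert this using 1
    simp [biWeight, hw, add_comm]
  have hwt2 : ∀ k : Fin (m + 1), IsWeightedHomogeneous (biWeight n m)
      (X (Sum.inr k) * X (Sum.inr j) ^ N * X (Sum.inl i) ^ w : MvPolynomial (Coord n m) K)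
      (w, w) := by
    intro k
    have := ((isWeightedHomogeneous_X K (biWeight n m) (Sum.inr k)).mul
      ((isWeightedHomogeneous_X K (biWeight n m) (Sum.inr j)).pow N)).mul
      ((isWeightedHomogeneous_X K (biWeight n m) (Sum.inl i)).pow w)
    convert this using 1
    simp [biWeight, hw, add_comm]
  obtain ⟨p, hp⟩ := h.exists_point τ
  have e1 := fun k => key (hwt1 k)
  have e2 := fun k => key (hwt2 k)
  simp only [map_mul, map_pow, eval_X] at e1 e2
  have hne := e1 i
  have hprod : q.coord (Sum.inl i) * q.coord (Sum.inl i) ^ N * q.coord (Sum.inr j) ^ w ≠ 0 :=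
    mul_ne_zero (mul_ne_zero hi (pow_ne_zero _ hi)) (pow_ne_zero _ hj)
  rw [hne] at hprod
  set y := paramVec a b φ ψ τ with hy
  have hc0 : c ≠ 0 := left_ne_zero_of_mul hprod
  have hyi : y (Sum.inl i) ≠ 0 :=
    left_ne_zero_of_mul (left_ne_zero_of_mul (right_ne_zero_of_mul hprod))
  have hyj : y (Sum.inr j) ≠ 0 := by
    have := right_ne_zero_of_mul (right_ne_zero_of_mul hprod)
    intro h0
    rw [h0, zero_pow (by omega)] at this
    exact this rfl
  have hqp : q = p := by
    refine (isRep_coord q).eq_of_scale hp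
      ⟨q.coord (Sum.inl i) / y (Sum.inl i), div_ne_zero hi hyi, fun k => ?_⟩
      ⟨q.coord (Sum.inr j) / y (Sum.inr j), div_ne_zero hj hyj, fun k => ?_⟩
    · have hk := e1 k
      have hi' := e1 i
      have hA : q.coord (Sum.inl i) ^ N * q.coord (Sum.inr j) ^ w ≠ 0 :=
        mul_ne_zero (pow_ne_zero _ hi) (pow_ne_zero _ hj)
      have : (q.coord (Sum.inl k) * y (Sum.inl i) - q.coord (Sum.inl i) * y (Sum.inl k)) *
          (q.coord (Sum.inl i) ^ N * q.coord (Sum.inr j) ^ w) = 0 := by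
        linear_combination y (Sum.inl i) * hk - y (Sum.inl k) * hi'
      have := (mul_eq_zero.mp this).resolve_right hA
      field_simp
      linear_combination this
    · have hk := e2 k
      have hi' := e2 j
      have hA : q.coord (Sum.inr j) ^ N * q.coord (Sum.inl i) ^ w ≠ 0 :=
        mul_ne_zero (pow_ne_zero _ hj) (pow_ne_zero _ hi)
      have : (q.coord (Sum.inr k) * y (Sum.inr j) - q.coord (Sum.inr j) * y (Sum.inr k)) *
          (q.coord (Sum.inr j) ^ N * q.coord (Sum.inl i) ^ w) = 0 := by
        linear_combination y (Sum.inr j) * hk - y (Sum.inr k) * hi'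
      have := (mul_eq_zero.mp this).resolve_right hA
      field_simp
      linear_combination this
  rw [hqp]
  exact ⟨τ, hp⟩

lemma isIrreducible [Infinite K] : IsIrreducible (paramCurve a b φ ψ) := by
  constructor
  · obtain ⟨p, hp⟩ := h.exists_point none
    exact ⟨p, _, hp⟩
  · rintro U V hU hV ⟨p, hpC, hpU⟩ ⟨q, hqC, hqV⟩
    obtain ⟨F, ⟨u, v⟩, hF, hFp, hFU⟩ := exists_basicOpen_subset hU hpU
    obtain ⟨G, ⟨u', v'⟩, hG, hGq, hGV⟩ := exists_basicOpen_subset hV hqV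
    have hF0 : paramHom φ ψ F ≠ 0 := fun h0 => hFp ((h.eval_eq_zero_iff hF).mpr h0 p hpC)
    have hG0 : paramHom φ ψ G ≠ 0 := fun h0 => hGq ((h.eval_eq_zero_iff hG).mpr h0 q hqC)
    obtain ⟨t, ht⟩ : ∃ t, (paramHom φ ψ F * paramHom φ ψ G).eval t ≠ 0 := by
      by_contra! hc
      exact mul_ne_zero hF0 hG0 (Polynomial.funext fun t => by simpa using hc t)
    rw [Polynomial.eval_mul] at ht
    obtain ⟨r, hr⟩ := h.exists_point (some t)
    refine ⟨r, ⟨_, hr⟩, hFU r fun h0 => left_ne_zero_of_mul ht ?_,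
      hGV r fun h0 => right_ne_zero_of_mul ht ?_⟩
    · have := (hr.eval_eq_zero_iff hF).mpr h0
      rwa [h.eval_paramVec hF] at this
    · have := (hr.eval_eq_zero_iff hG).mpr h0
      rwa [h.eval_paramVec hG] at this

/-- A proper closed subset lies in the zero locus of a bihomogeneous polynomial whose pullback is
nonzero, and this pullback has finitely many roots. -/
lemma finite_of_ssubset [Infinite K] {Z : Set (BiProj K n m)} (hZ : IsClosed Z)
    (hsub : Z ⊆ paramCurve a b φ ψ) (hne : Z ≠ paramCurve a b φ ψ) : Z.Finite := by
  classical
  obtain ⟨q, hqC, hqZ⟩ : ∃ q ∈ paramCurve a b φ ψ, q ∉ Z := by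
    by_contra! hc
    exact hne (hsub.antisymm hc)
  obtain ⟨F, ⟨u, v⟩, hF, hFZ, hFq⟩ := exists_vanishing_of_isClosed hZ hqZ
  have hF0 : paramHom φ ψ F ≠ 0 := fun h0 => hFq ((h.eval_eq_zero_iff hF).mpr h0 q hqC)
  choose pt hpt using h.exists_point
  have hfin : (insert none (some '' ((paramHom φ ψ F).roots.toFinset : Set K))).Finite :=
    ((Finset.finite_toSet _).image _).insert _
  refine (hfin.image pt).subset fun p hp => ?_
  obtain ⟨τ, hτ⟩ := hsub hp
  refine ⟨τ, ?_, (hpt τ).unique hτ⟩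
  cases τ with
  | none => simp
  | some t =>
    have := (hτ.eval_eq_zero_iff hF).mpr (hFZ p hp)
    rw [h.eval_paramVec hF] at this
    right
    simpa [hF0] using this

lemma nontrivial (hab : 0 < a + b) : (paramCurve a b φ ψ).Nontrivial := by
  obtain ⟨N, hN⟩ := h.full
  obtain ⟨F, hF, hFX⟩ := hN (N + 1) (N + 1) (by simp) (by simp) Polynomial.X (by
    rw [Polynomial.natDegree_X, ← add_mul]
    exact Nat.mul_pos hab (Nat.succ_pos N))
  obtain ⟨p, hp⟩ := h.exists_point (some 0)
  obtain ⟨q, hq⟩ := h.exists_point (some 1)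
  refine ⟨p, ⟨_, hp⟩, q, ⟨_, hq⟩, ?_⟩
  rintro rfl
  have h1 := (hp.eval_eq_zero_iff hF).mp (by rw [h.eval_paramVec hF, hFX]; simp)
  have h2 := (hq.eval_eq_zero_iff hF).mpr h1
  rw [h.eval_paramVec hF, hFX] at h2
  simp at h2

lemma isIrreducibleCurve [Infinite K] (hab : 0 < a + b) :
    IsIrreducibleCurve (paramCurve a b φ ψ) :=
  ⟨h.isClosed, h.isIrreducible, topologicalKrullDim_eq_one h.isClosed h.isIrreducible
    (fun _ hsub hZ hne => h.finite_of_ssubset hZ hsub hne) (h.nontrivial hab)⟩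

/-- The part of bidegree `(u, v)` of the coordinate ring is isomorphic to the space of all forms of
degree `a u + b v`, so the Hilbert function is `a u + b v + 1`. -/
lemma hasBidegree [Infinite K] : HasBidegree (paramCurve a b φ ψ) a b := by
  obtain ⟨N, hN⟩ := h.full
  refine ⟨1, N, fun u v hu hv => ?_⟩
  have h1 : hilbertFunction (paramCurve a b φ ψ) u v =
      Module.finrank K ((weightedHomogeneousSubmodule K (biWeight n m) (u, v)).map
        (paramHom φ ψ).toLinearMap) := by
    refine finrank_map_eq_of_ker _ _ _ fun F hF => ?_
    exact (mk_idealOf_eq_zero_iff hF).trans (h.eval_eq_zero_iff hF)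
  have h2 : (weightedHomogeneousSubmodule K (biWeight n m) (u, v)).map
      (paramHom φ ψ).toLinearMap = Polynomial.degreeLT K (a * u + b * v + 1) := by
    ext f
    rw [mem_degreeLT_succ_iff, Submodule.mem_map]
    constructor
    · rintro ⟨F, hF, rfl⟩
      exact h.natDegree_paramHom hF
    · intro hf
      obtain ⟨F, hF, hFf⟩ := hN u v hu hv f hf
      exact ⟨F, hF, hFf⟩
  rw [h1, h2, (Polynomial.degreeLTEquiv K _).finrank_eq, Module.finrank_fin_fun]
  push_cast
  ring

end IsParam

end Parametrised

/-! ### Rationality of parametrised curves -/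

section Rational

variable {K : Type*} [Field K] {n m : ℕ}

/-- The monomial `X₀ ^ u * X₁ ^ v` recording a bidegree, over the field of rational functions. -/
noncomputable def bidegreeMonomial (K : Type*) [Field K] :
    Multiplicative (ℕ × ℕ) →* MvPolynomial (Fin 2) (RatFunc K) where
  toFun d := X 0 ^ (Multiplicative.toAdd d).1 * X 1 ^ (Multiplicative.toAdd d).2
  map_one' := by simp
  map_mul' a b := by simp only [toAdd_mul, Prod.fst_add, Prod.snd_add, pow_add]; ring

lemma bidegreeMonomial_ne_zero (d : Multiplicative (ℕ × ℕ)) : bidegreeMonomial K d ≠ 0 :=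
  mul_ne_zero (pow_ne_zero _ (X_ne_zero _)) (pow_ne_zero _ (X_ne_zero _))

lemma bidegreeMonomial_eq (d : ℕ × ℕ) : bidegreeMonomial K (Multiplicative.ofAdd d) =
    monomial (Finsupp.single 0 d.1 + Finsupp.single 1 d.2) 1 := by
  simp [bidegreeMonomial, X_pow_eq_monomial, monomial_mul]

/-- The substitution of `X₀ * φ i` and `X₁ * ψ j` for the coordinates. The two extra variables
record the bidegree, so that the kernel is bihomogeneous. -/
noncomputable def coneHom (φ : Fin (n + 1) → K[X]) (ψ : Fin (m + 1) → K[X]) :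
    MvPolynomial (Coord n m) K →ₐ[K] MvPolynomial (Fin 2) (RatFunc K) :=
  aeval fun s => bidegreeMonomial K (Multiplicative.ofAdd (biWeight n m s)) *
    algebraMap K[X] _ (Sum.elim φ ψ s)

variable {a b : ℕ} {φ : Fin (n + 1) → K[X]} {ψ : Fin (m + 1) → K[X]}

lemma coneHom_apply {F : MvPolynomial (Coord n m) K} {d : ℕ × ℕ}
    (hF : IsWeightedHomogeneous (biWeight n m) F d) :
    coneHom φ ψ F = bidegreeMonomial K (Multiplicative.ofAdd d) *
      algebraMap K[X] _ (paramHom φ ψ F) := by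
  rw [coneHom, aeval_character_mul hF]
  congr 1
  have : (aeval fun s => algebraMap K[X] (MvPolynomial (Fin 2) (RatFunc K)) (Sum.elim φ ψ s)) =
      (IsScalarTower.toAlgHom K K[X] (MvPolynomial (Fin 2) (RatFunc K))).comp (paramHom φ ψ) := by
    rw [paramHom, comp_aeval]
    rfl
  rw [this]
  rfl

namespace IsParam

variable (h : IsParam a b φ ψ)

include h

/-- The kernel of `coneHom` is bihomogeneous, because the bidegree can be read off from the extra
variables. -/
lemma ker_coneHom [Infinite K] :
    RingHom.ker (coneHom φ ψ) = idealOf (paramCurve a b φ ψ) := by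
  apply le_antisymm
  · intro f hf
    rw [RingHom.mem_ker] at hf
    have hcomp : ∀ d, paramHom φ ψ (weightedHomogeneousComponent (biWeight n m) d f) = 0 := by
      intro d
      let L : MvPolynomial (Coord n m) K →+ RatFunc K :=
        (MvPolynomial.coeffAddMonoidHom
          (Finsupp.single (0 : Fin 2) d.1 + Finsupp.single 1 d.2)).comp
          (coneHom φ ψ).toRingHom.toAddMonoidHom
      have hL : ∀ e, L (weightedHomogeneousComponent (biWeight n m) e f) =
          if e = d then algebraMap K[X] (RatFunc K)
            (paramHom φ ψ (weightedHomogeneousComponent (biWeight n m) e f)) else 0 := by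
        intro e
        change coeff _ (coneHom φ ψ _) = _
        rw [coneHom_apply (weightedHomogeneousComponent_isWeightedHomogeneous e f),
          bidegreeMonomial_eq, IsScalarTower.algebraMap_apply K[X] (RatFunc K), algebraMap_eq,
          mul_comm, coeff_C_mul, coeff_monomial]
        by_cases hed : e = d
        · simp [hed]
        · rw [if_neg, if_neg hed, mul_zero]
          intro heq
          apply hed
          have h0 := DFunLike.congr_fun heq 0
          have h1 := DFunLike.congr_fun heq 1
          simp at h0 h1
          exact Prod.ext h0 h1
      have h0 : L f = 0 := by
        change coeff _ (coneHom φ ψ f) = 0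
        rw [hf, coeff_zero]
      rw [← finsum_weightedHomogeneousComponent (biWeight n m) f,
        AddMonoidHom.map_finsum _ (weightedHomogeneousComponent_finsupp f),
        finsum_eq_single _ d (fun e he => by rw [hL, if_neg he]), hL, if_pos rfl] at h0
      exact RatFunc.algebraMap_injective K (by rw [h0, map_zero])
    rw [← finsum_weightedHomogeneousComponent (biWeight n m) f]
    refine finsum_induction (· ∈ idealOf (paramCurve a b φ ψ)) (zero_mem _)
      (fun _ _ => add_mem) fun d => ?_
    have hd := weightedHomogeneousComponent_isWeightedHomogeneous (w := biWeight n m) d f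
    exact Ideal.subset_span ⟨⟨d, hd⟩, (h.eval_eq_zero_iff hd).mpr (hcomp d)⟩
  · refine Ideal.span_le.mpr ?_
    rintro F ⟨⟨d, hF⟩, hv⟩
    change coneHom φ ψ F = 0
    rw [coneHom_apply hF, (h.eval_eq_zero_iff hF).mp hv, map_zero, mul_zero]

/-- A parametrised curve is rational. The coordinate ring embeds in `K(t)[X₀, X₁]`, with elements
of bidegree `(u, v)` going to multiples of `X₀ ^ u * X₁ ^ v`; so in the fraction field the
quotients of elements of the same bidegree lie in `K(t)`, and all of `K(t)` is attained. -/
theorem isRationalCurve [Infinite K] (hab : 0 < a + b) :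
    IsRationalCurve (paramCurve a b φ ψ) := by
  set C := paramCurve a b φ ψ with hC
  let A := MvPolynomial (Fin 2) (RatFunc K)
  let L := FractionRing A
  let ρ : MvPolynomial (Coord n m) K →ₐ[K] L :=
    (IsScalarTower.toAlgHom K A L).comp (coneHom φ ψ)
  have hAL : Function.Injective (algebraMap A L) := IsFractionRing.injective A L
  have hker : ∀ f, ρ f = 0 ↔ f ∈ idealOf C := by
    intro f
    rw [← h.ker_coneHom, RingHom.mem_ker]
    exact map_eq_zero_iff (algebraMap A L) hAL
  let ρ' : CoordRing C →ₐ[K] L := Ideal.Quotient.liftₐ (idealOf C) ρ fun f hf => (hker f).mpr hf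
  have hρ'mk : ∀ f, ρ' (Ideal.Quotient.mk (idealOf C) f) = ρ f := fun f => rfl
  have hinj : Function.Injective ρ' := by
    rw [injective_iff_map_eq_zero]
    intro x hx
    obtain ⟨f, rfl⟩ := Ideal.Quotient.mk_surjective x
    rw [hρ'mk] at hx
    exact Ideal.Quotient.eq_zero_iff_mem.mpr ((hker f).mp hx)
  have hdom : IsDomain (CoordRing C) := hinj.isDomain ρ'.toRingHom
  let ι : FractionRing (CoordRing C) →ₐ[K] L := IsFractionRing.liftAlgHom hinj
  have hιmk : ∀ f, ι (algebraMap (CoordRing C) _ (Ideal.Quotient.mk (idealOf C) f)) = ρ f :=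
    fun f => IsFractionRing.lift_algebraMap (g := ρ'.toRingHom) hinj _
  have hιinj : Function.Injective ι := ι.toRingHom.injective
  let κ : RatFunc K →ₐ[K] L := IsScalarTower.toAlgHom K (RatFunc K) L
  have hκinj : Function.Injective κ := κ.toRingHom.injective
  have hρ : ∀ {F : MvPolynomial (Coord n m) K} {d : ℕ × ℕ},
      IsWeightedHomogeneous (biWeight n m) F d →
      ρ F = algebraMap A L (bidegreeMonomial K (Multiplicative.ofAdd d)) *
        κ (algebraMap K[X] (RatFunc K) (paramHom φ ψ F)) := by
    intro F d hF
    change algebraMap A L (coneHom φ ψ F) = _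
    rw [coneHom_apply hF, map_mul]
    congr 1
  have hmon : ∀ d, algebraMap A L (bidegreeMonomial K d) ≠ 0 := fun d h0 =>
    bidegreeMonomial_ne_zero d (hAL (by rw [h0, map_zero]))
  have hrange : (functionField C).map ι = κ.range := by
    ext z
    constructor
    · rintro ⟨z, ⟨d, f, g, hf, hg, hg0, hz⟩, rfl⟩
      have h1 := congrArg ι hz
      rw [map_mul, hιmk, hιmk, hρ hf, hρ hg] at h1
      have hne : κ (algebraMap K[X] (RatFunc K) (paramHom φ ψ g)) ≠ 0 := by
        intro h0
        have : ρ g = 0 := by rw [hρ hg, h0, mul_zero]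
        rw [← hρ'mk, map_eq_zero_iff _ hinj] at this
        exact nonZeroDivisors.ne_zero hg0 this
      refine ⟨algebraMap K[X] (RatFunc K) (paramHom φ ψ f) /
        algebraMap K[X] (RatFunc K) (paramHom φ ψ g), ?_⟩
      change κ _ = ι z
      rw [map_div₀, div_eq_iff hne]
      refine mul_left_cancel₀ (hmon (Multiplicative.ofAdd d)) ?_
      linear_combination -h1
    · rintro ⟨r, rfl⟩
      obtain ⟨N, hN⟩ := h.full
      set w := N + (r.num.natDegree + r.denom.natDegree) with hw
      have hwD : r.num.natDegree + r.denom.natDegree ≤ a * w + b * w := by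
        calc r.num.natDegree + r.denom.natDegree ≤ 1 * w := by omega
          _ ≤ (a + b) * w := Nat.mul_le_mul_right _ hab
          _ = _ := by ring
      obtain ⟨f, hf, hfn⟩ := hN w w (by omega) (by omega) r.num (by omega)
      obtain ⟨g, hg, hgd⟩ := hN w w (by omega) (by omega) r.denom (by omega)
      have hd0 : κ (algebraMap K[X] (RatFunc K) r.denom) ≠ 0 := by
        intro h0
        have := hκinj (h0.trans (map_zero κ).symm)
        exact RatFunc.denom_ne_zero r (RatFunc.algebraMap_injective K (by rw [this, map_zero]))
      have hρg : ρ g ≠ 0 := by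
        rw [hρ hg, hgd]
        exact mul_ne_zero (hmon _) hd0
      have hg0 : Ideal.Quotient.mk (idealOf C) g ≠ 0 := fun h0 => hρg (by
        rw [← hρ'mk, h0, map_zero])
      have hg1 : algebraMap (CoordRing C) (FractionRing (CoordRing C))
          (Ideal.Quotient.mk (idealOf C) g) ≠ 0 := fun h0 =>
        hg0 (IsFractionRing.injective (CoordRing C) (FractionRing (CoordRing C))
          (by rw [h0, map_zero]))
      refine ⟨algebraMap (CoordRing C) (FractionRing (CoordRing C)) (Ideal.Quotient.mk _ f) /
        algebraMap (CoordRing C) (FractionRing (CoordRing C)) (Ideal.Quotient.mk _ g),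
        ⟨(w, w), f, g, hf, hg, mem_nonZeroDivisors_of_ne_zero hg0, div_mul_cancel₀ _ hg1⟩, ?_⟩
      change ι _ = κ r
      rw [map_div₀, hιmk, hιmk, hρ hf, hρ hg, hfn, hgd, mul_div_mul_left _ _ (hmon _), ← map_div₀,
        RatFunc.num_div_denom]
  exact ⟨((functionField C).equivMapOfInjective ι hιinj).trans
    ((Subalgebra.equivOfEq _ _ hrange).trans (AlgEquiv.ofInjective κ hκinj).symm)⟩

end IsParam

end Rational

/-! ### Differentials, and parametrisations by rational normal curves -/

section NormalParam

variable {K : Type*} [Field K] {n m : ℕ}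

/-- The differential at `x` of a polynomial, evaluated on the vector `δ`. -/
noncomputable def dirDeriv {σ : Type*} [Fintype σ] (x δ : σ → K) (F : MvPolynomial σ K) : K :=
  ∑ s, eval x (pderiv s F) * δ s

lemma dirDeriv_mul {σ : Type*} [Fintype σ] (x δ : σ → K) (F G : MvPolynomial σ K) :
    dirDeriv x δ (F * G) = eval x F * dirDeriv x δ G + eval x G * dirDeriv x δ F := by
  simp only [dirDeriv, Finset.mul_sum, ← Finset.sum_add_distrib]
  refine Finset.sum_congr rfl fun s _ => ?_
  rw [Derivation.leibniz]
  simp only [smul_eq_mul, map_add, map_mul]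
  ring

lemma dirDeriv_add {σ : Type*} [Fintype σ] (x δ : σ → K) (F G : MvPolynomial σ K) :
    dirDeriv x δ (F + G) = dirDeriv x δ F + dirDeriv x δ G := by
  simp only [dirDeriv, map_add, add_mul, Finset.sum_add_distrib]

lemma dirDeriv_sub {σ : Type*} [Fintype σ] (x δ : σ → K) (F G : MvPolynomial σ K) :
    dirDeriv x δ (F - G) = dirDeriv x δ F - dirDeriv x δ G := by
  simp only [dirDeriv, map_sub, sub_mul, Finset.sum_sub_distrib]

lemma dirDeriv_X {σ : Type*} [Fintype σ] [DecidableEq σ] (x δ : σ → K) (s : σ) :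
    dirDeriv x δ (X s) = δ s := by
  rw [dirDeriv, Finset.sum_eq_single s]
  · simp
  · intro t _ hts; simp [pderiv_X_of_ne hts.symm]
  · simp

/-- The chain rule along a polynomial path. -/
lemma eval_derivative_aeval {σ : Type*} [Fintype σ] (γ : σ → K[X]) (s : K) (F : MvPolynomial σ K) :
    (Polynomial.derivative (aeval γ F)).eval s =
      dirDeriv (fun a => (γ a).eval s) (fun a => (Polynomial.derivative (γ a)).eval s) F := by
  classical
  have hev : ∀ F : MvPolynomial σ K, (aeval γ F).eval s = eval (fun a => (γ a).eval s) F := by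
    intro F
    change (Polynomial.aeval s) (aeval γ F) = aeval (fun a => (γ a).eval s) F
    rw [← AlgHom.comp_apply, comp_aeval]
    rfl
  induction F using MvPolynomial.induction_on with
  | C r => simp [dirDeriv, Polynomial.algebraMap_eq]
  | add p q hp hq => rw [map_add, map_add, Polynomial.eval_add, hp, hq, dirDeriv_add]
  | mul_X p i hp =>
    rw [map_mul, aeval_X, Polynomial.derivative_mul, Polynomial.eval_add, Polynomial.eval_mul,
      Polynomial.eval_mul, hp, dirDeriv_mul, dirDeriv_X, eval_X, hev]
    ring

/-- Tangency need only be tested on the bihomogeneous generators of the ideal. -/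
lemma mem_coneTangentSpace_iff {C : Set (BiProj K n m)} {p : BiProj K n m}
    (hp : p ∈ C) (δ : Coord n m → K) :
    δ ∈ coneTangentSpace C p ↔ ∀ (F : MvPolynomial (Coord n m) K) (d : ℕ × ℕ),
      IsWeightedHomogeneous (biWeight n m) F d → (∀ q ∈ C, eval q.coord F = 0) →
      dirDeriv p.coord δ F = 0 := by
  have hmem : δ ∈ coneTangentSpace C p ↔ ∀ F ∈ idealOf C, dirDeriv p.coord δ F = 0 := by
    simp only [coneTangentSpace, Submodule.mem_iInf, LinearMap.mem_ker, LinearMap.sum_apply,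
      LinearMap.smul_apply, LinearMap.proj_apply, smul_eq_mul, dirDeriv]
  rw [hmem]
  constructor
  · exact fun h F d hF hv => h F (Ideal.subset_span ⟨⟨d, hF⟩, hv⟩)
  · intro h F hF
    have hle : idealOf C ≤ RingHom.ker (eval p.coord) := Ideal.span_le.mpr fun G hG => hG.2 p hp
    induction hF using Submodule.span_induction with
    | mem F hF => exact h F hF.1.choose hF.1.choose_spec hF.2
    | zero => simp [dirDeriv]
    | add F G _ _ hF hG => rw [dirDeriv_add, hF, hG, add_zero]
    | smul G F hF ih =>
      rw [smul_eq_mul, dirDeriv_mul, ih, show eval p.coord F = 0 from hle hF]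
      ring

/-- A basis of the binary forms of degree `D`, adapted to a point `τ` of the line: the powers of
a local coordinate at `τ`. -/
noncomputable def localForm (D : ℕ) : Option K → ℕ → K[X]
  | some t, k => (Polynomial.X - Polynomial.C t) ^ k
  | none, k => Polynomial.X ^ (D - k)

lemma natDegree_localForm (D : ℕ) (τ : Option K) {k : ℕ} (hk : k ≤ D) :
    (localForm D τ k).natDegree ≤ D := by
  cases τ with
  | some t =>
    refine (Polynomial.natDegree_pow_le_of_le k (Polynomial.natDegree_X_sub_C_le t)).trans ?_
    simpa using hk
  | none => exact (Polynomial.natDegree_X_pow_le _).trans (Nat.sub_le _ _)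

lemma projEval_localForm_zero (D : ℕ) (τ : Option K) : projEval D τ (localForm D τ 0) = 1 := by
  cases τ <;> simp [localForm]

lemma projEval_localForm (D : ℕ) (τ : Option K) {k : ℕ} (hk : k ≤ D) (h0 : 0 < k) :
    projEval D τ (localForm D τ k) = 0 := by
  cases τ with
  | some t => simp [localForm, h0.ne']
  | none => simp [localForm, Polynomial.coeff_X_pow]; omega

lemma localForm_mul {D E : ℕ} (τ : Option K) {j k : ℕ} (hj : j ≤ D) (hk : k ≤ E) :
    localForm D τ j * localForm E τ k = localForm (D + E) τ (j + k) := by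
  cases τ with
  | some t => simp [localForm, pow_add]
  | none => simp only [localForm, ← pow_add]; congr 1; omega

lemma exists_sum_localForm {D : ℕ} (τ : Option K) {f : K[X]} (hf : f.natDegree ≤ D) :
    ∃ c : ℕ → K, f = ∑ k ∈ Finset.range (D + 1), c k • localForm D τ k := by
  cases τ with
  | some t =>
    refine ⟨fun k => (Polynomial.taylor t f).coeff k, ?_⟩
    conv_lhs => rw [← Polynomial.sum_taylor_eq f t]
    rw [Polynomial.sum_over_range' _ _ (D + 1) (by
      rw [Polynomial.natDegree_taylor]; omega)]
    · simp [localForm, Polynomial.smul_eq_C_mul]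
    · simp
  | none =>
    refine ⟨fun k => f.coeff (D - k), ?_⟩
    conv_lhs => rw [f.as_sum_range_C_mul_X_pow' (Nat.lt_succ_of_le hf)]
    rw [← Finset.sum_range_reflect]
    refine Finset.sum_congr rfl fun k hk => ?_
    rw [Polynomial.smul_eq_C_mul, localForm]
    congr 3

/-- The parametrisation is by rational normal curves: the `φ i` form a basis of the forms of degree
`n`, and the `ψ j` form a basis of the forms of degree `m`. -/
structure IsNormalParam (φ : Fin (n + 1) → K[X]) (ψ : Fin (m + 1) → K[X]) : Prop where
  natDegree_fst : ∀ i, (φ i).natDegree ≤ n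
  natDegree_snd : ∀ j, (ψ j).natDegree ≤ m
  span_fst : ∀ f : K[X], f.natDegree ≤ n → ∃ c : Fin (n + 1) → K, ∑ i, c i • φ i = f
  span_snd : ∀ f : K[X], f.natDegree ≤ m → ∃ c : Fin (m + 1) → K, ∑ j, c j • ψ j = f

/-- If `D + 1` polynomials span the polynomials of degree at most `D`, then they are linearly
independent. -/
lemma eq_zero_of_sum_smul_eq_zero {D : ℕ} {φ : Fin (D + 1) → K[X]}
    (hdeg : ∀ i, (φ i).natDegree ≤ D)
    (hspan : ∀ f : K[X], f.natDegree ≤ D → ∃ c : Fin (D + 1) → K, ∑ i, c i • φ i = f)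
    {c : Fin (D + 1) → K} (hc : ∑ i, c i • φ i = 0) : c = 0 := by
  let L : (Fin (D + 1) → K) →ₗ[K] Polynomial.degreeLT K (D + 1) :=
    Fintype.linearCombination K fun i => ⟨φ i, mem_degreeLT_succ_iff.mpr (hdeg i)⟩
  have hL : ∀ c, ((L c : Polynomial.degreeLT K (D + 1)) : K[X]) = ∑ i, c i • φ i := by
    intro c
    simp [L, Fintype.linearCombination_apply]
  have hfr : Module.finrank K (Fin (D + 1) → K) =
      Module.finrank K (Polynomial.degreeLT K (D + 1)) :=
    (Polynomial.degreeLTEquiv K (D + 1)).finrank_eq.symm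
  have : FiniteDimensional K (Polynomial.degreeLT K (D + 1)) :=
    (Polynomial.degreeLTEquiv K (D + 1)).symm.finiteDimensional
  have hinj : Function.Injective L := by
    rw [LinearMap.injective_iff_surjective_of_finrank_eq_finrank hfr]
    rintro ⟨f, hf⟩
    obtain ⟨c, hc⟩ := hspan f (mem_degreeLT_succ_iff.mp hf)
    exact ⟨c, Subtype.ext ((hL c).trans hc)⟩
  exact (injective_iff_map_eq_zero L).mp hinj c (Subtype.ext ((hL c).trans hc))

/-- A vector is determined by its pairings with the coefficient vectors of the local forms. -/
lemma eq_zero_of_pairing_localForm {D : ℕ} {φ : Fin (D + 1) → K[X]}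
    (hdeg : ∀ i, (φ i).natDegree ≤ D)
    (hspan : ∀ f : K[X], f.natDegree ≤ D → ∃ c : Fin (D + 1) → K, ∑ i, c i • φ i = f)
    (τ : Option K) {c : ℕ → Fin (D + 1) → K}
    (hc : ∀ k ≤ D, ∑ i, c k i • φ i = localForm D τ k) {x : Fin (D + 1) → K}
    (hx : ∀ k ≤ D, ∑ i, c k i * x i = 0) : x = 0 := by
  ext j
  obtain ⟨e, he⟩ := exists_sum_localForm τ (hdeg j)
  have h0 : (fun i => ∑ k ∈ Finset.range (D + 1), e k * c k i - (Pi.single j 1 : Fin (D + 1) → K) i)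
      = 0 := by
    refine eq_zero_of_sum_smul_eq_zero hdeg hspan ?_
    simp only [sub_smul, Finset.sum_sub_distrib, Finset.sum_smul, mul_smul]
    rw [Finset.sum_comm]
    simp only [← Finset.smul_sum]
    rw [Finset.sum_congr rfl fun k hk => by
      rw [hc k (Nat.lt_succ_iff.mp (Finset.mem_range.mp hk))], ← he, sub_eq_zero]
    rw [Finset.sum_eq_single j] <;> simp +contextual
  have h1 : ∀ i, (Pi.single j 1 : Fin (D + 1) → K) i = ∑ k ∈ Finset.range (D + 1), e k * c k i :=
    fun i => (sub_eq_zero.mp (congrFun h0 i)).symm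
  calc x j = ∑ i, (Pi.single j 1 : Fin (D + 1) → K) i * x i := by
        rw [Finset.sum_eq_single j] <;> simp +contextual
    _ = ∑ k ∈ Finset.range (D + 1), e k * ∑ i, c k i * x i := by
        simp only [h1, Finset.sum_mul, Finset.mul_sum]
        rw [Finset.sum_comm]
        simp only [mul_assoc]
    _ = 0 := Finset.sum_eq_zero fun k hk => by
        rw [hx k (Nat.lt_succ_iff.mp (Finset.mem_range.mp hk)), mul_zero]

variable {φ : Fin (n + 1) → K[X]} {ψ : Fin (m + 1) → K[X]}

/-- The linear form in the first block of variables with given coefficients. -/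
noncomputable def linFst (m : ℕ) (c : Fin (n + 1) → K) : MvPolynomial (Coord n m) K :=
  ∑ i, MvPolynomial.C (c i) * X (Sum.inl i)

/-- The linear form in the second block of variables with given coefficients. -/
noncomputable def linSnd (n : ℕ) (c : Fin (m + 1) → K) : MvPolynomial (Coord n m) K :=
  ∑ i, MvPolynomial.C (c i) * X (Sum.inr i)

lemma bihomogeneous_linFst (c : Fin (n + 1) → K) :
    IsWeightedHomogeneous (biWeight n m) (linFst m c) (1, 0) :=
  IsWeightedHomogeneous.sum _ _ _ fun i _ =>
    (isWeightedHomogeneous_X K (biWeight n m) (Sum.inl i)).C_mul _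

lemma bihomogeneous_linSnd (c : Fin (m + 1) → K) :
    IsWeightedHomogeneous (biWeight n m) (linSnd n c) (0, 1) :=
  IsWeightedHomogeneous.sum _ _ _ fun i _ =>
    (isWeightedHomogeneous_X K (biWeight n m) (Sum.inr i)).C_mul _

lemma paramHom_linFst (c : Fin (n + 1) → K) : paramHom φ ψ (linFst m c) = ∑ i, c i • φ i := by
  simp [linFst, paramHom, Polynomial.smul_eq_C_mul, Polynomial.algebraMap_eq]

lemma paramHom_linSnd (c : Fin (m + 1) → K) : paramHom φ ψ (linSnd n c) = ∑ i, c i • ψ i := by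
  simp [linSnd, paramHom, Polynomial.smul_eq_C_mul, Polynomial.algebraMap_eq]

lemma eval_linFst (c : Fin (n + 1) → K) (x : Coord n m → K) :
    eval x (linFst m c) = ∑ i, c i * x (Sum.inl i) := by simp [linFst]

lemma eval_linSnd (c : Fin (m + 1) → K) (x : Coord n m → K) :
    eval x (linSnd n c) = ∑ i, c i * x (Sum.inr i) := by simp [linSnd]

lemma dirDeriv_linFst (c : Fin (n + 1) → K) (x δ : Coord n m → K) :
    dirDeriv x δ (linFst m c) = ∑ i, c i * δ (Sum.inl i) := by
  simp only [dirDeriv, linFst, map_sum, Derivation.leibniz, pderiv_C,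
    smul_eq_mul, Finset.sum_mul]
  rw [Finset.sum_comm]
  refine Finset.sum_congr rfl fun i _ => ?_
  rw [Finset.sum_eq_single (Sum.inl i)]
  · simp
  · intro b _ hb; simp [pderiv_X_of_ne hb.symm]
  · simp

lemma dirDeriv_linSnd (c : Fin (m + 1) → K) (x δ : Coord n m → K) :
    dirDeriv x δ (linSnd n c) = ∑ i, c i * δ (Sum.inr i) := by
  simp only [dirDeriv, linSnd, map_sum, Derivation.leibniz, pderiv_C,
    smul_eq_mul, Finset.sum_mul]
  rw [Finset.sum_comm]
  refine Finset.sum_congr rfl fun i _ => ?_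
  rw [Finset.sum_eq_single (Sum.inr i)]
  · simp
  · intro b _ hb; simp [pderiv_X_of_ne hb.symm]
  · simp

/-- Monomials of degree `D * u` are products of `u` monomials of degree at most `D`. -/
lemma exists_lift_X_pow {D : ℕ} {d : ℕ × ℕ}
    (hD : ∀ k ≤ D, ∃ F, IsWeightedHomogeneous (biWeight n m) F d ∧
      paramHom φ ψ F = Polynomial.X ^ k) (u : ℕ) :
    ∀ k ≤ D * u, ∃ F, IsWeightedHomogeneous (biWeight n m) F (u • d) ∧
      paramHom φ ψ F = Polynomial.X ^ k := by
  induction u with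
  | zero =>
    intro k hk
    obtain rfl : k = 0 := by simpa using hk
    exact ⟨1, by simpa using isWeightedHomogeneous_one K _, by simp⟩
  | succ u ih =>
    intro k hk
    rw [Nat.mul_succ] at hk
    obtain ⟨F, hF, hFk⟩ := hD (min k D) (min_le_right _ _)
    obtain ⟨G, hG, hGk⟩ := ih (k - min k D) (by omega)
    refine ⟨G * F, by rw [succ_nsmul]; exact hG.mul hF, ?_⟩
    rw [map_mul, hFk, hGk, ← pow_add]
    congr 1
    omega

namespace IsNormalParam

/-- Every form of degree `n u + m v` is a combination of monomials, and each monomial is a product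
of `u` monomials of degree at most `n` and `v` monomials of degree at most `m`. -/
lemma isParam (h : IsNormalParam φ ψ) : IsParam n m φ ψ := by
  classical
  refine ⟨h.natDegree_fst, h.natDegree_snd, 0, fun u v _ _ f hf => ?_⟩
  have hx := exists_lift_X_pow (φ := φ) (ψ := ψ) (D := n) (d := (1, 0)) (fun k hk => by
    obtain ⟨c, hc⟩ := h.span_fst (Polynomial.X ^ k) ((Polynomial.natDegree_X_pow_le k).trans hk)
    exact ⟨_, bihomogeneous_linFst c, (paramHom_linFst c).trans hc⟩) u
  have hy := exists_lift_X_pow (φ := φ) (ψ := ψ) (D := m) (d := (0, 1)) (fun k hk => by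
    obtain ⟨c, hc⟩ := h.span_snd (Polynomial.X ^ k) ((Polynomial.natDegree_X_pow_le k).trans hk)
    exact ⟨_, bihomogeneous_linSnd c, (paramHom_linSnd c).trans hc⟩) v
  have hxy : ∀ k ≤ n * u + m * v, ∃ F, IsWeightedHomogeneous (biWeight n m) F (u, v) ∧
      paramHom φ ψ F = Polynomial.X ^ k := by
    intro k hk
    obtain ⟨F, hF, hFk⟩ := hx (min k (n * u)) (min_le_right _ _)
    obtain ⟨G, hG, hGk⟩ := hy (k - min k (n * u)) (by omega)
    refine ⟨F * G, by simpa using hF.mul hG, ?_⟩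
    rw [map_mul, hFk, hGk, ← pow_add]
    congr 1
    omega
  have hle : Polynomial.degreeLT K (n * u + m * v + 1) ≤
      (weightedHomogeneousSubmodule K (biWeight n m) (u, v)).map (paramHom φ ψ).toLinearMap := by
    rw [Polynomial.degreeLT_eq_span_X_pow, Submodule.span_le]
    intro g hg
    simp only [Finset.coe_image, Finset.coe_range, Set.mem_image, Set.mem_Iio] at hg
    obtain ⟨k, hk, rfl⟩ := hg
    obtain ⟨F, hF, hFk⟩ := hxy k (by omega)
    exact ⟨F, hF, hFk⟩
  obtain ⟨F, hF, hFf⟩ := hle (mem_degreeLT_succ_iff.mpr hf)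
  exact ⟨F, hF, hFf⟩

end IsNormalParam

end NormalParam

/-! ### Smoothness -/

section Smooth

variable {K : Type*} [Field K] {n m : ℕ}

/-- The velocity of a polynomial path in the cone over `C` is tangent to the cone. -/
lemma derivative_mem_coneTangentSpace {C : Set (BiProj K n m)} {p : BiProj K n m} (hp : p ∈ C)
    (γ : Coord n m → K[X]) (s : K) (hs : ∀ a, (γ a).eval s = p.coord a)
    (hγ : ∀ (F : MvPolynomial (Coord n m) K) (d : ℕ × ℕ),
      IsWeightedHomogeneous (biWeight n m) F d → (∀ q ∈ C, eval q.coord F = 0) →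
      ∀ t, eval (fun a => (γ a).eval t) F = 0) [Infinite K] :
    (fun a => (Polynomial.derivative (γ a)).eval s) ∈ coneTangentSpace C p := by
  rw [mem_coneTangentSpace_iff hp]
  intro F d hF hv
  have h0 : aeval γ F = 0 := by
    refine Polynomial.funext fun t => ?_
    rw [Polynomial.eval_zero, ← hγ F d hF hv t]
    change (Polynomial.aeval t) (aeval γ F) = aeval (fun a => (γ a).eval t) F
    rw [← AlgHom.comp_apply, comp_aeval]
    rfl
  rw [show p.coord = fun a => (γ a).eval s from funext fun a => (hs a).symm,
    ← eval_derivative_aeval, h0]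
  simp

/-- The two Euler directions are tangent to the cone over any set. -/
lemma euler_mem_coneTangentSpace [Infinite K] {C : Set (BiProj K n m)} {p : BiProj K n m}
    (hp : p ∈ C) (l r : K) :
    (fun a => Sum.elim (fun _ => l) (fun _ => r) a * p.coord a) ∈ coneTangentSpace C p := by
  have := derivative_mem_coneTangentSpace hp (fun a => Polynomial.C (p.coord a) *
    (1 + Polynomial.C (Sum.elim (fun _ => l) (fun _ => r) a) * Polynomial.X)) 0 (by simp) (by
      intro F d hF hv t
      have := eval_scale hF (1 + l * t) (1 + r * t) p.coord
      rw [hv p hp, mul_zero] at this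
      rw [← this]
      congr 2
      ext (a | a) <;> simp <;> ring)
  convert this using 2 with a
  simp
  ring

namespace IsNormalParam

variable {φ : Fin (n + 1) → K[X]} {ψ : Fin (m + 1) → K[X]}

/-- A tangent vector at the point of parameter `τ`, along which the linear form pulling back to the
local coordinate at `τ` has nonzero derivative. It is the velocity of the parametrisation, rescaled
to pass through the chosen coordinates of the point; at infinity, the reversed polynomials give the
parametrisation in the coordinate `1 / t`. -/
lemma exists_mem_coneTangentSpace [Infinite K] (h : IsNormalParam φ ψ) (hm : 0 < m)
    {p : BiProj K n m} {τ : Option K} (hp : IsRep (paramVec n m φ ψ τ) p) :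
    ∃ δ ∈ coneTangentSpace (paramCurve n m φ ψ) p, ∃ r : K, r ≠ 0 ∧
      ∀ c : Fin (m + 1) → K, ∑ j, c j • ψ j = localForm m τ 1 → ∑ j, c j * δ (Sum.inr j) = r := by
  obtain ⟨l, r, hl, hr, hlr⟩ := id hp
  have hpC : p ∈ paramCurve n m φ ψ := ⟨τ, hp⟩
  cases τ with
  | some t =>
    refine ⟨_, derivative_mem_coneTangentSpace hpC (fun a =>
      Polynomial.C (Sum.elim (fun _ => l⁻¹) (fun _ => r⁻¹) a) * Sum.elim φ ψ a) t ?_ ?_,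
      r⁻¹, inv_ne_zero hr, fun c hc => ?_⟩
    · intro a
      have := congrFun hlr a
      cases a <;> simp [paramVec] at this ⊢ <;> rw [this] <;> field_simp
    · intro F d hF hv s
      obtain ⟨q, hq⟩ := h.isParam.exists_point (some s)
      have := ((hq.scale (inv_ne_zero hl) (inv_ne_zero hr)).eval_eq_zero_iff hF).mpr
        (hv q ⟨_, hq⟩)
      rw [← this]
      congr 2
      ext (a | a) <;> simp [paramVec]
    · have hd := congrArg (fun f => (Polynomial.derivative f).eval t) hc
      simp only [Polynomial.derivative_sum, Polynomial.eval_finsetSum, Polynomial.derivative_smul,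
        Polynomial.eval_smul, smul_eq_mul, localForm] at hd
      simp at hd
      calc _ = r⁻¹ * ∑ j, c j * (Polynomial.derivative (ψ j)).eval t := by
            rw [Finset.mul_sum]
            exact Finset.sum_congr rfl fun j _ => by simp; ring
        _ = r⁻¹ := by rw [hd, mul_one]
  | none =>
    refine ⟨_, derivative_mem_coneTangentSpace hpC (fun a =>
      Polynomial.C (Sum.elim (fun _ => l⁻¹) (fun _ => r⁻¹) a) *
        Sum.elim (fun i => Polynomial.reflect n (φ i)) (fun j => Polynomial.reflect m (ψ j)) a)
      0 ?_ ?_, r⁻¹, inv_ne_zero hr, fun c hc => ?_⟩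
    · intro a
      have := congrFun hlr a
      cases a <;> simp [paramVec] at this ⊢ <;>
        rw [← Polynomial.coeff_zero_eq_eval_zero, Polynomial.coeff_reflect] <;>
        simp [this] <;> field_simp
    · intro F d hF hv s
      by_cases hs : s = 0
      · subst hs
        refine Eq.trans ?_ (hv p hpC)
        congr 2
        ext a
        have := congrFun hlr a
        cases a <;> simp [paramVec] at this ⊢ <;>
          rw [← Polynomial.coeff_zero_eq_eval_zero, Polynomial.coeff_reflect] <;>
          simp [this] <;> field_simp
      · obtain ⟨q, hq⟩ := h.isParam.exists_point (some s⁻¹)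
        have hrefl : ∀ (N : ℕ) (f : K[X]), f.natDegree ≤ N →
            (Polynomial.reflect N f).eval s = s ^ N * f.eval s⁻¹ := by
          intro N f hf
          have hinv : Invertible s⁻¹ := invertibleOfNonzero (inv_ne_zero hs)
          have := Polynomial.eval₂_reflect_mul_pow (RingHom.id K) s⁻¹ N f hf
          rw [invOf_eq_inv, inv_inv, Polynomial.eval₂_id, Polynomial.eval₂_id] at this
          rw [← this, inv_pow, mul_comm, mul_assoc, inv_mul_cancel₀ (pow_ne_zero _ hs), mul_one]
        have := ((hq.scale (l := l⁻¹ * s ^ n) (r := r⁻¹ * s ^ m)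
          (mul_ne_zero (inv_ne_zero hl) (pow_ne_zero _ hs))
          (mul_ne_zero (inv_ne_zero hr) (pow_ne_zero _ hs))).eval_eq_zero_iff hF).mpr
          (hv q ⟨_, hq⟩)
        rw [← this]
        congr 2
        ext (a | a)
        · simp [paramVec, hrefl n _ (h.natDegree_fst a), mul_assoc]
        · simp [paramVec, hrefl m _ (h.natDegree_snd a), mul_assoc]
    · have hd := congrArg (fun f : K[X] => f.coeff (m - 1)) hc
      simp [localForm, Polynomial.finsetSum_coeff] at hd
      have hc1 : ∀ j, (Polynomial.derivative (Polynomial.reflect m (ψ j))).eval 0 =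
          (ψ j).coeff (m - 1) := by
        intro j
        rw [← Polynomial.coeff_zero_eq_eval_zero, Polynomial.coeff_derivative,
          Polynomial.coeff_reflect, Polynomial.revAt_le (by omega)]
        simp
      calc _ = r⁻¹ * ∑ j, c j * (ψ j).coeff (m - 1) := by
            rw [Finset.mul_sum]
            refine Finset.sum_congr rfl fun j _ => ?_
            simp [hc1]; ring
        _ = r⁻¹ := by rw [hd, mul_one]

/-- A curve parametrised by rational normal curves is smooth. At the point of parameter `τ`, the
linear forms `x k` and `y k` pulling back to the `k`-th
powers of the local coordinate satisfy `x 0 * x k = x 1 * x (k - 1)`, `y 0 * y k = y 1 * y (k - 1)`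
and `x 0 * y 1 = x 1 * y 0`; differentiating, a tangent vector is determined by its values on
`x 0`, `y 0` and `y 1`. The two Euler directions and the velocity of the parametrisation show that
these values are arbitrary. -/
theorem isSmoothCurve [Infinite K] (h : IsNormalParam φ ψ) (hm : 0 < m) :
    IsSmoothCurve (paramCurve n m φ ψ) := by
  intro p hpC
  obtain ⟨τ, hp⟩ := id hpC
  obtain ⟨l, r, hl, hr, hlr⟩ := id hp
  have hex1 : ∀ k, ∃ c : Fin (n + 1) → K, k ≤ n → ∑ i, c i • φ i = localForm n τ k := by
    intro k
    by_cases hk : k ≤ n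
    · obtain ⟨c, hc⟩ := h.span_fst _ (natDegree_localForm n τ hk)
      exact ⟨c, fun _ => hc⟩
    · exact ⟨0, fun h => absurd h hk⟩
  have hex2 : ∀ k, ∃ c : Fin (m + 1) → K, k ≤ m → ∑ i, c i • ψ i = localForm m τ k := by
    intro k
    by_cases hk : k ≤ m
    · obtain ⟨c, hc⟩ := h.span_snd _ (natDegree_localForm m τ hk)
      exact ⟨c, fun _ => hc⟩
    · exact ⟨0, fun h => absurd h hk⟩
  choose cx hcx using hex1
  choose cy hcy using hex2
  set V := coneTangentSpace (paramCurve n m φ ψ) p with hV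
  -- values of the linear forms at `p`
  have hxv : ∀ k ≤ n, l * eval p.coord (linFst m (cx k)) = projEval n τ (localForm n τ k) := by
    intro k hk
    have h1 := h.isParam.eval_paramVec (bihomogeneous_linFst (m := m) (cx k)) τ
    rw [hlr, eval_scale (bihomogeneous_linFst (m := m) (cx k)), paramHom_linFst, hcx k hk] at h1
    simpa using h1
  have hyv : ∀ k ≤ m, r * eval p.coord (linSnd n (cy k)) = projEval m τ (localForm m τ k) := by
    intro k hk
    have h1 := h.isParam.eval_paramVec (bihomogeneous_linSnd (n := n) (cy k)) τ
    rw [hlr, eval_scale (bihomogeneous_linSnd (n := n) (cy k)), paramHom_linSnd, hcy k hk] at h1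
    simpa using h1
  have hx0 : eval p.coord (linFst m (cx 0)) ≠ 0 := fun h0 => by
    have := hxv 0 (Nat.zero_le _)
    rw [h0, mul_zero, projEval_localForm_zero] at this
    exact zero_ne_one this
  have hy0 : eval p.coord (linSnd n (cy 0)) ≠ 0 := fun h0 => by
    have := hyv 0 (Nat.zero_le _)
    rw [h0, mul_zero, projEval_localForm_zero] at this
    exact zero_ne_one this
  have hxk : ∀ k ≤ n, 0 < k → eval p.coord (linFst m (cx k)) = 0 := fun k hk h0 => by
    have := hxv k hk
    rw [projEval_localForm n τ hk h0] at this
    exact (mul_eq_zero.mp this).resolve_left hl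
  have hyk : ∀ k ≤ m, 0 < k → eval p.coord (linSnd n (cy k)) = 0 := fun k hk h0 => by
    have := hyv k hk
    rw [projEval_localForm m τ hk h0] at this
    exact (mul_eq_zero.mp this).resolve_left hr
  -- relations between the forms
  have hrel : ∀ {F G : MvPolynomial (Coord n m) K} {d : ℕ × ℕ} (δ : Coord n m → K), δ ∈ V →
      IsWeightedHomogeneous (biWeight n m) F d → IsWeightedHomogeneous (biWeight n m) G d →
      paramHom φ ψ F = paramHom φ ψ G → dirDeriv p.coord δ F = dirDeriv p.coord δ G := by
    intro F G d δ hδ hF hG hFG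
    rw [← sub_eq_zero, ← dirDeriv_sub]
    exact (mem_coneTangentSpace_iff hpC δ).mp hδ _ d (hF.sub hG)
      ((h.isParam.eval_eq_zero_iff (hF.sub hG)).mpr (by rw [map_sub, hFG, sub_self]))
  have hX : ∀ δ ∈ V, ∀ k ≤ n, 2 ≤ k → dirDeriv p.coord δ (linFst m (cx k)) = 0 := by
    intro δ hδ k hk hk2
    have := hrel δ hδ ((bihomogeneous_linFst (cx 0)).mul (bihomogeneous_linFst (cx k)))
      ((bihomogeneous_linFst (cx 1)).mul (bihomogeneous_linFst (cx (k - 1)))) (by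
        rw [map_mul, map_mul, paramHom_linFst, paramHom_linFst, paramHom_linFst, paramHom_linFst,
          hcx 0 (by omega), hcx k hk, hcx 1 (by omega), hcx (k - 1) (by omega),
          localForm_mul τ (by omega) (by omega), localForm_mul τ (by omega) (by omega)]
        congr 1; omega)
    rw [dirDeriv_mul, dirDeriv_mul, hxk k hk (by omega), hxk 1 (by omega) (by omega),
      hxk (k - 1) (by omega) (by omega)] at this
    simpa [hx0] using this
  have hY : ∀ δ ∈ V, ∀ k ≤ m, 2 ≤ k → dirDeriv p.coord δ (linSnd n (cy k)) = 0 := by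
    intro δ hδ k hk hk2
    have := hrel δ hδ ((bihomogeneous_linSnd (cy 0)).mul (bihomogeneous_linSnd (cy k)))
      ((bihomogeneous_linSnd (cy 1)).mul (bihomogeneous_linSnd (cy (k - 1)))) (by
        rw [map_mul, map_mul, paramHom_linSnd, paramHom_linSnd, paramHom_linSnd, paramHom_linSnd,
          hcy 0 (by omega), hcy k hk, hcy 1 (by omega), hcy (k - 1) (by omega),
          localForm_mul τ (by omega) (by omega), localForm_mul τ (by omega) (by omega)]
        congr 1; omega)
    rw [dirDeriv_mul, dirDeriv_mul, hyk k hk (by omega), hyk 1 (by omega) (by omega),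
      hyk (k - 1) (by omega) (by omega)] at this
    simpa [hy0] using this
  have hXY : ∀ δ ∈ V, 1 ≤ n → eval p.coord (linFst m (cx 0)) *
      dirDeriv p.coord δ (linSnd n (cy 1)) = eval p.coord (linSnd n (cy 0)) *
      dirDeriv p.coord δ (linFst m (cx 1)) := by
    intro δ hδ hn
    have := hrel δ hδ ((bihomogeneous_linFst (cx 0)).mul (bihomogeneous_linSnd (cy 1)))
      ((bihomogeneous_linFst (cx 1)).mul (bihomogeneous_linSnd (cy 0))) (by
        rw [map_mul, map_mul, paramHom_linFst, paramHom_linFst, paramHom_linSnd, paramHom_linSnd,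
          hcx 0 (by omega), hcy 1 hm, hcx 1 hn, hcy 0 (by omega),
          localForm_mul τ (by omega) (by omega), localForm_mul τ (by omega) (by omega)])
    rw [dirDeriv_mul, dirDeriv_mul, hyk 1 hm (by omega), hxk 1 hn (by omega)] at this
    simpa using this
  -- the three coordinates on the tangent space
  let Λ : V →ₗ[K] (Fin 3 → K) := LinearMap.pi ![
    (∑ i, cx 0 i • (LinearMap.proj (Sum.inl i) : (Coord n m → K) →ₗ[K] K)).comp V.subtype,
    (∑ j, cy 0 j • (LinearMap.proj (Sum.inr j) : (Coord n m → K) →ₗ[K] K)).comp V.subtype,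
    (∑ j, cy 1 j • (LinearMap.proj (Sum.inr j) : (Coord n m → K) →ₗ[K] K)).comp V.subtype]
  have hΛ0 : ∀ δ : V, Λ δ 0 = ∑ i, cx 0 i * δ.1 (Sum.inl i) := fun δ => by simp [Λ]
  have hΛ1 : ∀ δ : V, Λ δ 1 = ∑ j, cy 0 j * δ.1 (Sum.inr j) := fun δ => by simp [Λ]
  have hΛ2 : ∀ δ : V, Λ δ 2 = ∑ j, cy 1 j * δ.1 (Sum.inr j) := fun δ => by simp [Λ]
  have hinj : Function.Injective Λ := by
    rw [injective_iff_map_eq_zero]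
    rintro ⟨δ, hδ⟩ h0
    have h00 := (hΛ0 ⟨δ, hδ⟩).symm.trans (congrFun h0 0)
    have h01 := (hΛ1 ⟨δ, hδ⟩).symm.trans (congrFun h0 1)
    have h02 := (hΛ2 ⟨δ, hδ⟩).symm.trans (congrFun h0 2)
    have hx : (fun i => δ (Sum.inl i)) = 0 := by
      refine eq_zero_of_pairing_localForm h.natDegree_fst h.span_fst τ hcx fun k hk => ?_
      rw [← dirDeriv_linFst (m := m) (cx k) p.coord δ]
      match k with
      | 0 => rw [dirDeriv_linFst]; exact h00
      | 1 =>
        have := hXY δ hδ hk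
        rw [dirDeriv_linSnd, show ∑ i, cy 1 i * δ (Sum.inr i) = 0 from h02, mul_zero] at this
        exact (mul_eq_zero.mp this.symm).resolve_left hy0
      | k + 2 => exact hX δ hδ _ hk (by omega)
    have hy : (fun i => δ (Sum.inr i)) = 0 := by
      refine eq_zero_of_pairing_localForm h.natDegree_snd h.span_snd τ hcy fun k hk => ?_
      rw [← dirDeriv_linSnd (n := n) (cy k) p.coord δ]
      match k with
      | 0 => rw [dirDeriv_linSnd]; exact h01
      | 1 => rw [dirDeriv_linSnd]; exact h02
      | k + 2 => exact hY δ hδ _ hk (by omega)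
    ext (i | j)
    exacts [congrFun hx i, congrFun hy j]
  have hsurj : Function.Surjective Λ := by
    intro w
    obtain ⟨δ, hδ, e, he, hδe⟩ := h.exists_mem_coneTangentSpace hm hp
    have hδ1 := hδe (cy 1) (hcy 1 hm)
    set T : V := (w 2 / e) • ⟨δ, hδ⟩ with hT
    set l' := (w 0 - Λ T 0) / eval p.coord (linFst m (cx 0)) with hl'
    set r' := (w 1 - Λ T 1) / eval p.coord (linSnd n (cy 0)) with hr'
    have hE : ∀ (c : Fin (m + 1) → K), ∑ j, c j * (r' * p.coord (Sum.inr j)) =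
        r' * eval p.coord (linSnd n c) := by
      intro c
      rw [eval_linSnd, Finset.mul_sum]
      exact Finset.sum_congr rfl fun j _ => by ring
    refine ⟨⟨_, euler_mem_coneTangentSpace hpC l' r'⟩ + T, ?_⟩
    rw [map_add]
    ext i
    fin_cases i
    · simp only [Fin.zero_eta, Pi.add_apply]
      rw [hΛ0]
      have : ∑ i, cx 0 i * (l' * p.coord (Sum.inl i)) = w 0 - Λ T 0 := by
        rw [show ∑ i, cx 0 i * (l' * p.coord (Sum.inl i)) = l' * eval p.coord (linFst m (cx 0)) by
          rw [eval_linFst, Finset.mul_sum]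
          exact Finset.sum_congr rfl fun j _ => by ring]
        rw [hl', div_mul_cancel₀ _ hx0]
      simp only [Sum.elim_inl]
      rw [this, sub_add_cancel]
    · simp only [Fin.mk_one, Pi.add_apply]
      rw [hΛ1]
      simp only [Sum.elim_inr]
      rw [hE, hr', div_mul_cancel₀ _ hy0, sub_add_cancel]
    · simp only [Fin.reduceFinMk, Pi.add_apply]
      rw [hΛ2]
      simp only [Sum.elim_inr]
      rw [hE, hyk 1 hm one_pos, mul_zero, zero_add, hT, map_smul, Pi.smul_apply, hΛ2, hδ1,
        smul_eq_mul, div_mul_cancel₀ _ he]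
  rw [(LinearEquiv.ofBijective Λ ⟨hinj, hsurj⟩).finrank_eq, Module.finrank_fin_fun]

end IsNormalParam

end Smooth

/-! ### Sections over an irreducible curve, and corresponding pencils -/

section Bezout

variable {K : Type*} [Field K] {n m : ℕ}

/-- Restriction of a polynomial in the bihomogeneous coordinates to the chosen coordinates of the
points of `C`. -/
noncomputable def restrictTo (C : Set (BiProj K n m)) :
    MvPolynomial (Coord n m) K →ₗ[K] (C → K) :=
  LinearMap.pi fun p => (aeval p.1.coord : MvPolynomial (Coord n m) K →ₐ[K] K).toLinearMap

lemma restrictTo_apply {C : Set (BiProj K n m)} (F : MvPolynomial (Coord n m) K) (p : C) :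
    restrictTo C F p = eval p.1.coord F := rfl

/-- The graded pieces of the bihomogeneous coordinate ring of `C`, as spaces of functions. -/
noncomputable def sections (C : Set (BiProj K n m)) (u v : ℕ) : Submodule K (C → K) :=
  (weightedHomogeneousSubmodule K (biWeight n m) (u, v)).map (restrictTo C)

variable {C : Set (BiProj K n m)}

lemma finrank_sections (u v : ℕ) : Module.finrank K (sections C u v) = hilbertFunction C u v := by
  refine finrank_map_eq_of_ker _ _ _ fun F hF => ?_
  refine Iff.trans ?_ (mk_idealOf_eq_zero_iff hF).symm
  rw [funext_iff]
  simp [restrictTo_apply]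

instance (u v : ℕ) : FiniteDimensional K (sections C u v) := by
  have hle : weightedHomogeneousSubmodule K (biWeight n m) (u, v) ≤
      weightedHomogeneousSubmodule K (fun _ : Coord n m => 1) (u + v) := by
    intro F hF e he
    have := hF he
    rw [Finsupp.weight_apply, Finsupp.sum] at this ⊢
    have h1 := congrArg Prod.fst this
    have h2 := congrArg Prod.snd this
    rw [Prod.fst_sum] at h1
    rw [Prod.snd_sum] at h2
    simp only at h1 h2
    rw [← h1, ← h2, ← Finset.sum_add_distrib]
    refine Finset.sum_congr rfl fun i _ => ?_
    rcases i with i | i <;> simp [biWeight]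
  have hfg : FiniteDimensional K
      (weightedHomogeneousSubmodule K (fun _ : Coord n m => 1) (u + v)) :=
    Module.Finite.iff_fg.mpr (weightedHomogeneousSubmodule_fg (R := K) _ (by simp) _)
  have := Submodule.finiteDimensional_of_le hle
  unfold sections
  infer_instance

lemma sections_mul {u v u' v' : ℕ} {f g : C → K} (hf : f ∈ sections C u v)
    (hg : g ∈ sections C u' v') : f * g ∈ sections C (u + u') (v + v') := by
  obtain ⟨F, hF, rfl⟩ := hf
  obtain ⟨G, hG, rfl⟩ := hg
  refine ⟨F * G, IsWeightedHomogeneous.mul hF hG, ?_⟩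
  ext p
  simp [restrictTo_apply]

/-- On an irreducible set, the sections have no zero divisors. -/
lemma sections_eq_zero_or_eq_zero (hC : IsIrreducible C) {u v u' v' : ℕ} {f g : C → K}
    (hf : f ∈ sections C u v) (hg : g ∈ sections C u' v') (hfg : f * g = 0) : f = 0 ∨ g = 0 := by
  obtain ⟨F, hF, rfl⟩ := hf
  obtain ⟨G, hG, rfl⟩ := hg
  by_contra! hne
  obtain ⟨p, hp⟩ := Function.ne_iff.mp hne.1
  obtain ⟨q, hq⟩ := Function.ne_iff.mp hne.2
  obtain ⟨r, hrC, hrF, hrG⟩ := hC.2 {p | eval p.coord F ≠ 0} {p | eval p.coord G ≠ 0}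
    (isOpen_basicOpen _ hF) (isOpen_basicOpen _ hG) ⟨p, p.2, hp⟩ ⟨q, q.2, hq⟩
  exact mul_ne_zero hrF hrG (congrFun hfg ⟨r, hrC⟩)

lemma exists_section_ne_zero (p : C) (u v : ℕ) : ∃ f ∈ sections C u v, f p ≠ 0 := by
  obtain ⟨i, hi⟩ := (isRep_coord p.1).fst_ne_zero
  obtain ⟨j, hj⟩ := (isRep_coord p.1).snd_ne_zero
  refine ⟨_, ⟨X (Sum.inl i) ^ u * X (Sum.inr j) ^ v, ?_, rfl⟩, ?_⟩
  · have := ((isWeightedHomogeneous_X K (biWeight n m) (Sum.inl i)).pow u).mul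
      ((isWeightedHomogeneous_X K (biWeight n m) (Sum.inr j)).pow v)
    change IsWeightedHomogeneous _ _ _
    convert this using 1
    simp [biWeight]
  · rw [restrictTo_apply]
    simp [hi, hj]

/-- Sections of large bidegree separate the points of finite sets. -/
lemma exists_section_separating [DecidableEq C] (S : Finset C) (p : C) (hp : p ∉ S) {u v : ℕ}
    (hu : S.card ≤ u) (hv : S.card ≤ v) :
    ∃ f ∈ sections C u v, f p ≠ 0 ∧ ∀ q ∈ S, f q = 0 := by
  induction S using Finset.induction_on generalizing u v with
  | empty =>
    obtain ⟨f, hf, hfp⟩ := exists_section_ne_zero p u v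
    exact ⟨f, hf, hfp, by simp⟩
  | insert q S hq ih =>
    rw [Finset.card_insert_of_notMem hq] at hu hv
    obtain ⟨u, rfl⟩ := Nat.exists_eq_add_of_le' (Nat.one_le_of_lt hu)
    obtain ⟨v, rfl⟩ := Nat.exists_eq_add_of_le' (Nat.one_le_of_lt hv)
    rw [Finset.mem_insert, not_or] at hp
    obtain ⟨f, hf, hfp, hfS⟩ := ih hp.2 (Nat.le_of_succ_le_succ hu) (Nat.le_of_succ_le_succ hv)
    obtain ⟨g, hg, hgp, hgq⟩ : ∃ g ∈ sections C 1 1, g p ≠ 0 ∧ g q = 0 := by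
      obtain ⟨F, hF, hFq, hFp⟩ := exists_separating_linear (fun h => hp.1 (Subtype.ext h))
      rcases hF with hF | hF
      · obtain ⟨g, hg, hgp⟩ := exists_section_ne_zero p 0 1
        exact ⟨restrictTo C F * g, sections_mul ⟨F, hF, rfl⟩ hg, mul_ne_zero hFp hgp, by
          rw [Pi.mul_apply, restrictTo_apply, hFq, zero_mul]⟩
      · obtain ⟨g, hg, hgp⟩ := exists_section_ne_zero p 1 0
        exact ⟨g * restrictTo C F, sections_mul hg ⟨F, hF, rfl⟩, mul_ne_zero hgp hFp, by
          rw [Pi.mul_apply, restrictTo_apply, hFq, mul_zero]⟩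
    refine ⟨f * g, sections_mul hf hg, mul_ne_zero hfp hgp, fun x hx => ?_⟩
    rcases Finset.mem_insert.mp hx with rfl | hx
    · rw [Pi.mul_apply, hgq, mul_zero]
    · rw [Pi.mul_apply, hfS x hx, zero_mul]

/-- The sections vanishing at a finite set of points. -/
noncomputable def vanishing (u v : ℕ) (S : Finset C) : Submodule K (C → K) :=
  (LinearMap.ker ((LinearMap.funLeft K K (Subtype.val : S → C)).domRestrict
    (sections C u v))).map (sections C u v).subtype

lemma mem_vanishing {u v : ℕ} {S : Finset C} {f : C → K} :
    f ∈ vanishing u v S ↔ f ∈ sections C u v ∧ ∀ q ∈ S, f q = 0 := by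
  simp only [vanishing, Submodule.mem_map, LinearMap.mem_ker, Submodule.coe_subtype]
  constructor
  · rintro ⟨⟨f, hf⟩, h0, rfl⟩
    exact ⟨hf, fun q hq => congrFun h0 ⟨q, hq⟩⟩
  · rintro ⟨hf, h0⟩
    exact ⟨⟨f, hf⟩, funext fun q => h0 q q.2, rfl⟩

instance (u v : ℕ) (S : Finset C) : FiniteDimensional K (vanishing u v S) := by
  unfold vanishing
  infer_instance

/-- Distinct points impose independent conditions on the sections of large bidegree. -/
lemma finrank_vanishing {u v : ℕ} (S : Finset C) (hu : S.card ≤ u) (hv : S.card ≤ v) :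
    Module.finrank K (vanishing u v S) + S.card = hilbertFunction C u v := by
  classical
  rw [← finrank_sections, vanishing, Submodule.finrank_map_subtype_eq,
    ← LinearMap.finrank_range_add_finrank_ker ((LinearMap.funLeft K K
      (Subtype.val : S → C)).domRestrict (sections C u v)), add_comm]
  congr 1
  have hsurj : LinearMap.range ((LinearMap.funLeft K K
      (Subtype.val : S → C)).domRestrict (sections C u v)) = ⊤ := by
    rw [LinearMap.range_eq_top]
    intro w
    have hex : ∀ s : S, ∃ f ∈ sections C u v, f s ≠ 0 ∧ ∀ q ∈ S.erase s, f q = 0 := fun s =>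
      exists_section_separating (S.erase s) s (Finset.notMem_erase _ _)
        ((Finset.card_erase_le).trans hu) ((Finset.card_erase_le).trans hv)
    choose f hf hfs hf0 using hex
    refine ⟨⟨∑ s : S, (w s / f s s) • f s, Submodule.sum_mem _ fun s _ =>
      Submodule.smul_mem _ _ (hf s)⟩, ?_⟩
    ext s
    simp only [LinearMap.domRestrict_apply, LinearMap.funLeft_apply, Finset.sum_apply,
      Pi.smul_apply, smul_eq_mul]
    rw [Finset.sum_eq_single s]
    · exact div_mul_cancel₀ _ (hfs s)
    · intro t _ hts
      rw [hf0 t s (Finset.mem_erase.mpr ⟨fun h => hts (Subtype.ext h.symm), s.2⟩), mul_zero]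
    · simp
  rw [hsurj, finrank_top, Module.finrank_fintype_fun_eq_card, Fintype.card_coe]

/-- Multiplication by a nonzero section preserves dimensions. -/
lemma finrank_map_mulLeft (hC : IsIrreducible C) {u v u' v' : ℕ} {g : C → K}
    (hg : g ∈ sections C u' v') (hg0 : g ≠ 0) {M : Submodule K (C → K)}
    (hM : M ≤ sections C u v) :
    Module.finrank K (M.map (LinearMap.mulLeft K g)) = Module.finrank K M := by
  rw [finrank_map_eq_of_ker M _ (LinearMap.id : (C → K) →ₗ[K] (C → K)) (fun f hf => ?_),
    Submodule.map_id]
  constructor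
  · exact fun h0 => (sections_eq_zero_or_eq_zero hC hg (hM hf) h0).resolve_left hg0
  · rintro h0
    rw [show f = 0 from h0, map_zero]

/-- A hyperplane section of the irreducible curve `C`, by a form `H` of bidegree `(0, 1)`, has
degree `b`; if it contains a set `S` of `b` points of `C`, then every section of large bidegree that
vanishes on `S` is divisible by `H`. -/
lemma exists_eq_mul (hC : IsIrreducible C) {a b : ℕ} (hab : HasBidegree C a b) :
    ∃ N : ℕ, ∀ (S : Finset C) (_ : S.card = b) (H : C → K) (_ : H ∈ sections C 0 1) (_ : H ≠ 0)
      (_ : ∀ q ∈ S, H q = 0) (u v : ℕ) (_ : N ≤ u) (_ : N ≤ v) (f : C → K)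
      (_ : f ∈ sections C u (v + 1)) (_ : ∀ q ∈ S, f q = 0), ∃ g ∈ sections C u v, f = H * g := by
  obtain ⟨c, N, hN⟩ := hab
  refine ⟨max N b, fun S hS H hH hH0 hHS u v hu hv f hf hfS => ?_⟩
  have hle : (sections C u v).map (LinearMap.mulLeft K H) ≤ vanishing u (v + 1) S := by
    rintro _ ⟨g, hg, rfl⟩
    rw [mem_vanishing]
    refine ⟨?_, fun q hq => by simp [hHS q hq]⟩
    have := sections_mul hH hg
    rwa [zero_add, add_comm 1] at this
  have hfr1 : Module.finrank K ((sections C u v).map (LinearMap.mulLeft K H)) =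
      hilbertFunction C u v := by
    rw [finrank_map_mulLeft hC hH hH0 le_rfl, finrank_sections]
  have hfr2 := finrank_vanishing (u := u) (v := v + 1) S (by omega) (by omega)
  have h1 := hN u v (by omega) (by omega)
  have h2 := hN u (v + 1) (by omega) (by omega)
  have heq := Submodule.eq_of_le_of_finrank_eq hle (by
    rw [hfr1]
    push_cast at h2
    zify at hfr2 ⊢
    rw [hS] at hfr2
    linarith)
  have hfm : f ∈ (sections C u v).map (LinearMap.mulLeft K H) := by
    rw [heq, mem_vanishing]
    exact ⟨hf, hfS⟩
  obtain ⟨g, hg, rfl⟩ := hfm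
  exact ⟨g, hg, rfl⟩

/-- Two pencils of hyperplane sections of an irreducible curve of bidegree `(a, b)` with `a < b`.
The pencil spanned by `H₁, H₂`, of bidegree `(0, 1)`, has `b - 1` base points `P t`, `t ∈ T`, on the
curve; the pencil spanned by `M₁, M₂`, of bidegree `(1, 0)`, has the base points `P t` with
`t ≠ k`. If the two pencils correspond at the points `P r₁`, `P r₂`, `P r₃`, then they correspond
at all points. Otherwise `B = M₁ H₂ - M₂ H₁` is not zero. For every section `G` that vanishes at
`P k`, divisibility gives `M₁ G = H₁ G'` and `H₂ G' - M₂ G = H₂ E`, whence `B G = H₁ H₂ E`, and `E`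
vanishes at `P r₃`; so `G ↦ E` is an injection from a space of dimension `h(u, v) - 1` to one of
dimension `h(u + 1, v - 1) - 1`, which is smaller as `a < b`. -/
theorem pencils_correspond (hC : IsIrreducible C) {a b : ℕ} (hbd : HasBidegree C a b) (hab : a < b)
    {ι : Type*} [DecidableEq ι] {P : ι → C} (hP : Function.Injective P) (T : Finset ι)
    (hT : T.card + 1 = b) {k r₁ r₂ r₃ : ι} (hr₁ : r₁ ∉ T) (hr₂ : r₂ ∉ T)
    {H₁ H₂ M₁ M₂ : C → K} (hH₁ : H₁ ∈ sections C 0 1) (hH₂ : H₂ ∈ sections C 0 1)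
    (hM₁ : M₁ ∈ sections C 1 0) (hM₂ : M₂ ∈ sections C 1 0)
    (hH₁r₃ : H₁ (P r₃) ≠ 0) (hH₂r₃ : H₂ (P r₃) ≠ 0)
    (hH₁T : ∀ t ∈ T, H₁ (P t) = 0) (hH₂T : ∀ t ∈ T, H₂ (P t) = 0)
    (hM₁T : ∀ t ∈ T, t ≠ k → M₁ (P t) = 0) (hM₂T : ∀ t ∈ T, t ≠ k → M₂ (P t) = 0)
    (hH₁r₁ : H₁ (P r₁) = 0) (hH₂r₂ : H₂ (P r₂) = 0) (hM₁r₁ : M₁ (P r₁) = 0)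
    (hM₂r₂ : M₂ (P r₂) = 0) (hr₃ : M₁ (P r₃) * H₂ (P r₃) = M₂ (P r₃) * H₁ (P r₃)) :
    M₁ * H₂ = M₂ * H₁ := by
  classical
  have hH₁0 : H₁ ≠ 0 := fun h => hH₁r₃ (congrFun h _)
  have hH₂0 : H₂ ≠ 0 := fun h => hH₂r₃ (congrFun h _)
  by_contra hne
  set B := M₁ * H₂ - M₂ * H₁ with hB
  have hB0 : B ≠ 0 := fun h => hne (sub_eq_zero.mp h)
  have hBmem : B ∈ sections C 1 1 := by
    have h1 := sections_mul hM₁ hH₂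
    have h2 := sections_mul hM₂ hH₁
    exact Submodule.sub_mem _ h1 h2
  have hHH : H₁ * H₂ ∈ sections C 0 2 := sections_mul hH₁ hH₂
  have hHH0 : H₁ * H₂ ≠ 0 := fun h =>
    (sections_eq_zero_or_eq_zero hC hH₁ hH₂ h).elim hH₁0 hH₂0
  obtain ⟨N, hN⟩ := exists_eq_mul hC hbd
  obtain ⟨c, N', hN'⟩ := hbd
  have hcard : ∀ r ∉ T, ((insert r T).map ⟨P, hP⟩).card = b := fun r hr => by
    rw [Finset.card_map, Finset.card_insert_of_notMem hr, hT]
  have hmem : ∀ {f : C → K} {r : ι}, (∀ t ∈ T, f (P t) = 0) → f (P r) = 0 →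
      ∀ q ∈ (insert r T).map ⟨P, hP⟩, f q = 0 := by
    intro f r hfT hfr q hq
    obtain ⟨t, ht, rfl⟩ := Finset.mem_map.mp hq
    rcases Finset.mem_insert.mp ht with rfl | ht
    exacts [hfr, hfT t ht]
  obtain ⟨u, hu⟩ : ∃ u, u = max N N' + 1 := ⟨_, rfl⟩
  obtain ⟨v, hv⟩ : ∃ v, v = max N N' + 1 := ⟨_, rfl⟩
  have hle : (vanishing u (v + 1) {P k}).map (LinearMap.mulLeft K B) ≤
      (vanishing (u + 1) v {P r₃}).map (LinearMap.mulLeft K (H₁ * H₂)) := by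
    rintro _ ⟨G, hG, rfl⟩
    rw [SetLike.mem_coe, mem_vanishing] at hG
    have hGk : G (P k) = 0 := hG.2 _ (Finset.mem_singleton_self _)
    obtain ⟨G', hG', hMG⟩ := hN _ (hcard r₁ hr₁) H₁ hH₁ hH₁0 (hmem hH₁T hH₁r₁) (1 + u) v
      (by omega) (by omega) (M₁ * G) (by simpa using sections_mul hM₁ hG.1)
      (hmem (fun t ht => by
        by_cases htk : t = k
        · rw [Pi.mul_apply, htk, hGk, mul_zero]
        · rw [Pi.mul_apply, hM₁T t ht htk, zero_mul]) (by rw [Pi.mul_apply, hM₁r₁, zero_mul]))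
    obtain ⟨E, hE, hGE⟩ := hN _ (hcard r₂ hr₂) H₂ hH₂ hH₂0 (hmem hH₂T hH₂r₂) (1 + u) v
      (by omega) (by omega) (G' * H₂ - M₂ * G)
      (Submodule.sub_mem _ (by simpa using sections_mul hG' hH₂)
        (by simpa using sections_mul hM₂ hG.1))
      (hmem (fun t ht => by
        by_cases htk : t = k
        · rw [Pi.sub_apply, Pi.mul_apply, Pi.mul_apply, hH₂T t ht, htk, hGk, mul_zero, mul_zero,
            sub_zero]
        · simp [hH₂T t ht, hM₂T t ht htk]) (by simp [hH₂r₂, hM₂r₂]))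
    have hBG : B * G = H₁ * H₂ * E := by
      rw [hB]
      linear_combination H₂ * hMG + H₁ * hGE
    refine ⟨E, ?_, hBG.symm⟩
    rw [SetLike.mem_coe, mem_vanishing]
    refine ⟨by rwa [add_comm u 1], ?_⟩
    rintro q hq
    rw [Finset.mem_singleton.mp hq]
    have h0 := congrFun hBG (P r₃)
    simp only [Pi.mul_apply, hB, Pi.sub_apply, hr₃, sub_self, zero_mul] at h0
    exact (mul_eq_zero.mp h0.symm).resolve_left (mul_ne_zero hH₁r₃ hH₂r₃)
  have hsub : ∀ (x y : ℕ) (S : Finset C), vanishing x y S ≤ sections C x y :=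
    fun x y S f hf => (mem_vanishing.mp hf).1
  have hdim := Submodule.finrank_mono hle
  rw [finrank_map_mulLeft hC hBmem hB0 (hsub _ _ _), finrank_map_mulLeft hC hHH hHH0 (hsub _ _ _)]
    at hdim
  have h1 := finrank_vanishing (u := u) (v := v + 1) {P k} (by simp [hu]) (by simp [hv])
  have h2 := finrank_vanishing (u := u + 1) (v := v) {P r₃} (by simp) (by simp [hv])
  rw [Finset.card_singleton] at h1 h2
  have h3 := hN' u (v + 1) (by omega) (by omega)
  have h4 := hN' (u + 1) v (by omega) (by omega)
  push_cast at h3 h4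
  zify at h1 h2 hdim hab
  linarith

end Bezout

/-! ### The distinguished curve of points in normal position -/

section Frames

variable {K : Type*} [Field K] {n : ℕ}

/-- The Lagrange polynomials of the nodes `v`, up to scalar factors. -/
noncomputable def nodeBasis {D : ℕ} (v : Fin (D + 1) → K) (i : Fin (D + 1)) : K[X] :=
  ∏ l ∈ Finset.univ.erase i, (Polynomial.X - Polynomial.C (v l))

lemma eval_nodeBasis_mul {D : ℕ} (v : Fin (D + 1) → K) (i : Fin (D + 1)) (t : K) :
    (nodeBasis v i).eval t * (t - v i) = ∏ l, (t - v l) := by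
  rw [nodeBasis, Polynomial.eval_prod, ← Finset.prod_erase_mul _ _ (Finset.mem_univ i)]
  simp

lemma natDegree_nodeBasis {D : ℕ} (v : Fin (D + 1) → K) (i : Fin (D + 1)) :
    (nodeBasis v i).natDegree = D := by
  rw [nodeBasis, Polynomial.natDegree_prod_of_monic _ _ fun l _ => Polynomial.monic_X_sub_C _]
  simp

lemma coeff_nodeBasis {D : ℕ} (v : Fin (D + 1) → K) (i : Fin (D + 1)) :
    (nodeBasis v i).coeff D = 1 := by
  have : (nodeBasis v i).Monic :=
    Polynomial.monic_prod_of_monic _ _ fun l _ => Polynomial.monic_X_sub_C _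
  have h := this.coeff_natDegree
  rwa [natDegree_nodeBasis] at h

lemma eval_nodeBasis_of_ne {D : ℕ} (v : Fin (D + 1) → K) {i j : Fin (D + 1)} (hij : i ≠ j) :
    (nodeBasis v j).eval (v i) = 0 := by
  rw [nodeBasis, Polynomial.eval_prod]
  exact Finset.prod_eq_zero (Finset.mem_erase.mpr ⟨hij, Finset.mem_univ _⟩) (by simp)

lemma eval_nodeBasis_self_ne_zero {D : ℕ} {v : Fin (D + 1) → K} (hv : Function.Injective v)
    (i : Fin (D + 1)) : (nodeBasis v i).eval (v i) ≠ 0 := by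
  rw [nodeBasis, Polynomial.eval_prod, Finset.prod_ne_zero_iff]
  intro l hl
  simpa [sub_eq_zero] using hv.ne (Finset.ne_of_mem_erase hl).symm

/-- Lagrange interpolation, after a linear change of basis. -/
lemma exists_sum_smul_nodeBasis {D : ℕ} {v : Fin (D + 1) → K} (hv : Function.Injective v)
    {A : Matrix (Fin (D + 1)) (Fin (D + 1)) K} (hA : IsUnit A.det) {f : K[X]}
    (hf : f.natDegree ≤ D) :
    ∃ c : Fin (D + 1) → K, ∑ i, c i • ∑ l, A i l • nodeBasis v l = f := by
  set g : Fin (D + 1) → K := fun l => f.eval (v l) / (nodeBasis v l).eval (v l) with hg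
  have hfg : ∑ l, g l • nodeBasis v l = f := by
    rw [← sub_eq_zero]
    refine Polynomial.eq_zero_of_natDegree_lt_card_of_eval_eq_zero _ hv (fun i => ?_) ?_
    · rw [Polynomial.eval_sub, Polynomial.eval_finsetSum, Finset.sum_eq_single i]
      · simp [hg, eval_nodeBasis_self_ne_zero hv i]
      · intro l _ hl
        simp [eval_nodeBasis_of_ne v hl.symm]
      · simp
    · rw [Fintype.card_fin, Nat.lt_succ_iff]
      refine (Polynomial.natDegree_sub_le _ _).trans (max_le ?_ hf)
      exact Polynomial.natDegree_sum_le_of_forall_le _ _ fun l _ =>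
        (Polynomial.natDegree_smul_le _ _).trans (natDegree_nodeBasis v l).le
  refine ⟨Matrix.vecMul g A⁻¹, ?_⟩
  have h1 : Matrix.vecMul (Matrix.vecMul g A⁻¹) A = g := by
    rw [Matrix.vecMul_vecMul, Matrix.nonsing_inv_mul A hA, Matrix.vecMul_one]
  conv_rhs => rw [← hfg, ← h1]
  simp only [Finset.smul_sum, smul_smul]
  rw [Finset.sum_comm]
  refine Finset.sum_congr rfl fun l _ => ?_
  rw [← Finset.sum_smul]
  rfl

/-- The nodes for the parametrisation of the first factor: the vector `c` is proportional to
the values at `0` of the corresponding Lagrange polynomials. -/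
def nodesFst (c : Fin (n + 1) → K) : Fin (n + 1) → K := fun i => -(c i)⁻¹

/-- The nodes for the second factor: those for the first factor, and `0`. -/
def nodesSnd (c : Fin (n + 1) → K) : Fin (n + 1 + 1) → K :=
  Fin.snoc (α := fun _ => K) (nodesFst c) 0

lemma nodesFst_injective {c : Fin (n + 1) → K} (hc : Function.Injective c) :
    Function.Injective (nodesFst c) := fun i j hij => hc (by simpa [nodesFst] using hij)

lemma nodesSnd_castSucc (c : Fin (n + 1) → K) (i : Fin (n + 1)) :
    nodesSnd c i.castSucc = -(c i)⁻¹ := by simp [nodesSnd, nodesFst]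

lemma nodesSnd_last (c : Fin (n + 1) → K) : nodesSnd c (Fin.last (n + 1)) = 0 := by
  simp [nodesSnd]

lemma nodesSnd_injective {c : Fin (n + 1) → K} (hc : Function.Injective c) (hc0 : ∀ i, c i ≠ 0) :
    Function.Injective (nodesSnd c) := by
  intro i j
  induction i using Fin.lastCases with
  | last =>
    induction j using Fin.lastCases with
    | last => exact fun _ => rfl
    | cast j => rw [nodesSnd_last, nodesSnd_castSucc]; intro h; simp [hc0 j] at h
  | cast i =>
    induction j using Fin.lastCases with
    | last => rw [nodesSnd_last, nodesSnd_castSucc]; intro h; simp [hc0 i] at h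
    | cast j =>
      rw [nodesSnd_castSucc, nodesSnd_castSucc]
      intro h
      have hij : c i = c j := by simpa using h
      rw [hc hij]

/-- The first components of `n + 3` points in normal position: the coordinate points, the point
`c`, and the unit point. -/
def frameFst (c : Fin (n + 1) → K) (i : Fin (n + 3)) (j : Fin (n + 1)) : K :=
  if (i : ℕ) ≤ n then if (i : ℕ) = j then 1 else 0 else if (i : ℕ) = n + 1 then c j else 1

/-- The second components of `n + 3` points in normal position: the coordinate points and the unit
point. -/
def frameSnd (K : Type*) [Field K] (n : ℕ) (i : Fin (n + 3)) (j : Fin (n + 1 + 1)) : K :=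
  if (i : ℕ) ≤ n + 1 then if (i : ℕ) = j then 1 else 0 else 1

/-- The first half of the parametrisation of the distinguished curve. -/
noncomputable def curveFst (c : Fin (n + 1) → K) (A : Matrix (Fin (n + 1)) (Fin (n + 1)) K)
    (i : Fin (n + 1)) : K[X] :=
  ∑ l, A i l • nodeBasis (nodesFst c) l

/-- The second half of the parametrisation of the distinguished curve. -/
noncomputable def curveSnd (c : Fin (n + 1) → K)
    (B : Matrix (Fin (n + 1 + 1)) (Fin (n + 1 + 1)) K) (i : Fin (n + 1 + 1)) : K[X] :=
  ∑ l, B i l • nodeBasis (nodesSnd c) l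

variable {c : Fin (n + 1) → K} (hc : Function.Injective c) (hc0 : ∀ i, c i ≠ 0)
  {A : Matrix (Fin (n + 1)) (Fin (n + 1)) K} (hA : IsUnit A.det)
  {B : Matrix (Fin (n + 1 + 1)) (Fin (n + 1 + 1)) K} (hB : IsUnit B.det)

include hc hc0 hA hB in
lemma isNormalParam_curve : IsNormalParam (curveFst c A) (curveSnd c B) where
  natDegree_fst _ := Polynomial.natDegree_sum_le_of_forall_le _ _ fun l _ =>
    (Polynomial.natDegree_smul_le _ _).trans (natDegree_nodeBasis _ l).le
  natDegree_snd _ := Polynomial.natDegree_sum_le_of_forall_le _ _ fun l _ =>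
    (Polynomial.natDegree_smul_le _ _).trans (natDegree_nodeBasis _ l).le
  span_fst _ hf := exists_sum_smul_nodeBasis (nodesFst_injective hc) hA hf
  span_snd _ hf := exists_sum_smul_nodeBasis (nodesSnd_injective hc hc0) hB hf

/-- A point with components `A x` and `B y` lies on the distinguished curve if `x` and `y` are
proportional to the values at some parameter of the Lagrange polynomials. -/
lemma isRep_paramVec_curve {p : BiProj K n (n + 1)} {x : Fin (n + 1) → K} {y : Fin (n + 1 + 1) → K}
    (hp : IsRep (Sum.elim (A.mulVec x) (B.mulVec y)) p) {τ : Option K} {s t : K} (hs : s ≠ 0)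
    (ht : t ≠ 0) (hx : ∀ j, projEval n τ (nodeBasis (nodesFst c) j) = s * x j)
    (hy : ∀ j, projEval (n + 1) τ (nodeBasis (nodesSnd c) j) = t * y j) :
    p ∈ paramCurve n (n + 1) (curveFst c A) (curveSnd c B) := by
  refine ⟨τ, ?_⟩
  convert hp.scale hs ht using 1
  ext (i | i)
  · simp only [paramVec, curveFst, Sum.elim_inl, map_sum, map_smul, hx, Matrix.mulVec, dotProduct,
      Finset.mul_sum, smul_eq_mul]
    exact Finset.sum_congr rfl fun l _ => by ring
  · simp only [paramVec, curveSnd, Sum.elim_inr, map_sum, map_smul, hy, Matrix.mulVec, dotProduct,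
      Finset.mul_sum, smul_eq_mul]
    exact Finset.sum_congr rfl fun l _ => by ring

lemma projEval_none_nodeBasis {D : ℕ} (v : Fin (D + 1) → K) (i : Fin (D + 1)) :
    projEval D none (nodeBasis v i) = 1 := coeff_nodeBasis v i

include hc hc0 in
/-- The distinguished curve passes through the points of the frame, at the parameters given by the
nodes, `0` and infinity. -/
lemma mem_curve_of_frame {p : BiProj K n (n + 1)} (i : Fin (n + 3))
    (hp : IsRep (Sum.elim (A.mulVec (frameFst c i)) (B.mulVec (frameSnd K n i))) p) :
    p ∈ paramCurve n (n + 1) (curveFst c A) (curveSnd c B) := by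
  have hprod : ∀ t : K, (∀ j : Fin (n + 1), t - nodesFst c j ≠ 0) → ∀ j : Fin (n + 1),
      (nodeBasis (nodesFst c) j).eval t = (∏ l, (t - nodesFst c l)) / (t - nodesFst c j) :=
    fun t ht j => by rw [eq_div_iff (ht j), eval_nodeBasis_mul]
  rcases lt_trichotomy (i : ℕ) (n + 1) with hi | hi | hi
  · have h1 := eval_nodeBasis_self_ne_zero (nodesFst_injective hc) ⟨i, hi⟩
    have h2 := eval_nodeBasis_self_ne_zero (nodesSnd_injective hc hc0) (Fin.castSucc ⟨i, hi⟩)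
    rw [nodesSnd_castSucc] at h2
    refine isRep_paramVec_curve hp (τ := some (nodesFst c ⟨i, hi⟩)) h1 h2
      (fun j => ?_) (fun j => ?_)
    · by_cases hij : (i : ℕ) = j
      · obtain rfl : (⟨i, hi⟩ : Fin (n + 1)) = j := Fin.ext hij
        simp [frameFst, Nat.le_of_lt_succ hi]
      · rw [frameFst, if_pos (Nat.le_of_lt_succ hi), if_neg hij, mul_zero]
        exact eval_nodeBasis_of_ne _ fun h => hij (congrArg Fin.val h)
    · by_cases hij : (i : ℕ) = j
      · obtain rfl : (Fin.castSucc ⟨i, hi⟩ : Fin (n + 1 + 1)) = j := Fin.ext hij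
        simp [frameSnd, hi.le, nodesFst]
      · rw [frameSnd, if_pos hi.le, if_neg hij, mul_zero]
        change (nodeBasis (nodesSnd c) j).eval (-(c ⟨i, hi⟩)⁻¹) = 0
        rw [← nodesSnd_castSucc]
        exact eval_nodeBasis_of_ne _ fun h => hij (congrArg Fin.val h)
  · have h0 : ∀ j, (0 : K) - nodesFst c j ≠ 0 := fun j => by simp [nodesFst, hc0 j]
    have h2 := eval_nodeBasis_self_ne_zero (nodesSnd_injective hc hc0) (Fin.last (n + 1))
    rw [nodesSnd_last] at h2
    have hP : ∏ l, (0 - nodesFst c l) ≠ 0 := Finset.prod_ne_zero_iff.mpr fun j _ => h0 j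
    refine isRep_paramVec_curve hp (τ := some 0) hP h2
      (fun j => ?_) (fun j => ?_)
    · rw [projEval_some, hprod 0 h0]
      simp [frameFst, hi, nodesFst]
    · by_cases hij : (i : ℕ) = j
      · obtain rfl : Fin.last (n + 1) = j := Fin.ext (by simp [← hij, hi])
        simp [frameSnd, hi]
      · rw [frameSnd, if_pos hi.le, if_neg hij, mul_zero]
        change (nodeBasis (nodesSnd c) j).eval 0 = 0
        have := eval_nodeBasis_of_ne (nodesSnd c) (i := Fin.last (n + 1)) (j := j)
          fun h => hij (hi.trans (congrArg Fin.val h))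
        rwa [nodesSnd_last] at this
  · refine isRep_paramVec_curve hp (τ := none) one_ne_zero one_ne_zero (fun j => ?_) (fun j => ?_)
    · rw [projEval_none_nodeBasis, frameFst, if_neg (by omega), if_neg (by omega), mul_one]
    · rw [projEval_none_nodeBasis, frameSnd, if_neg (by omega), mul_one]

include hc0 in
/-- The solutions, with nonzero coordinates, of the bilinear equations of the distinguished curve
in normal position are its points: the second relation makes `c i * ((y i)⁻¹ - y_last⁻¹)`
independent of `i`, and this quantity determines the parameter. -/
lemma exists_parameter {x : Fin (n + 1) → K} {y : Fin (n + 1 + 1) → K} (hx : ∀ i, x i ≠ 0)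
    (hy : ∀ i, y i ≠ 0)
    (h1 : ∀ j k : Fin (n + 1), j ≠ k → x k * y j.castSucc = x j * y k.castSucc)
    (h2 : ∀ j l : Fin (n + 1), j ≠ l → (c l - c j) * x l * y j.castSucc =
      (c l * x j - c j * x l) * y (Fin.last _)) :
    ∃ (τ : Option K) (s t : K), s ≠ 0 ∧ t ≠ 0 ∧
      (∀ j, projEval n τ (nodeBasis (nodesFst c) j) = s * x j) ∧
      ∀ j, projEval (n + 1) τ (nodeBasis (nodesSnd c) j) = t * y j := by
  obtain ⟨z, hz⟩ : ∃ z, z = y (Fin.last _) := ⟨_, rfl⟩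
  obtain ⟨ρ, hρ⟩ : ∃ ρ, ρ = x 0 / y (Fin.castSucc 0) := ⟨_, rfl⟩
  obtain ⟨w, hw⟩ : ∃ w, w = c 0 * ((y (Fin.castSucc 0))⁻¹ - z⁻¹) := ⟨_, rfl⟩
  have hz0 : z ≠ 0 := hz ▸ hy _
  have hρ0 : ρ ≠ 0 := hρ ▸ div_ne_zero (hx _) (hy _)
  have hxy : ∀ i, x i = ρ * y i.castSucc := by
    intro i
    by_cases hi : i = 0
    · rw [hi, hρ, div_mul_cancel₀ _ (hy _)]
    · have := h1 0 i (Ne.symm hi)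
      have hy0 := hy (Fin.castSucc 0)
      rw [hρ]
      field_simp
      exact this
  have hwi : ∀ i, c i * ((y i.castSucc)⁻¹ - z⁻¹) = w := by
    intro i
    by_cases hi : i = 0
    · rw [hi, hw]
    · have := h2 0 i (Ne.symm hi)
      rw [hxy i, hxy 0, ← hz] at this
      have hyi := hy i.castSucc
      have hy0 := hy (Fin.castSucc 0)
      have h3 : (c i - c 0) * y i.castSucc * y (Fin.castSucc 0) =
          (c i * y (Fin.castSucc 0) - c 0 * y i.castSucc) * z := by
        refine mul_left_cancel₀ hρ0 ?_
        linear_combination this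
      rw [hw]
      field_simp
      linear_combination -h3
  by_cases hw0 : w = 0
  · have hyz : ∀ i, y i = z := by
      intro i
      induction i using Fin.lastCases with
      | last => exact hz.symm
      | cast i =>
        have := hwi i
        rw [hw0] at this
        have := (mul_eq_zero.mp this).resolve_left (hc0 i)
        exact inv_injective (sub_eq_zero.mp this)
    refine ⟨none, (ρ * z)⁻¹, z⁻¹, inv_ne_zero (mul_ne_zero hρ0 hz0), inv_ne_zero hz0,
      fun j => ?_, fun j => ?_⟩
    · rw [projEval_none_nodeBasis, hxy, hyz, inv_mul_cancel₀ (mul_ne_zero hρ0 hz0)]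
    · rw [projEval_none_nodeBasis, hyz, inv_mul_cancel₀ hz0]
  · obtain ⟨t, ht⟩ : ∃ t, t = (w * z)⁻¹ := ⟨_, rfl⟩
    have hsnd : ∀ i, t - nodesSnd c i = (w * y i)⁻¹ := by
      intro i
      induction i using Fin.lastCases with
      | last => rw [nodesSnd_last, sub_zero, ← hz, ht]
      | cast i =>
        rw [nodesSnd_castSucc, ht]
        have := hwi i
        have hyi := hy i.castSucc
        have hci := hc0 i
        field_simp at this ⊢
        linear_combination -this
    have hfst : ∀ i, t - nodesFst c i = (w * y i.castSucc)⁻¹ := by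
      intro i
      rw [← hsnd, nodesSnd_castSucc]
      rfl
    have hne : ∀ i, (w * y i)⁻¹ ≠ 0 := fun i => inv_ne_zero (mul_ne_zero hw0 (hy i))
    have hP1 : ∏ l, (t - nodesFst c l) ≠ 0 :=
      Finset.prod_ne_zero_iff.mpr fun l _ => by rw [hfst]; exact hne _
    have hP2 : ∏ l, (t - nodesSnd c l) ≠ 0 :=
      Finset.prod_ne_zero_iff.mpr fun l _ => by rw [hsnd]; exact hne _
    refine ⟨some t, (∏ l, (t - nodesFst c l)) * w / ρ, (∏ l, (t - nodesSnd c l)) * w,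
      div_ne_zero (mul_ne_zero hP1 hw0) hρ0, mul_ne_zero hP2 hw0, fun j => ?_, fun j => ?_⟩
    · have := eval_nodeBasis_mul (nodesFst c) j t
      rw [hfst] at this
      have hyj := hy j.castSucc
      rw [projEval_some, hxy, ← this]
      field_simp
    · have := eval_nodeBasis_mul (nodesSnd c) j t
      rw [hsnd] at this
      have hyj := hy j
      rw [projEval_some, ← this]
      field_simp

end Frames

/-! ### Uniqueness of the distinguished curve -/

section Uniqueness

variable {K : Type*} [Field K] {n : ℕ}

/-- An irreducible curve of bidegree `(n, n + 1)` through the `n + 3` points in position `(c, A, B)`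
is contained in the distinguished curve. The pencils of hyperplanes through suitable subsets of the
points give the bilinear equations of the distinguished curve in the linear forms dual to the
frame. -/
lemma subset_distinguished [Infinite K] {c : Fin (n + 1) → K} (hc : Function.Injective c)
    (hc0 : ∀ i, c i ≠ 0)
    {A : Matrix (Fin (n + 1)) (Fin (n + 1)) K} (hA : IsUnit A.det)
    {B : Matrix (Fin (n + 1 + 1)) (Fin (n + 1 + 1)) K} (hB : IsUnit B.det)
    {p : Fin (n + 3) → BiProj K n (n + 1)}
    (hp : ∀ i, IsRep (Sum.elim (A.mulVec (frameFst c i)) (B.mulVec (frameSnd K n i))) (p i))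
    {C : Set (BiProj K n (n + 1))} (hC : IsCurveThrough p n (n + 1) C) :
    Function.Injective p ∧ C ⊆ paramCurve n (n + 1) (curveFst c A) (curveSnd c B) := by
  classical
  obtain ⟨⟨hCc, hCi, -⟩, hbd, hpC⟩ := hC
  -- the linear forms dual to the frame, as polynomials and as sections over `C`
  obtain ⟨X₁, hX₁, hXv⟩ : ∃ X₁ : Fin (n + 1) → MvPolynomial (Coord n (n + 1)) K,
      (∀ j, IsWeightedHomogeneous (biWeight n (n + 1)) (X₁ j) (1, 0)) ∧
      ∀ q j, eval q (X₁ j) = (A⁻¹.mulVec fun i => q (Sum.inl i)) j :=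
    ⟨fun j => linFst (n + 1) (A⁻¹ j), fun j => bihomogeneous_linFst _, fun q j => eval_linFst _ _⟩
  obtain ⟨Y₁, hY₁, hYv⟩ : ∃ Y₁ : Fin (n + 1 + 1) → MvPolynomial (Coord n (n + 1)) K,
      (∀ j, IsWeightedHomogeneous (biWeight n (n + 1)) (Y₁ j) (0, 1)) ∧
      ∀ q j, eval q (Y₁ j) = (B⁻¹.mulVec fun i => q (Sum.inr i)) j :=
    ⟨fun j => linSnd n (B⁻¹ j), fun j => bihomogeneous_linSnd _, fun q j => eval_linSnd _ _⟩
  have hex : ∀ i, ∃ l r : K, l ≠ 0 ∧ r ≠ 0 ∧ (∀ j, eval (p i).coord (X₁ j) = l * frameFst c i j) ∧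
      ∀ j, eval (p i).coord (Y₁ j) = r * frameSnd K n i j := by
    intro i
    obtain ⟨l, r, hl, hr, h⟩ := hp i
    refine ⟨l⁻¹, r⁻¹, inv_ne_zero hl, inv_ne_zero hr, fun j => ?_, fun j => ?_⟩
    · have h1 : (fun k => (p i).coord (Sum.inl k)) = l⁻¹ • A.mulVec (frameFst c i) := by
        ext k
        have := congrFun h (Sum.inl k)
        simp only [Sum.elim_inl] at this
        rw [Pi.smul_apply, this, smul_eq_mul, inv_mul_cancel_left₀ hl]
      rw [hXv, h1, Matrix.mulVec_smul, Matrix.mulVec_mulVec, Matrix.nonsing_inv_mul A hA,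
        Matrix.one_mulVec]
      rfl
    · have h1 : (fun k => (p i).coord (Sum.inr k)) = r⁻¹ • B.mulVec (frameSnd K n i) := by
        ext k
        have := congrFun h (Sum.inr k)
        simp only [Sum.elim_inr] at this
        rw [Pi.smul_apply, this, smul_eq_mul, inv_mul_cancel_left₀ hr]
      rw [hYv, h1, Matrix.mulVec_smul, Matrix.mulVec_mulVec, Matrix.nonsing_inv_mul B hB,
        Matrix.one_mulVec]
      rfl
  choose l r hl hr hlX hrY using hex
  have hpinj : Function.Injective p := by
    have key : ∀ i i' : Fin (n + 3), i < i' → p i ≠ p i' := by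
      intro i i' hii' heq
      have hi : (i : ℕ) < n + 1 + 1 := by have := i'.2; have : (i : ℕ) < i' := hii'; omega
      -- a coordinate that vanishes at one of the two points only
      obtain ⟨j, hj⟩ : ∃ j : Fin (n + 1 + 1), ¬ (frameSnd K n i j = 0 ↔ frameSnd K n i' j = 0) := by
        by_cases hi' : (i' : ℕ) ≤ n + 1
        · refine ⟨⟨i, hi⟩, ?_⟩
          have : (i : ℕ) ≠ i' := (Fin.val_fin_lt.mpr hii').ne
          simp [frameSnd, Nat.le_of_lt_succ hi, hi', this.symm]
        · refine ⟨if (i : ℕ) = 0 then 1 else 0, ?_⟩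
          by_cases h0 : (i : ℕ) = 0
          · simp [frameSnd, h0, hi']
          · simp [frameSnd, h0, hi', Nat.le_of_lt_succ hi]
      have h1 := hrY i j
      have h2 := hrY i' j
      rw [heq, h2] at h1
      apply hj
      constructor
      · intro h0
        rw [h0, mul_zero] at h1
        exact (mul_eq_zero.mp h1).resolve_left (hr i')
      · intro h0
        rw [h0, mul_zero] at h1
        exact (mul_eq_zero.mp h1.symm).resolve_left (hr i)
    intro i i' heq
    by_contra hne
    rcases lt_or_gt_of_ne hne with h | h
    exacts [key i i' h heq, key i' i h heq.symm]
  refine ⟨hpinj, ?_⟩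
  let P : Fin (n + 3) → C := fun i => ⟨p i, hpC i⟩
  have hP : Function.Injective P := fun i j h => hpinj (congrArg Subtype.val h)
  let ξ : Fin (n + 1) → C → K := fun j => restrictTo C (X₁ j)
  let η : Fin (n + 1 + 1) → C → K := fun j => restrictTo C (Y₁ j)
  have hξ : ∀ j, ξ j ∈ sections C 1 0 := fun j => ⟨_, hX₁ j, rfl⟩
  have hη : ∀ j, η j ∈ sections C 0 1 := fun j => ⟨_, hY₁ j, rfl⟩
  have hξP : ∀ j i, ξ j (P i) = l i * frameFst c i j := fun j i => hlX i j
  have hηP : ∀ j i, η j (P i) = r i * frameSnd K n i j := fun j i => hrY i j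
  -- the indices of the points, and the values of the forms there
  let e : Fin (n + 1) → Fin (n + 3) := fun j => ⟨j, by omega⟩
  let i₁ : Fin (n + 3) := ⟨n + 1, by omega⟩
  let i₂ : Fin (n + 3) := ⟨n + 2, by omega⟩
  have hF1 : ∀ (j : Fin (n + 1)) (i : Fin (n + 3)), i ≠ e j → i ≠ i₁ → i ≠ i₂ →
      frameFst c i j = 0 := by
    intro j i h1 h2 h3
    have h1' : (i : ℕ) ≠ j := fun h => h1 (Fin.ext h)
    have h2' : (i : ℕ) ≠ n + 1 := fun h => h2 (Fin.ext h)
    have h3' : (i : ℕ) ≠ n + 2 := fun h => h3 (Fin.ext h)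
    rw [frameFst, if_pos (by omega), if_neg h1']
  have hF2 : ∀ j : Fin (n + 1), frameFst c i₁ j = c j := fun j => by simp [frameFst, i₁]
  have hF3 : ∀ j : Fin (n + 1), frameFst c i₂ j = 1 := fun j => by simp [frameFst, i₂]
  have hG1 : ∀ (j : Fin (n + 1)) (i : Fin (n + 3)), i ≠ e j → i ≠ i₂ →
      frameSnd K n i j.castSucc = 0 := by
    intro j i h1 h3
    have h1' : (i : ℕ) ≠ j := fun h => h1 (Fin.ext h)
    have h3' : (i : ℕ) ≠ n + 2 := fun h => h3 (Fin.ext h)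
    rw [frameSnd, if_pos (by omega), if_neg (by simpa using h1')]
  have hG2 : ∀ i : Fin (n + 3), i ≠ i₁ → i ≠ i₂ → frameSnd K n i (Fin.last _) = 0 := by
    intro i h2 h3
    have h2' : (i : ℕ) ≠ n + 1 := fun h => h2 (Fin.ext h)
    have h3' : (i : ℕ) ≠ n + 2 := fun h => h3 (Fin.ext h)
    rw [frameSnd, if_pos (by omega), if_neg (by simpa using h2')]
  have hG3 : ∀ j, frameSnd K n i₂ j = 1 := fun j => by simp [frameSnd, i₂]
  have he : ∀ j, e j ≠ i₁ ∧ e j ≠ i₂ := fun j =>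
    ⟨fun h => by have := congrArg Fin.val h; simp [e, i₁] at this; omega,
      fun h => by have := congrArg Fin.val h; simp [e, i₂] at this; omega⟩
  have heinj : ∀ {j k}, j ≠ k → e j ≠ e k := fun h h' => h (Fin.ext (by simpa [e] using h'))
  have hi₁₂ : i₁ ≠ i₂ := fun h => by simpa [i₁, i₂] using congrArg Fin.val h
  have hcard : ∀ x y z : Fin (n + 3), x ≠ y → x ≠ z → y ≠ z →
      ({x, y, z}ᶜ : Finset (Fin (n + 3))).card + 1 = n + 1 := by
    intro x y z h1 h2 h3
    rw [Finset.card_compl, Finset.card_eq_three.mpr ⟨x, y, z, h1, h2, h3, rfl⟩, Fintype.card_fin]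
    omega
  -- the two pencils with base points away from `e j`, `e k` and the last point
  have rel1 : ∀ j k, j ≠ k → ξ k * η j.castSucc = ξ j * η k.castSucc := by
    intro j k hjk
    refine pencils_correspond hCi hbd (Nat.lt_succ_self n) hP {e j, e k, i₂}ᶜ
      (hcard _ _ _ (heinj hjk) (he j).2 (he k).2) (k := i₁) (r₁ := e j) (r₂ := e k) (r₃ := i₂)
      (by simp) (by simp) (hη _) (hη _) (hξ _) (hξ _) ?_ ?_ ?_ ?_ ?_ ?_ ?_ ?_ ?_ ?_ ?_
    · rw [hηP, hG3, mul_one]; exact hr _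
    · rw [hηP, hG3, mul_one]; exact hr _
    · intro t ht
      simp only [Finset.mem_compl, Finset.mem_insert, Finset.mem_singleton, not_or] at ht
      rw [hηP, hG1 k t ht.2.1 ht.2.2, mul_zero]
    · intro t ht
      simp only [Finset.mem_compl, Finset.mem_insert, Finset.mem_singleton, not_or] at ht
      rw [hηP, hG1 j t ht.1 ht.2.2, mul_zero]
    · intro t ht ht1
      simp only [Finset.mem_compl, Finset.mem_insert, Finset.mem_singleton, not_or] at ht
      rw [hξP, hF1 k t ht.2.1 ht1 ht.2.2, mul_zero]
    · intro t ht ht1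
      simp only [Finset.mem_compl, Finset.mem_insert, Finset.mem_singleton, not_or] at ht
      rw [hξP, hF1 j t ht.1 ht1 ht.2.2, mul_zero]
    · rw [hηP, hG1 k _ (heinj hjk) (he j).2, mul_zero]
    · rw [hηP, hG1 j _ (heinj hjk.symm) (he k).2, mul_zero]
    · rw [hξP, hF1 k _ (heinj hjk) (he j).1 (he j).2, mul_zero]
    · rw [hξP, hF1 j _ (heinj hjk.symm) (he k).1 (he k).2, mul_zero]
    · rw [hξP, hξP, hηP, hηP, hF3, hF3, hG3, hG3]
  -- the two pencils with base points away from `e j` and the last two points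
  have rel2 : ∀ j k, j ≠ k → ((c k - c j) • ξ k) * η j.castSucc =
      (c k • ξ j - c j • ξ k) * η (Fin.last _) := by
    intro j k hjk
    refine pencils_correspond hCi hbd (Nat.lt_succ_self n) hP {e j, i₁, i₂}ᶜ
      (hcard _ _ _ (he j).1 (he j).2 hi₁₂) (k := e k) (r₁ := e j) (r₂ := i₁) (r₃ := i₂)
      (by simp) (by simp) (hη _) (hη _) (Submodule.smul_mem _ _ (hξ _))
      (Submodule.sub_mem _ (Submodule.smul_mem _ _ (hξ _)) (Submodule.smul_mem _ _ (hξ _)))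
      ?_ ?_ ?_ ?_ ?_ ?_ ?_ ?_ ?_ ?_ ?_
    · rw [hηP, hG3, mul_one]; exact hr _
    · rw [hηP, hG3, mul_one]; exact hr _
    · intro t ht
      simp only [Finset.mem_compl, Finset.mem_insert, Finset.mem_singleton, not_or] at ht
      rw [hηP, hG2 t ht.2.1 ht.2.2, mul_zero]
    · intro t ht
      simp only [Finset.mem_compl, Finset.mem_insert, Finset.mem_singleton, not_or] at ht
      rw [hηP, hG1 j t ht.1 ht.2.2, mul_zero]
    · intro t ht ht1
      simp only [Finset.mem_compl, Finset.mem_insert, Finset.mem_singleton, not_or] at ht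
      rw [Pi.smul_apply, hξP, hF1 k t ht1 ht.2.1 ht.2.2, mul_zero, smul_zero]
    · intro t ht ht1
      simp only [Finset.mem_compl, Finset.mem_insert, Finset.mem_singleton, not_or] at ht
      rw [Pi.sub_apply, Pi.smul_apply, Pi.smul_apply, hξP, hξP, hF1 k t ht1 ht.2.1 ht.2.2,
        hF1 j t ht.1 ht.2.1 ht.2.2, mul_zero, smul_zero, smul_zero, sub_zero]
    · rw [hηP, hG2 _ (he j).1 (he j).2, mul_zero]
    · rw [hηP, hG1 j _ (he j).1.symm hi₁₂, mul_zero]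
    · rw [Pi.smul_apply, hξP, hF1 k _ (heinj hjk) (he j).1 (he j).2, mul_zero, smul_zero]
    · rw [Pi.sub_apply, Pi.smul_apply, Pi.smul_apply, hξP, hξP, hF2, hF2, smul_eq_mul, smul_eq_mul]
      ring
    · rw [Pi.sub_apply, Pi.smul_apply, Pi.smul_apply, Pi.smul_apply, hξP, hξP, hηP, hηP, hF3, hF3,
        hG3, hG3]
      simp only [smul_eq_mul]
      ring
  -- the open set where all the forms are nonzero meets `C` at the last point
  have hOwh := (IsWeightedHomogeneous.prod Finset.univ X₁ _ fun j _ => hX₁ j).mul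
    (IsWeightedHomogeneous.prod Finset.univ Y₁ _ fun j _ => hY₁ j)
  set Q := (∏ j, X₁ j) * ∏ j, Y₁ j with hQ
  have hQv : ∀ q : Coord n (n + 1) → K, eval q Q ≠ 0 ↔
      (∀ j, eval q (X₁ j) ≠ 0) ∧ ∀ j, eval q (Y₁ j) ≠ 0 := by
    intro q
    rw [hQ, map_mul, map_prod, map_prod, mul_ne_zero_iff, Finset.prod_ne_zero_iff,
      Finset.prod_ne_zero_iff]
    simp
  have hOopen : IsOpen {q : BiProj K n (n + 1) | eval q.coord Q ≠ 0} := isOpen_basicOpen _ hOwh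
  have hsub := subset_closure_inter_of_isPreirreducible_of_isOpen hCi.2 hOopen ⟨p i₂, hpC i₂, by
    change eval _ Q ≠ 0
    rw [hQv]
    refine ⟨fun j => ?_, fun j => ?_⟩
    · rw [hlX, hF3, mul_one]; exact hl _
    · rw [hrY, hG3, mul_one]; exact hr _⟩
  have hclosed := (isNormalParam_curve hc hc0 hA hB).isParam.isClosed
  refine hsub.trans (closure_minimal ?_ hclosed)
  rintro q ⟨hqC, hqO⟩
  obtain ⟨hqX, hqY⟩ := (hQv _).mp hqO
  obtain ⟨τ, s, t, hs, ht, hxs, hyt⟩ := exists_parameter hc0 (x := fun j => eval q.coord (X₁ j))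
    (y := fun j => eval q.coord (Y₁ j)) hqX hqY
    (fun j k hjk => congrFun (rel1 j k hjk) ⟨q, hqC⟩)
    (fun j k hjk => congrFun (rel2 j k hjk) ⟨q, hqC⟩)
  refine isRep_paramVec_curve ?_ hs ht hxs hyt
  convert isRep_coord q using 1
  have h1 : A.mulVec (fun j => eval q.coord (X₁ j)) = fun i => q.coord (Sum.inl i) := by
    rw [show (fun j => eval q.coord (X₁ j)) = A⁻¹.mulVec fun i => q.coord (Sum.inl i) from
      funext fun j => hXv q.coord j, Matrix.mulVec_mulVec, Matrix.mul_nonsing_inv A hA,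
      Matrix.one_mulVec]
  have h2 : B.mulVec (fun j => eval q.coord (Y₁ j)) = fun i => q.coord (Sum.inr i) := by
    rw [show (fun j => eval q.coord (Y₁ j)) = B⁻¹.mulVec fun i => q.coord (Sum.inr i) from
      funext fun j => hYv q.coord j, Matrix.mulVec_mulVec, Matrix.mul_nonsing_inv B hB,
      Matrix.one_mulVec]
  rw [h1, h2]
  ext (i | i) <;> rfl

/-- Existence and uniqueness of the distinguished curve through `n + 3` points in position
`(c, A, B)`. -/
theorem exists_unique_distinguished [Infinite K] {c : Fin (n + 1) → K} (hc : Function.Injective c)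
    (hc0 : ∀ i, c i ≠ 0)
    {A : Matrix (Fin (n + 1)) (Fin (n + 1)) K} (hA : IsUnit A.det)
    {B : Matrix (Fin (n + 1 + 1)) (Fin (n + 1 + 1)) K} (hB : IsUnit B.det)
    {p : Fin (n + 3) → BiProj K n (n + 1)}
    (hp : ∀ i, IsRep (Sum.elim (A.mulVec (frameFst c i)) (B.mulVec (frameSnd K n i))) (p i)) :
    ∃ C : Set (BiProj K n (n + 1)), IsCurveThrough p n (n + 1) C ∧ IsSmoothCurve C ∧
      IsRationalCurve C ∧
      ∀ C' : Set (BiProj K n (n + 1)), IsCurveThrough p n (n + 1) C' → C' = C := by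
  have hN := isNormalParam_curve hc hc0 hA hB
  refine ⟨paramCurve n (n + 1) (curveFst c A) (curveSnd c B),
    ⟨hN.isParam.isIrreducibleCurve (by omega), hN.isParam.hasBidegree,
      fun i => mem_curve_of_frame hc hc0 i (hp i)⟩, hN.isSmoothCurve (Nat.succ_pos n),
    hN.isParam.isRationalCurve (by omega), fun C' hC' => ?_⟩
  obtain ⟨hinj, hsub⟩ := subset_distinguished hc hc0 hA hB hp hC'
  by_contra hne
  have hfin := hN.isParam.finite_of_ssubset hC'.1.1 hsub hne
  have hss := subsingleton_of_finite_of_isPreirreducible hfin hC'.1.2.1.2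
  have := hinj (hss (hC'.2.2 0) (hC'.2.2 1))
  simp at this

end Uniqueness

/-! ### Bringing general points into normal position -/

section GeneralFrames

variable {S T : Type*} [CommRing S] [CommRing T]

/-- The numerators of the coordinates of `v` with respect to the columns of `M`, as given by
Cramer's rule. -/
def cramerVec {r : ℕ} (M : Matrix (Fin r) (Fin r) S) (v : Fin r → S) : Fin r → S :=
  M.adjugate.mulVec v

lemma mulVec_cramerVec {r : ℕ} (M : Matrix (Fin r) (Fin r) S) (v : Fin r → S) :
    M.mulVec (cramerVec M v) = M.det • v := by
  rw [cramerVec, Matrix.mulVec_mulVec, Matrix.mul_adjugate, Matrix.smul_mulVec, Matrix.one_mulVec]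

lemma map_cramerVec {r : ℕ} (f : S →+* T) (M : Matrix (Fin r) (Fin r) S) (v : Fin r → S)
    (i : Fin r) : f (cramerVec M v i) = cramerVec (M.map f) (fun j => f (v j)) i := by
  rw [cramerVec, cramerVec, RingHom.map_mulVec]
  have := RingHom.map_adjugate f M
  rw [RingHom.mapMatrix_apply, RingHom.mapMatrix_apply] at this
  rw [this]
  rfl

lemma map_matrix_det {r : ℕ} (f : S →+* T) (M : Matrix (Fin r) (Fin r) S) :
    f M.det = (M.map f).det := RingHom.map_det f M

variable {n : ℕ}

/-- The matrix whose columns are the first `n + 1` of the `n + 3` vectors in the first factor. -/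
def frameMatFst (x : Fin (n + 3) × Coord n (n + 1) → S) : Matrix (Fin (n + 1)) (Fin (n + 1)) S :=
  fun j i => x (Fin.castLE (by omega) i, Sum.inl j)

/-- The matrix whose columns are the first `n + 2` of the `n + 3` vectors in the second factor. -/
def frameMatSnd (x : Fin (n + 3) × Coord n (n + 1) → S) :
    Matrix (Fin (n + 1 + 1)) (Fin (n + 1 + 1)) S :=
  fun j i => x (Fin.castLE (by omega) i, Sum.inr j)

/-- The coordinates of the vector with index `n + 1` in the first factor, up to a common factor. -/
def frameCoordFst (x : Fin (n + 3) × Coord n (n + 1) → S) : Fin (n + 1) → S :=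
  cramerVec (frameMatFst x) fun j => x (⟨n + 1, by omega⟩, Sum.inl j)

/-- The coordinates of the last vector in the first factor, up to a common factor. -/
def frameUnitFst (x : Fin (n + 3) × Coord n (n + 1) → S) : Fin (n + 1) → S :=
  cramerVec (frameMatFst x) fun j => x (Fin.last (n + 2), Sum.inl j)

/-- The coordinates of the last vector in the second factor, up to a common factor. -/
def frameUnitSnd (x : Fin (n + 3) × Coord n (n + 1) → S) : Fin (n + 1 + 1) → S :=
  cramerVec (frameMatSnd x) fun j => x (Fin.last (n + 2), Sum.inr j)

/-- A polynomial in the coordinates of `n + 3` points, whose non-vanishing ensures that the points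
can be brought into normal position. It is defined over any ring, so that it can be evaluated at
the indeterminates. -/
def frameDisc (x : Fin (n + 3) × Coord n (n + 1) → S) : S :=
  ((frameMatFst x).det * ∏ i, (frameUnitFst x i * frameCoordFst x i)) *
    ((frameMatSnd x).det * ∏ i, frameUnitSnd x i) *
    ∏ i, ∏ j ∈ Finset.univ.erase i,
      (frameCoordFst x i * frameUnitFst x j - frameCoordFst x j * frameUnitFst x i)

lemma map_frameDisc (f : S →+* T) (x : Fin (n + 3) × Coord n (n + 1) → S) :
    f (frameDisc x) = frameDisc fun a => f (x a) := by
  simp only [frameDisc, frameUnitFst, frameCoordFst, frameUnitSnd, map_mul, map_prod, map_sub,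
    map_matrix_det, map_cramerVec]
  rfl

variable {K : Type*} [Field K]

/-- Points in normal position show that `frameDisc` is not identically zero. -/
lemma frameDisc_frame {c : Fin (n + 1) → K} (hc : Function.Injective c) (hc0 : ∀ i, c i ≠ 0) :
    frameDisc (fun a : Fin (n + 3) × Coord n (n + 1) =>
      Sum.elim (frameFst c a.1) (frameSnd K n a.1) a.2) ≠ 0 := by
  have h1 : frameMatFst (fun a : Fin (n + 3) × Coord n (n + 1) =>
      Sum.elim (frameFst c a.1) (frameSnd K n a.1) a.2) = 1 := by
    ext i j
    simp [frameMatFst, frameFst, Matrix.one_apply, Fin.ext_iff, Nat.le_of_lt_succ j.2,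
      eq_comm (a := (i : ℕ))]
  have h2 : frameMatSnd (fun a : Fin (n + 3) × Coord n (n + 1) =>
      Sum.elim (frameFst c a.1) (frameSnd K n a.1) a.2) = 1 := by
    ext i j
    simp [frameMatSnd, frameSnd, Matrix.one_apply, Fin.ext_iff, Nat.le_of_lt_succ j.2,
      eq_comm (a := (i : ℕ))]
  simp only [frameDisc, frameUnitFst, frameCoordFst, frameUnitSnd, h1, h2, cramerVec,
    Matrix.adjugate_one, Matrix.one_mulVec, Matrix.det_one]
  simp only [mul_ne_zero_iff, Finset.prod_ne_zero_iff]
  simp +contextual [frameFst, frameSnd, sub_eq_zero, hc0, hc.eq_iff, eq_comm]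

/-- The matrix `M`, with its columns rescaled by `g`, takes the coordinate vectors to multiples of
the columns of `M`. -/
lemma mulVec_diagonal_single {r : ℕ} (M : Matrix (Fin r) (Fin r) K) (g : Fin r → K) {i : ℕ}
    (hi : i < r) : (M * Matrix.diagonal g).mulVec (fun j => if i = j then 1 else 0) =
      fun j => g ⟨i, hi⟩ * M j ⟨i, hi⟩ := by
  have : (fun j : Fin r => if i = (j : ℕ) then (1 : K) else 0) = Pi.single ⟨i, hi⟩ 1 := by
    ext j
    simp [Pi.single_apply, Fin.ext_iff, eq_comm]
  rw [this]
  ext j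
  simp [mul_comm]

/-- The matrix `M`, with its columns rescaled by `g`, takes the vector with coordinates `h / g` to a
multiple of `v`, if `h` gives the coordinates of `v` with respect to the columns of `M`. -/
lemma mulVec_diagonal_div {r : ℕ} (M : Matrix (Fin r) (Fin r) K) {g h v : Fin r → K}
    (hg : ∀ i, g i ≠ 0) (hh : h = cramerVec M v) :
    (M * Matrix.diagonal g).mulVec (fun j => h j / g j) = fun j => M.det * v j := by
  have : (Matrix.diagonal g).mulVec (fun j => h j / g j) = h := by
    ext j
    rw [Matrix.mulVec_diagonal, mul_div_cancel₀ _ (hg j)]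
  rw [← Matrix.mulVec_mulVec, this, hh, mulVec_cramerVec]
  rfl

/-- General points of `ℙⁿ × ℙⁿ⁺¹` can be brought into normal position. -/
lemma exists_frame {p : Fin (n + 3) → BiProj K n (n + 1)} {x : Fin (n + 3) × Coord n (n + 1) → K}
    (hx : ∀ i, IsRep (fun a => x (i, a)) (p i)) (h0 : frameDisc x ≠ 0) :
    ∃ (c : Fin (n + 1) → K) (A : Matrix (Fin (n + 1)) (Fin (n + 1)) K)
      (B : Matrix (Fin (n + 1 + 1)) (Fin (n + 1 + 1)) K),
      Function.Injective c ∧ (∀ i, c i ≠ 0) ∧ IsUnit A.det ∧ IsUnit B.det ∧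
      ∀ i, IsRep (Sum.elim (A.mulVec (frameFst c i)) (B.mulVec (frameSnd K n i))) (p i) := by
  simp only [frameDisc, mul_ne_zero_iff, Finset.prod_ne_zero_iff, Finset.mem_univ, true_implies,
    Finset.mem_erase, and_true] at h0
  obtain ⟨⟨⟨hdA, hgh⟩, hdB, hk⟩, hne⟩ := h0
  have hg := fun i => (hgh i).1
  have hh := fun i => (hgh i).2
  refine ⟨fun j => frameCoordFst x j / frameUnitFst x j,
    frameMatFst x * Matrix.diagonal (frameUnitFst x),
    frameMatSnd x * Matrix.diagonal (frameUnitSnd x), fun i j hij => ?_,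
    fun i => div_ne_zero (hh i) (hg i), ?_, ?_, fun i => ?_⟩
  · by_contra hne'
    apply hne i j (Ne.symm hne')
    rw [div_eq_div_iff (hg i) (hg j)] at hij
    rw [hij, sub_self]
  · rw [Matrix.det_mul, Matrix.det_diagonal, isUnit_iff_ne_zero]
    exact mul_ne_zero hdA (Finset.prod_ne_zero_iff.mpr fun i _ => hg i)
  · rw [Matrix.det_mul, Matrix.det_diagonal, isUnit_iff_ne_zero]
    exact mul_ne_zero hdB (Finset.prod_ne_zero_iff.mpr fun i _ => hk i)
  · have key : ∃ l r : K, l ≠ 0 ∧ r ≠ 0 ∧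
        (frameMatFst x * Matrix.diagonal (frameUnitFst x)).mulVec
          (frameFst (fun j => frameCoordFst x j / frameUnitFst x j) i) =
          (fun j => l * x (i, Sum.inl j)) ∧
        (frameMatSnd x * Matrix.diagonal (frameUnitSnd x)).mulVec (frameSnd K n i) =
          fun j => r * x (i, Sum.inr j) := by
      have hone : (fun j => frameUnitFst x j / frameUnitFst x j) = fun _ => 1 :=
        funext fun j => div_self (hg j)
      have hone' : (fun j => frameUnitSnd x j / frameUnitSnd x j) = fun _ => 1 :=
        funext fun j => div_self (hk j)
      rcases lt_trichotomy (i : ℕ) (n + 1) with hi | hi | hi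
      · refine ⟨_, _, hg ⟨i, hi⟩, hk ⟨i, by omega⟩, ?_, ?_⟩
        · rw [show frameFst _ i = fun j : Fin (n + 1) => if (i : ℕ) = j then (1 : K) else 0 from
            funext fun j => if_pos (Nat.le_of_lt_succ hi), mulVec_diagonal_single _ _ hi]
          rfl
        · rw [show frameSnd K n i = fun j : Fin (n + 1 + 1) => if (i : ℕ) = j then (1 : K) else 0
            from funext fun j => if_pos hi.le, mulVec_diagonal_single _ _ (by omega)]
          rfl
      · refine ⟨_, _, hdA, hk ⟨i, by omega⟩, ?_, ?_⟩
        · rw [show frameFst _ i = fun j => frameCoordFst x j / frameUnitFst x j from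
            funext fun j => by rw [frameFst, if_neg (by omega), if_pos hi],
            mulVec_diagonal_div (h := frameCoordFst x) _ hg rfl]
          simp only [← hi]
        · rw [show frameSnd K n i = fun j : Fin (n + 1 + 1) => if (i : ℕ) = j then (1 : K) else 0
            from funext fun j => if_pos hi.le, mulVec_diagonal_single _ _ (by omega)]
          rfl
      · have hl : i = Fin.last (n + 2) := Fin.ext (by have := i.2; simp; omega)
        refine ⟨_, _, hdA, hdB, ?_, ?_⟩
        · rw [show frameFst _ i = fun _ : Fin (n + 1) => (1 : K) from
            funext fun j => by rw [frameFst, if_neg (by omega), if_neg (by omega)], ← hone,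
            mulVec_diagonal_div (h := frameUnitFst x) _ hg rfl, hl]
        · rw [show frameSnd K n i = fun _ => 1 from
            funext fun j => by rw [frameSnd, if_neg (by omega)], ← hone',
            mulVec_diagonal_div (h := frameUnitSnd x) _ hk rfl, hl]
    obtain ⟨l, r, hl, hr, h1, h2⟩ := key
    rw [h1, h2]
    convert (hx i).scale hl hr using 1
    ext (j | j) <;> rfl

/-- The distinguished rational curve through general points. -/
theorem forGeneralPoints_exists_unique_distinguished [CharZero K] (n : ℕ) :
    ForGeneralPoints fun p : Fin (n + 3) → BiProj K n (n + 1) =>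
      ∃ C : Set (BiProj K n (n + 1)), IsCurveThrough p n (n + 1) C ∧ IsSmoothCurve C ∧
        IsRationalCurve C ∧
        ∀ C' : Set (BiProj K n (n + 1)), IsCurveThrough p n (n + 1) C' → C' = C := by
  have heval : ∀ x : Fin (n + 3) × Coord n (n + 1) → K,
      eval x (frameDisc (X : _ → MvPolynomial (Fin (n + 3) × Coord n (n + 1)) K)) =
        frameDisc x := fun x => by simp only [map_frameDisc, eval_X]
  refine forGeneralPoints_of_polynomial (frameDisc X) (fun h0 => ?_) fun p x hx hne => ?_
  · have hc : Function.Injective fun i : Fin (n + 1) => (((i : ℕ) + 1 : ℕ) : K) := fun i j hij =>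
      Fin.ext (Nat.succ_injective (Nat.cast_injective hij))
    refine frameDisc_frame hc (fun i => Nat.cast_ne_zero.mpr (Nat.succ_ne_zero _)) ?_
    rw [← heval, h0, map_zero]
  · rw [heval] at hne
    obtain ⟨c, A, B, hc, hc0, hA, hB, hp⟩ := exists_frame hx hne
    exact exists_unique_distinguished hc hc0 hA hB hp

end GeneralFrames

/-! ### Interpolation by curves of bidegree `(1, d)` -/

section Coprime

variable {K : Type*} [Field K]

/-- If two binary forms of degree `d` have no common factor, then the forms of degree `D + d` with
`D + 1 ≥ d` lie in the ideal that they generate. -/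
lemma exists_mul_add_mul {d : ℕ} (hd : 1 ≤ d) {g h : K[X]} (hg : g.natDegree ≤ d)
    (hh : h.natDegree ≤ d) (hR : Polynomial.resultant g h d d ≠ 0) (e : ℕ) {f : K[X]}
    (hf : f.natDegree ≤ d - 1 + e + d) :
    ∃ p q : K[X], p.natDegree ≤ d - 1 + e ∧ q.natDegree ≤ d - 1 + e ∧ f = p * g + q * h := by
  induction e generalizing f with
  | zero =>
    have hf' : f ∈ Polynomial.degreeLT K (d + d) := by
      rw [show d + d = (d - 1 + 0 + d) + 1 by omega]
      exact mem_degreeLT_succ_iff.mpr hf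
    have h1 := LinearMap.congr_fun (Polynomial.sylveserMap_comp_adjSylvester g h hg hh) ⟨f, hf'⟩
    obtain ⟨pq, hpq⟩ : ∃ pq, pq = Polynomial.adjSylvester (m := d) (n := d) g h ⟨f, hf'⟩ :=
      ⟨_, rfl⟩
    have hdeg : ∀ p : Polynomial.degreeLT K d, (p : K[X]).natDegree ≤ d - 1 + 0 := fun p =>
      mem_degreeLT_succ_iff.mp (by rw [show d - 1 + 0 + 1 = d by omega]; exact p.2)
    refine ⟨Polynomial.C (Polynomial.resultant g h d d)⁻¹ * (pq.2 : K[X]),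
      Polynomial.C (Polynomial.resultant g h d d)⁻¹ * (pq.1 : K[X]),
      (Polynomial.natDegree_C_mul_le _ _).trans (hdeg _),
      (Polynomial.natDegree_C_mul_le _ _).trans (hdeg _), ?_⟩
    rw [LinearMap.comp_apply, ← hpq] at h1
    have h2 : g * (pq.2 : K[X]) + h * (pq.1 : K[X]) =
        Polynomial.C (Polynomial.resultant g h d d) * f := by
      rw [← Polynomial.smul_eq_C_mul]
      exact congrArg Subtype.val h1
    have h3 : Polynomial.C (Polynomial.resultant g h d d)⁻¹ *
        Polynomial.C (Polynomial.resultant g h d d) = 1 := by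
      rw [← Polynomial.C_mul, inv_mul_cancel₀ hR, Polynomial.C_1]
    linear_combination (-Polynomial.C (Polynomial.resultant g h d d)⁻¹) * h2 - f * h3
  | succ e ih =>
    obtain ⟨p, q, hp, hq, hpq⟩ := ih (f := f.divX)
      (by rw [Polynomial.natDegree_divX_eq_natDegree_tsub_one]; omega)
    -- the constant term and the rest of `f` are treated separately
    obtain ⟨p', q', hp', hq', hpq'⟩ := ih (f := Polynomial.C (f.coeff 0)) (by simp)
    have hX : ∀ r r' : K[X], r.natDegree ≤ d - 1 + e → r'.natDegree ≤ d - 1 + e →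
        (r * Polynomial.X + r').natDegree ≤ d - 1 + (e + 1) := fun r r' hr hr' =>
      Polynomial.natDegree_add_le_of_degree_le
        ((Polynomial.natDegree_mul_le_of_le hr Polynomial.natDegree_X_le).trans_eq (by omega))
        (hr'.trans (by omega))
    refine ⟨p * Polynomial.X + p', q * Polynomial.X + q', hX _ _ hp hp', hX _ _ hq hq', ?_⟩
    have h1 := Polynomial.divX_mul_X_add f
    rw [hpq, hpq'] at h1
    linear_combination -h1

/-- A parametrisation by the identity of the line and by forms of degree `d`, two of which have no
common factor, is an embedding: the pullback is surjective in bidegree `(u, v)` for `u ≥ d`. -/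
lemma isParam_of_resultant_ne_zero {d s : ℕ} (hd : 1 ≤ d) {ψ : Fin (s + 1) → K[X]}
    (hψ : ∀ j, (ψ j).natDegree ≤ d) {j k : Fin (s + 1)}
    (hR : Polynomial.resultant (ψ j) (ψ k) d d ≠ 0) :
    IsParam (n := 1) 1 d ![1, Polynomial.X] ψ where
  natDegree_fst i := by fin_cases i <;> simp
  natDegree_snd := hψ
  full := by
    have hX : ∀ j : Fin (s + 1), IsWeightedHomogeneous (biWeight 1 s)
        (X (Sum.inr j) : MvPolynomial (Coord 1 s) K) (0, 1) := fun j =>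
      isWeightedHomogeneous_X K _ _
    refine ⟨d, fun u v hu hv => ?_⟩
    clear hv
    induction v with
    | zero =>
      intro f hf
      rw [mul_zero, add_zero, one_mul] at hf
      refine ⟨∑ e ∈ Finset.range (u + 1), MvPolynomial.C (f.coeff e) *
        (X (Sum.inl 0) ^ (u - e) * X (Sum.inl 1) ^ e), ?_, ?_⟩
      · refine IsWeightedHomogeneous.sum _ _ _ fun e he => ?_
        have h1 := ((isWeightedHomogeneous_X K (biWeight 1 s) (Sum.inl 0)).pow (u - e)).mul
          ((isWeightedHomogeneous_X K (biWeight 1 s) (Sum.inl 1)).pow e)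
        have h2 := (isWeightedHomogeneous_C (biWeight 1 s) (f.coeff e)).mul h1
        convert h2 using 1
        have := Finset.mem_range.mp he
        simp only [biWeight, Sum.elim_inl, Prod.smul_mk, smul_eq_mul, mul_one, mul_zero,
          Prod.mk_add_mk, zero_add, Prod.mk.injEq, and_true]
        omega
      · rw [map_sum]
        conv_rhs => rw [Polynomial.as_sum_range_C_mul_X_pow' f (Nat.lt_succ_of_le hf)]
        refine Finset.sum_congr rfl fun e _ => ?_
        simp [paramHom]
    | succ v ih =>
      intro f hf
      obtain ⟨p, q, hp, hq, hpq⟩ := exists_mul_add_mul hd (hψ j) (hψ k) hR (u + d * v + 1 - d)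
        (f := f) (hf.trans_eq (by rw [Nat.mul_succ]; omega))
      obtain ⟨P, hP, rfl⟩ := ih p (hp.trans_eq (by omega))
      obtain ⟨Q, hQ, rfl⟩ := ih q (hq.trans_eq (by omega))
      refine ⟨P * X (Sum.inr j) + Q * X (Sum.inr k), (hP.mul (hX j)).add (hQ.mul (hX k)), ?_⟩
      rw [hpq, map_add, map_mul, map_mul]
      simp [paramHom]

end Coprime

section Interpolation

variable {S T : Type*} [CommRing S] [CommRing T] {s d : ℕ}

/-- The matrix whose columns are the first `s + 1` of the `d + 2` vectors in the second factor. -/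
def interpMat (hsd : s ≤ d) (x : Fin (d + 2) × Coord 1 s → S) :
    Matrix (Fin (s + 1)) (Fin (s + 1)) S :=
  fun j i => x (Fin.castLE (by omega) i, Sum.inr j)

/-- The coefficients of a linear relation between the `d + 2` vectors in the second factor, the
last of which has the coefficient `-det`. The coefficients with index `> s` are chosen to be `det`,
and the others are then given by Cramer's rule. -/
def interpWeight (hsd : s ≤ d) (x : Fin (d + 2) × Coord 1 s → S) (i : Fin (d + 1)) : S :=
  if h : (i : ℕ) < s + 1 then
    cramerVec (interpMat hsd x) (fun j => x (Fin.last (d + 1), Sum.inr j) -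
      ∑ l ∈ Finset.univ.filter fun l : Fin (d + 1) => ¬ (l : ℕ) < s + 1,
          x (l.castSucc, Sum.inr j)) ⟨i, h⟩
  else (interpMat hsd x).det

lemma sum_filter_lt {M : Type*} [AddCommMonoid M] (hsd : s ≤ d) (f : Fin (d + 1) → M) :
    ∑ i ∈ Finset.univ.filter fun i : Fin (d + 1) => (i : ℕ) < s + 1, f i =
      ∑ i : Fin (s + 1), f (Fin.castLE (by omega) i) := by
  symm
  refine Finset.sum_bij (fun i _ => Fin.castLE (by omega) i)
    (fun i _ => Finset.mem_filter.mpr ⟨Finset.mem_univ _, i.2⟩)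
    (fun i _ j _ h => Fin.castLE_injective _ h) (fun i hi => ?_) fun i _ => rfl
  exact ⟨⟨i, by simpa using hi⟩, Finset.mem_univ _, rfl⟩

/-- The linear relation expressed by `interpWeight`. -/
lemma sum_interpWeight (hsd : s ≤ d) (x : Fin (d + 2) × Coord 1 s → S) (j : Fin (s + 1)) :
    ∑ i : Fin (d + 1), interpWeight hsd x i * x (i.castSucc, Sum.inr j) =
      (interpMat hsd x).det * x (Fin.last (d + 1), Sum.inr j) := by
  rw [← Finset.sum_filter_add_sum_filter_not _ (fun i : Fin (d + 1) => (i : ℕ) < s + 1),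
    sum_filter_lt hsd]
  have h1 := congrFun (mulVec_cramerVec (interpMat hsd x) fun j => x (Fin.last (d + 1), Sum.inr j) -
      ∑ l ∈ Finset.univ.filter fun l : Fin (d + 1) => ¬ (l : ℕ) < s + 1,
          x (l.castSucc, Sum.inr j)) j
  have h2 : ∑ i : Fin (s + 1), interpWeight hsd x (Fin.castLE (by omega) i) *
      x ((Fin.castLE (by omega : s + 1 ≤ d + 1) i).castSucc, Sum.inr j) =
      (interpMat hsd x).mulVec (cramerVec (interpMat hsd x) fun j =>
        x (Fin.last (d + 1), Sum.inr j) -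
        ∑ l ∈ Finset.univ.filter fun l : Fin (d + 1) => ¬ (l : ℕ) < s + 1,
          x (l.castSucc, Sum.inr j)) j := by
    rw [Matrix.mulVec, dotProduct]
    refine Finset.sum_congr rfl fun i _ => ?_
    have hi : interpWeight hsd x (Fin.castLE (by omega) i) = cramerVec (interpMat hsd x) (fun j =>
        x (Fin.last (d + 1), Sum.inr j) -
        ∑ l ∈ Finset.univ.filter fun l : Fin (d + 1) => ¬ (l : ℕ) < s + 1,
          x (l.castSucc, Sum.inr j)) i := dif_pos i.2
    rw [hi, mul_comm]
    rfl
  have h3 : ∑ i ∈ Finset.univ.filter fun i : Fin (d + 1) => ¬ (i : ℕ) < s + 1,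
      interpWeight hsd x i * x (i.castSucc, Sum.inr j) =
      (interpMat hsd x).det * ∑ i ∈ Finset.univ.filter fun i : Fin (d + 1) => ¬ (i : ℕ) < s + 1,
        x (i.castSucc, Sum.inr j) := by
    rw [Finset.mul_sum]
    refine Finset.sum_congr rfl fun i hi => ?_
    rw [interpWeight, dif_neg (by simpa using hi)]
  rw [h2, h1, h3, Pi.smul_apply, smul_eq_mul]
  ring

/-- The form on the line that vanishes at the first components of the first `d + 1` points, except
the point `i`. -/
noncomputable def lineBasis (x : Fin (d + 2) × Coord 1 s → S) (i : Fin (d + 1)) : S[X] :=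
  ∏ l ∈ Finset.univ.erase i, (Polynomial.C (x (l.castSucc, Sum.inl 0)) * Polynomial.X -
    Polynomial.C (x (l.castSucc, Sum.inl 1)))

/-- The determinant of the first components of two of the points. -/
def lineDet (x : Fin (d + 2) × Coord 1 s → S) (i k : Fin (d + 2)) : S :=
  x (i, Sum.inl 0) * x (k, Sum.inl 1) - x (i, Sum.inl 1) * x (k, Sum.inl 0)

/-- The map from the line to `ℙˢ` interpolating the `d + 2` points. -/
noncomputable def interpSnd (hsd : s ≤ d) (x : Fin (d + 2) × Coord 1 s → S) (j : Fin (s + 1)) :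
    S[X] :=
  ∑ i : Fin (d + 1), Polynomial.C (interpWeight hsd x i * lineDet x i.castSucc (Fin.last _) *
    x (i.castSucc, Sum.inr j)) * lineBasis x i

/-- A polynomial in the coordinates of `d + 2` points of `ℙ¹ × ℙˢ`, whose non-vanishing ensures that
the interpolating map parametrises a curve of bidegree `(1, d)` through the points. -/
noncomputable def interpDisc (hsd : s ≤ d) (x : Fin (d + 2) × Coord 1 s → S) : S :=
  ((∏ i, x (i, Sum.inl 0)) * ∏ i, ∏ k ∈ Finset.univ.erase i, lineDet x i k) *
    ((interpMat hsd x).det * ∏ i, interpWeight hsd x i) *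
    Polynomial.resultant (interpSnd hsd x 0) (interpSnd hsd x (Fin.last s)) d d

lemma map_interpWeight (hsd : s ≤ d) (f : S →+* T) (x : Fin (d + 2) × Coord 1 s → S)
    (i : Fin (d + 1)) : f (interpWeight hsd x i) = interpWeight hsd (fun a => f (x a)) i := by
  unfold interpWeight
  split_ifs
  · rw [map_cramerVec]
    simp only [map_sub, map_sum]
    rfl
  · exact map_matrix_det f _

lemma map_interpSnd (hsd : s ≤ d) (f : S →+* T) (x : Fin (d + 2) × Coord 1 s → S)
    (j : Fin (s + 1)) : (interpSnd hsd x j).map f = interpSnd hsd (fun a => f (x a)) j := by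
  rw [interpSnd, Polynomial.map_sum]
  refine Finset.sum_congr rfl fun i _ => ?_
  rw [Polynomial.map_mul, Polynomial.map_C]
  congr 1
  · simp only [map_mul, map_interpWeight, lineDet, map_sub]
  · simp [lineBasis, Polynomial.map_prod]

lemma map_interpDisc (hsd : s ≤ d) (f : S →+* T) (x : Fin (d + 2) × Coord 1 s → S) :
    f (interpDisc hsd x) = interpDisc hsd fun a => f (x a) := by
  have h : f (Polynomial.resultant (interpSnd hsd x 0) (interpSnd hsd x (Fin.last s)) d d) =
      Polynomial.resultant (interpSnd hsd (fun a => f (x a)) 0)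
        (interpSnd hsd (fun a => f (x a)) (Fin.last s)) d d := by
    rw [← Polynomial.resultant_map_map, map_interpSnd, map_interpSnd]
  simp only [interpDisc, map_mul, map_prod, lineDet, map_sub, map_matrix_det, map_interpWeight, h]
  rfl

lemma natDegree_lineBasis_le (x : Fin (d + 2) × Coord 1 s → S) (i : Fin (d + 1)) :
    (lineBasis x i).natDegree ≤ d := by
  refine (Polynomial.natDegree_prod_le _ _).trans ?_
  refine (Finset.sum_le_card_nsmul _ _ 1 fun l _ => ?_).trans (by simp)
  exact (Polynomial.natDegree_sub_C).le.trans
    ((Polynomial.natDegree_C_mul_le _ _).trans Polynomial.natDegree_X_le)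

lemma natDegree_interpSnd_le (hsd : s ≤ d) (x : Fin (d + 2) × Coord 1 s → S) (j : Fin (s + 1)) :
    (interpSnd hsd x j).natDegree ≤ d :=
  Polynomial.natDegree_sum_le_of_forall_le _ _ fun i _ =>
    (Polynomial.natDegree_C_mul_le _ _).trans (natDegree_lineBasis_le x i)

end Interpolation

section Existence

variable {K : Type*} [Field K] {s d : ℕ}

lemma eval_lineBasis (x : Fin (d + 2) × Coord 1 s → K) (i : Fin (d + 1)) (t : K) :
    (lineBasis x i).eval t =
      ∏ l ∈ Finset.univ.erase i, (x (l.castSucc, Sum.inl 0) * t - x (l.castSucc, Sum.inl 1)) := by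
  simp [lineBasis, Polynomial.eval_prod]

/-- The graph of the interpolating map is a curve of bidegree `(1, d)` through the given points. -/
lemma exists_curveThrough_of_interpDisc_ne_zero [Infinite K] (hs : 1 ≤ s) (hsd : s ≤ d)
    {p : Fin (d + 2) → BiProj K 1 s} {x : Fin (d + 2) × Coord 1 s → K}
    (hx : ∀ i, IsRep (fun a => x (i, a)) (p i)) (h0 : interpDisc hsd x ≠ 0) :
    ∃ C, IsCurveThrough p 1 d C := by
  simp only [interpDisc, mul_ne_zero_iff, Finset.prod_ne_zero_iff, Finset.mem_univ, true_implies,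
    Finset.mem_erase, and_true] at h0
  obtain ⟨⟨⟨ha, hdet⟩, hM, hw⟩, hR⟩ := h0
  have hpar := isParam_of_resultant_ne_zero (hs.trans hsd) (natDegree_interpSnd_le hsd x) hR
  refine ⟨_, hpar.isIrreducibleCurve (by omega), hpar.hasBidegree, fun i => ?_⟩
  -- the parameter of the point with first component `a` is the affine coordinate `a₁ / a₀`
  have hfac : ∀ i k, x (k, Sum.inl 0) * (x (i, Sum.inl 1) / x (i, Sum.inl 0)) - x (k, Sum.inl 1) =
      lineDet x k i / x (i, Sum.inl 0) := by
    intro i k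
    have := ha i
    rw [lineDet]
    field_simp
  suffices h : ∃ r : K, r ≠ 0 ∧ ∀ j, (interpSnd hsd x j).eval
      (x (i, Sum.inl 1) / x (i, Sum.inl 0)) = r * x (i, Sum.inr j) by
    obtain ⟨r, hr, h⟩ := h
    refine ⟨some (x (i, Sum.inl 1) / x (i, Sum.inl 0)), ?_⟩
    convert (hx i).scale (inv_ne_zero (ha i)) hr using 1
    ext (j | j)
    · have := ha i
      fin_cases j
      · simp [paramVec, this]
      · simp [paramVec, div_eq_inv_mul]
    · simp [paramVec, h]
  have hev : ∀ j t, (interpSnd hsd x j).eval t = ∑ i : Fin (d + 1), interpWeight hsd x i *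
      lineDet x i.castSucc (Fin.last _) * x (i.castSucc, Sum.inr j) * (lineBasis x i).eval t :=
    fun j t => by simp [interpSnd, Polynomial.eval_finsetSum]
  induction i using Fin.lastCases with
  | cast i =>
    refine ⟨interpWeight hsd x i * lineDet x i.castSucc (Fin.last _) * (lineBasis x i).eval
      (x (i.castSucc, Sum.inl 1) / x (i.castSucc, Sum.inl 0)), mul_ne_zero (mul_ne_zero (hw i)
      (hdet _ _ (Fin.castSucc_lt_last i).ne')) ?_, fun j => ?_⟩
    · rw [eval_lineBasis, Finset.prod_ne_zero_iff]
      intro l hl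
      rw [hfac]
      refine div_ne_zero (hdet _ _ fun h => ?_) (ha _)
      exact Finset.ne_of_mem_erase hl (Fin.castSucc_injective _ h.symm)
    · rw [hev, Finset.sum_eq_single i]
      · ring
      · intro l _ hl
        rw [eval_lineBasis, Finset.prod_eq_zero (i := i)
          (Finset.mem_erase.mpr ⟨hl.symm, Finset.mem_univ _⟩) (by rw [hfac, lineDet]; ring),
          mul_zero]
      · simp
  | last =>
    obtain ⟨t, ht⟩ : ∃ t, t = x (Fin.last (d + 1), Sum.inl 1) / x (Fin.last (d + 1), Sum.inl 0) :=
      ⟨_, rfl⟩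
    rw [← ht]
    obtain ⟨P, hP⟩ : ∃ P, P = ∏ l : Fin (d + 1),
      (x (l.castSucc, Sum.inl 0) * t - x (l.castSucc, Sum.inl 1)) := ⟨_, rfl⟩
    refine ⟨x (Fin.last (d + 1), Sum.inl 0) * P * (interpMat hsd x).det,
      mul_ne_zero (mul_ne_zero (ha _) ?_) hM, fun j => ?_⟩
    · rw [hP, Finset.prod_ne_zero_iff]
      intro l _
      rw [ht, hfac]
      exact div_ne_zero (hdet _ _ (Fin.castSucc_lt_last l).ne') (ha _)
    · rw [mul_assoc _ _ (x _), ← sum_interpWeight, hev, Finset.mul_sum]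
      refine Finset.sum_congr rfl fun i _ => ?_
      have h1 : lineDet x i.castSucc (Fin.last _) = x (Fin.last (d + 1), Sum.inl 0) *
          (x (i.castSucc, Sum.inl 0) * t - x (i.castSucc, Sum.inl 1)) := by
        rw [ht, hfac, mul_div_cancel₀ _ (ha _)]
      have h2 : (x (i.castSucc, Sum.inl 0) * t - x (i.castSucc, Sum.inl 1)) *
          (lineBasis x i).eval t = P := by
        rw [hP, eval_lineBasis]
        exact Finset.mul_prod_erase Finset.univ (fun l : Fin (d + 1) =>
          x (l.castSucc, Sum.inl 0) * t - x (l.castSucc, Sum.inl 1)) (Finset.mem_univ i)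
      rw [h1, ← h2]
      ring

end Existence

/-! ### Points at which the interpolation polynomial does not vanish -/

section SamplePoints

variable {K : Type*} [Field K] {s d : ℕ}

/-- Points of `ℙ¹ × ℙˢ` with the affine coordinates `0, …, d + 1` in the first factor and the
vectors `b i` in the second factor; the last vector is the sum of the others. -/
def samplePoints (b : Fin (d + 1) → Fin (s + 1) → K) (a : Fin (d + 2) × Coord 1 s) : K :=
  Sum.elim ![1, ((a.1 : ℕ) : K)]
    (Fin.snoc (α := fun _ => Fin (s + 1) → K) b (fun j => ∑ i, b i j) a.1) a.2

lemma interpMat_samplePoints (hsd : s ≤ d) (b : Fin (d + 1) → Fin (s + 1) → K)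
    (j i : Fin (s + 1)) : interpMat hsd (samplePoints b) j i = b (Fin.castLE (by omega) i) j :=
  congrFun (Fin.snoc_castSucc (α := fun _ => Fin (s + 1) → K) (fun j => ∑ i, b i j) b
    (Fin.castLE (by omega) i)) j

lemma interpWeight_samplePoints (hsd : s ≤ d) (b : Fin (d + 1) → Fin (s + 1) → K)
    (i : Fin (d + 1)) : interpWeight hsd (samplePoints b) i =
      (interpMat hsd (samplePoints b)).det := by
  unfold interpWeight
  split_ifs with h
  · have h1 : (fun j => samplePoints b (Fin.last (d + 1), Sum.inr j) -
        ∑ l ∈ Finset.univ.filter fun l : Fin (d + 1) => ¬ (l : ℕ) < s + 1,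
          samplePoints b (l.castSucc, Sum.inr j)) =
        (interpMat hsd (samplePoints b)).mulVec fun _ => 1 := by
      ext j
      simp only [samplePoints, Sum.elim_inr, Fin.snoc_last, Fin.snoc_castSucc]
      rw [← Finset.sum_filter_add_sum_filter_not Finset.univ
        (fun i : Fin (d + 1) => (i : ℕ) < s + 1), add_sub_cancel_right, sum_filter_lt hsd,
        Matrix.mulVec, dotProduct]
      refine Finset.sum_congr rfl fun k _ => ?_
      rw [mul_one, interpMat_samplePoints]
    rw [h1, cramerVec, Matrix.mulVec_mulVec, Matrix.adjugate_mul, Matrix.smul_mulVec,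
      Matrix.one_mulVec]
    simp
  · rfl

/-- A Newton basis at the nodes `0, 1, …`, with the last element raised to degree `d`. -/
noncomputable def newtonBasis (K : Type*) [Field K] (s d : ℕ) (j : Fin (s + 1)) : K[X] :=
  (∏ l ∈ Finset.range j, (Polynomial.X - Polynomial.C (l : K))) *
    if (j : ℕ) = s then Polynomial.X ^ (d - s) else 1

lemma natDegree_prod_range (j : ℕ) :
    (∏ l ∈ Finset.range j, (Polynomial.X - Polynomial.C (l : K))).natDegree = j := by
  rw [Polynomial.natDegree_prod_of_monic _ _ fun l _ => Polynomial.monic_X_sub_C _]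
  simp [-map_natCast]

lemma natDegree_newtonBasis_le (hsd : s ≤ d) (j : Fin (s + 1)) :
    (newtonBasis K s d j).natDegree ≤ d := by
  rw [newtonBasis]
  refine Polynomial.natDegree_mul_le.trans ?_
  rw [natDegree_prod_range]
  split_ifs with h
  · rw [Polynomial.natDegree_X_pow]; omega
  · rw [Polynomial.natDegree_one]; omega

lemma coeff_newtonBasis_last (hsd : s ≤ d) : (newtonBasis K s d (Fin.last s)).coeff d = 1 := by
  have hm : (∏ l ∈ Finset.range s, (Polynomial.X - Polynomial.C (l : K))).Monic :=
    Polynomial.monic_prod_of_monic _ _ fun l _ => Polynomial.monic_X_sub_C _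
  rw [newtonBasis, Fin.val_last, if_pos rfl]
  have h := (hm.mul (Polynomial.monic_X_pow (d - s))).coeff_natDegree
  rwa [hm.natDegree_mul (Polynomial.monic_X_pow _), natDegree_prod_range,
    Polynomial.natDegree_X_pow, Nat.add_sub_cancel' hsd] at h

lemma newtonBasis_zero (hs : 1 ≤ s) : newtonBasis K s d 0 = 1 := by
  simp [newtonBasis, (Nat.pos_iff_ne_zero.mp hs).symm]

lemma eval_newtonBasis_of_lt {i : ℕ} {j : Fin (s + 1)} (h : i < j) :
    (newtonBasis K s d j).eval (i : K) = 0 := by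
  rw [newtonBasis, Polynomial.eval_mul, Polynomial.eval_prod,
    Finset.prod_eq_zero (Finset.mem_range.mpr h) (by simp), zero_mul]

lemma eval_newtonBasis_self [CharZero K] (hs : 1 ≤ s) (j : Fin (s + 1)) :
    (newtonBasis K s d j).eval ((j : ℕ) : K) ≠ 0 := by
  rw [newtonBasis, Polynomial.eval_mul, Polynomial.eval_prod]
  refine mul_ne_zero (Finset.prod_ne_zero_iff.mpr fun l hl => ?_) ?_
  · rw [Polynomial.eval_sub, Polynomial.eval_X, Polynomial.eval_C, sub_ne_zero]
    exact Nat.cast_injective.ne (Finset.mem_range.mp hl).ne'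
  · split_ifs with h
    · rw [Polynomial.eval_pow, Polynomial.eval_X, h]
      exact pow_ne_zero _ (Nat.cast_ne_zero.mpr (by omega))
    · simp

/-- The nodes `0, …, d`. -/
def natNodes (K : Type*) [Field K] (d : ℕ) (i : Fin (d + 1)) : K := ((i : ℕ) : K)

lemma natNodes_injective [CharZero K] : Function.Injective (natNodes K d) := fun _ _ h =>
  Fin.ext (Nat.cast_injective h)

lemma lineBasis_samplePoints (b : Fin (d + 1) → Fin (s + 1) → K) (i : Fin (d + 1)) :
    lineBasis (samplePoints b) i = nodeBasis (natNodes K d) i := by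
  simp [lineBasis, nodeBasis, samplePoints, natNodes]

/-- The interpolation discriminant does not vanish at suitable sample points: the vectors are
chosen so that the interpolating map is given by the Newton basis. -/
lemma exists_interpDisc_ne_zero [CharZero K] (hs : 1 ≤ s) (hsd : s ≤ d) :
    ∃ x : Fin (d + 2) × Coord 1 s → K, interpDisc hsd x ≠ 0 := by
  have hdet : ∀ (b : Fin (d + 1) → Fin (s + 1) → K) i k, lineDet (samplePoints b) i k =
      ((k : ℕ) : K) - ((i : ℕ) : K) := fun b i k => by simp [lineDet, samplePoints]
  -- the inverses of the factors that the interpolating map introduces at the nodes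
  let c : Fin (d + 1) → K := fun i => ((((d + 1 : ℕ) : K) - ((i : ℕ) : K)) *
    (nodeBasis (natNodes K d) i).eval (natNodes K d i))⁻¹
  have hc0 : ∀ i : Fin (d + 1), ((d + 1 : ℕ) : K) - ((i : ℕ) : K) ≠ 0 := fun i =>
    sub_ne_zero.mpr (Nat.cast_injective.ne i.2.ne')
  have hc1 : ∀ i : Fin (d + 1), (nodeBasis (natNodes K d) i).eval (natNodes K d i) ≠ 0 := fun i =>
    eval_nodeBasis_self_ne_zero natNodes_injective i
  have hc : ∀ i, c i ≠ 0 := fun i => inv_ne_zero (mul_ne_zero (hc0 i) (hc1 i))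
  obtain ⟨b, hb⟩ : ∃ b : Fin (d + 1) → Fin (s + 1) → K, b = fun i j =>
    c i * (newtonBasis K s d j).eval (natNodes K d i) := ⟨_, rfl⟩
  obtain ⟨δ, hδ⟩ : ∃ δ, δ = (interpMat hsd (samplePoints b)).det := ⟨_, rfl⟩
  have hδ0 : δ ≠ 0 := by
    have hM : ∀ j i, interpMat hsd (samplePoints b) j i = c (Fin.castLE (by omega) i) *
        (newtonBasis K s d j).eval ((i : ℕ) : K) := by
      intro j i
      rw [interpMat_samplePoints, hb]
      rfl
    rw [hδ, Matrix.det_of_isUpperTriangular, Finset.prod_ne_zero_iff]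
    · intro i _
      rw [hM]
      exact mul_ne_zero (hc _) (eval_newtonBasis_self hs i)
    · intro j i hij
      rw [hM, eval_newtonBasis_of_lt (show (i : ℕ) < j from hij), mul_zero]
  have hψ : ∀ j, interpSnd hsd (samplePoints b) j = Polynomial.C δ * newtonBasis K s d j := by
    intro j
    rw [← sub_eq_zero]
    refine Polynomial.eq_zero_of_natDegree_lt_card_of_eval_eq_zero _ (natNodes_injective (d := d))
      (fun i => ?_) ?_
    · rw [interpSnd, Polynomial.eval_sub, Polynomial.eval_finsetSum, Finset.sum_eq_single i]
      · rw [lineBasis_samplePoints, interpWeight_samplePoints, hdet, ← hδ]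
        simp only [Polynomial.eval_mul, Polynomial.eval_C, samplePoints, Sum.elim_inr,
          Fin.snoc_castSucc, hb, c, Fin.val_last, Fin.val_castSucc]
        have := hc0 i
        have := hc1 i
        field_simp
        ring
      · intro l _ hl
        rw [lineBasis_samplePoints, Polynomial.eval_mul, eval_nodeBasis_of_ne _ hl.symm, mul_zero]
      · simp
    · rw [Fintype.card_fin, Nat.lt_succ_iff]
      exact (Polynomial.natDegree_sub_le _ _).trans (max_le (natDegree_interpSnd_le _ _ _)
        ((Polynomial.natDegree_C_mul_le _ _).trans (natDegree_newtonBasis_le hsd j)))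
  refine ⟨samplePoints b, ?_⟩
  simp only [interpDisc, mul_ne_zero_iff, Finset.prod_ne_zero_iff, Finset.mem_univ, true_implies,
    Finset.mem_erase, and_true, interpWeight_samplePoints, ← hδ, hdet]
  refine ⟨⟨⟨fun i => by simp [samplePoints], fun i k hik =>
    sub_ne_zero.mpr (Nat.cast_injective.ne fun h => hik (Fin.ext h))⟩, hδ0, fun _ => hδ0⟩, ?_⟩
  rw [hψ, hψ, newtonBasis_zero hs, mul_one, Polynomial.resultant_C_left]
  simp [hδ0, coeff_newtonBasis_last hsd]

/-- General `d + 2` points of `ℙ¹ × ℙˢ` lie on an irreducible curve of bidegree `(1, d)`, if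
`1 ≤ s ≤ d`. -/
theorem forGeneralPoints_exists_curveThrough [CharZero K] (hs : 1 ≤ s) (hsd : s ≤ d) :
    ForGeneralPoints fun p : Fin (d + 2) → BiProj K 1 s => ∃ C, IsCurveThrough p 1 d C := by
  have heval : ∀ x : Fin (d + 2) × Coord 1 s → K,
      eval x (interpDisc hsd (X : _ → MvPolynomial (Fin (d + 2) × Coord 1 s) K)) =
        interpDisc hsd x := fun x => by simp only [map_interpDisc, eval_X]
  refine forGeneralPoints_of_polynomial (interpDisc hsd X) (fun h0 => ?_) fun p x hx hne => ?_
  · obtain ⟨x, hx⟩ := exists_interpDisc_ne_zero (K := K) hs hsd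
    rw [← heval, h0, map_zero] at hx
    exact hx rfl
  · exact exists_curveThrough_of_interpDisc_ne_zero hs hsd hx (heval x ▸ hne)

end SamplePoints

end BiProjective

theorem mainTheorem9 {K : Type*} [Field K] [IsAlgClosed K] [CharZero K] :
    (∀ n : ℕ, BiProjective.ForGeneralPoints
      fun p : Fin (n + 3) → BiProjective.BiProj K n (n + 1) =>
        ∃ C : Set (BiProjective.BiProj K n (n + 1)),
          BiProjective.IsCurveThrough p n (n + 1) C ∧
          BiProjective.IsSmoothCurve C ∧ BiProjective.IsRationalCurve C ∧
          ∀ C' : Set (BiProjective.BiProj K n (n + 1)),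
            BiProjective.IsCurveThrough p n (n + 1) C' → C' = C) ∧
    (∀ n s : ℕ, s ≤ n + 2 → BiProjective.ForGeneralPoints
      fun p : Fin s → BiProjective.BiProj K n (n + 1) =>
        Dense (BiProjective.sweptLocus p n (n + 1))) ∧
    (∀ s d k : ℕ, 1 ≤ s → s ≤ d → k < d + 2 → BiProjective.ForGeneralPoints
      fun p : Fin k → BiProjective.BiProj K 1 s =>
        Dense (BiProjective.sweptLocus p 1 d)) := by
  refine ⟨BiProjective.forGeneralPoints_exists_unique_distinguished, fun n s hs => ?_,
    fun s d k hs hsd hk => BiProjective.dense_sweptLocus_of_exists hk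
      (BiProjective.forGeneralPoints_exists_curveThrough hs hsd)⟩
  obtain ⟨U, hU, hne, h⟩ := BiProjective.forGeneralPoints_exists_unique_distinguished (K := K) n
  exact BiProjective.dense_sweptLocus_of_exists (Nat.lt_succ_of_le hs)
    ⟨U, hU, hne, fun p hp => (h p hp).imp fun C hC => hC.1⟩
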